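/- **Setting.** Let $H'=\mathbb{C}((t))/\mathbb{C}\cdot 1$ with the symplectic form $\langle f,g\rangle=-\mathrm{Res}_{t=0}\,f\,dg$, let $b_n$ be the class of $t^n$, $H'_+=t\mathbb{C}[[t]]$ and $H_-=t^{-1}\mathbb{C}[t^{-1}]$. Let $\mathfrak{sp}(H')$ be the Lie algebra of continuous endomorphisms $S$ of $H'$ with $\langle Sx,y\rangle+\langle x,Sy\rangle=0$, and $\mathfrak{sp}^+(H')=\{S\in\mathfrak{sp}(H') : S(H'_+)\subseteq H'_+\}$. For a subspace $F\subset H'$ put $\mathfrak{sp}^+_F(H')=\{S\in\mathfrak{sp}^+(H') : S(F^\perp)\subseteq F\}$ and $F^\perp_+=F^\perp\cap H'_+$. An *extended PPAV* of dimension $g$ is a triple $a=(Z,F,L)$ where $Z\subset H'$ is Lagrangian with $Z\cap H'_+=0$, $F\subset Z$ has codimension $g$, and $L\subset F^\perp/F$ is a lattice of rank $2g$ with $L_{\mathbb{R}}\cap F^\perp_+=0$, on which $\frac{1}{2\pi i}\langle\,,\rangle$ is integral and unimodular, such that the complex conjugation of $F^\perp/F=Z/F\oplus F^\perp_+$ given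 by $L_{\mathbb{R}}$ maps $Z/F$ into $F^\perp_+$ and the Hermitian form $B(u,v)=\pi^{-1}\langle\bar u,v\rangle$ on $Z/F$ is positive definite. Its underlying PPAV is the quotient of $Z/F$ by the projection of $L$, polarized by $B$. Let $(X,\Theta)$ be a principally polarized abelian variety of dimension $g$ over $\mathbb{C}$, and let $\mathrm{Sp}(X,\Theta)$ be the set of extended PPAVs with underlying PPAV isomorphic to $(X,\Theta)$. Writing $X=\mathbb{C}^g/\Lambda$, every point of it arises from a pair $(\varphi,h)$, with $\varphi\colon H_-\to H'_+$ a linear map whose graph is $Z$ and $h=(h_1,\dots,h_g)$ a basis of $F^\perp_+$ such that the functionals $\pi^{-1}\langle h_i,\cdot\rangle$ on $Z/F$ form an isomorphism of the underlying PPAV with $\mathbb{C}^g/\Lambda$. Thus $\mathrm{Sp}(X,\Theta)$ is the quotient of the space of pairs $(\varphi,h)$ ($\varphi$ with Lagrangian graph, $h_1,\dots,h_g\in H'_+$ linearly independent) by $\mathrm{Aut}(X,\Theta)$, and this defines its topology and its sheaf $\mathscr{O}$ of holomorphic functions (functions which locally are holomorphic in finitely many of the coefficients of the $\varphi(b_{-n})$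 and of the $h_i$). An element $S\in\mathfrak{sp}^+(H')$ acts on $\mathscr{O}$ by $(Sf)(a)=\frac{d}{d\varepsilon}\big|_{\varepsilon=0}f(e^{-\varepsilon S}a)$. Let $\mathbb{F}\subset H'\,\widehat\otimes\,\mathscr{O}$ be the tautological subsheaf with fiber $F$ at $(Z,F,L)$. Let $\Gamma$ be an even positive definite lattice of finite rank, $\mathfrak{h}_\Gamma=\Gamma\otimes\mathbb{C}$ with orthonormal basis $(H^i)_i$, and let $V$ be one of the Heisenberg vertex algebras $\pi_\Gamma$ (level $\ell=1$) and $\pi_\Gamma^0$ (level $\ell=0$): the Fock module induced from the one-dimensional representation of $\mathfrak{h}_\Gamma[[t]]\oplus\mathbb{C}\mathbf{1}$, with $\mathfrak{h}_\Gamma[[t]]$ acting by $0$ and $\mathbf{1}$ by $\ell$, to $\mathfrak{h}_\Gamma((t))\oplus\mathbb{C}\mathbf{1}$, where $[A\otimes f,B\otimes g]=-(A,B)\,\mathrm{Res}(f\,dg)\,\mathbf{1}$. The algebra $\mathfrak{sp}^+(H')$ acts on $V$: on $\pi_\Gamma$, the element $S$ acts as $\frac12\sum_{m,n\ne0}s_{mn}\sum_i:\!H^i_mH^i_n\!:$,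 where $n\,s_{mn}$ is the coefficient of $b_m$ in $S(b_{-n})$; on $\pi_\Gamma^0=\mathrm{Sym}(\mathfrak{h}_\Gamma\otimes H'/H'_+)$, it acts by the derivation extending $A\otimes f\mapsto A\otimes S(f)$. It acts on $V\otimes\mathscr{O}$ by $S(A\otimes f)=S(A)\otimes f+A\otimes S(f)$. Put $\mathfrak{h}_\Gamma^{\mathrm{out}}(X,\Theta)=\mathfrak{h}_\Gamma\otimes\mathbb{F}$, which acts $\mathscr{O}$-linearly on $V\otimes\mathscr{O}$, and let $$\widehat{\mathbb{V}}(X,\Theta,V)=V\otimes\mathscr{O}\,/\,\mathfrak{h}_\Gamma^{\mathrm{out}}(X,\Theta)(V\otimes\mathscr{O}).$$ For $a=(Z,F,L)$ let $\widehat{\mathbb{V}}(a,V)=V/(\mathfrak{h}_\Gamma\otimes F)(V)$. **Theorem.** (i) The subsheaf $\mathfrak{h}_\Gamma^{\mathrm{out}}(X,\Theta)(V\otimes\mathscr{O})\subset V\otimes\mathscr{O}$ is preserved by the action of $\mathfrak{sp}^+(H')$ on $V\otimes\mathscr{O}$. Hence there is an induced action of the Lie algebra $\mathfrak{sp}^+(H')$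 on the sheaf $\widehat{\mathbb{V}}(X,\Theta,V)$. (ii) For each $a=(Z,F,L)$ in $\mathrm{Sp}(X,\Theta)$, evaluation at $a$ identifies the fiber of $\widehat{\mathbb{V}}(X,\Theta,V)$ at $a$ with $\widehat{\mathbb{V}}(a,V)$, and the action of $\mathfrak{sp}^+(H')$ on $\widehat{\mathbb{V}}(X,\Theta,V)$ induces the trivial action of $\mathfrak{sp}^+_F(H')$ on this fiber: for every local section $\sigma$ near $a$ and every $S\in\mathfrak{sp}^+_F(H')$, the section $S\sigma$ has value $0$ in $\widehat{\mathbb{V}}(a,V)$. -/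

import Mathlib

noncomputable section
namespace HeisPPAV
open scoped TensorProduct ComplexOrder

attribute [local instance] LieRing.ofAssociativeRing

/-! ## The symplectic space `H' = ℂ((t)) / ℂ b₀` -/

/-- The space `H = ℂ((t))`. -/
abbrev LS : Type := LaurentSeries ℂ

/-- The bracket `⟨f, g⟩ = - Res_{t = 0} f dg` of the Heisenberg algebra `H`. -/
def resForm : LinearMap.BilinForm ℂ LS :=
  LinearMap.mk₂ ℂ (fun f g => -(f * LaurentSeries.derivative ℂ g).coeff (-1))
    (fun f f' g => by simp [add_mul]; ring)
    (fun c f g => by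
      rw [← HahnSeries.C_mul_eq_smul, mul_assoc, HahnSeries.C_mul_eq_smul]; simp)
    (fun f g g' => by simp [mul_add]; ring)
    (fun c f g => by
      rw [map_smul, ← HahnSeries.C_mul_eq_smul, mul_left_comm, HahnSeries.C_mul_eq_smul]; simp)

/-- `f ↦ f - f₀`, where `f₀` is the constant term. -/
def dropConst : LS →ₗ[ℂ] LS where
  toFun f := f - HahnSeries.single 0 (f.coeff 0)
  map_add' f g := by
    ext n
    by_cases hn : n = 0 <;> simp [hn, HahnSeries.coeff_single_of_ne]
  map_smul' c f := by
    ext n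
    by_cases hn : n = 0 <;> simp [hn, HahnSeries.coeff_single_of_ne]

/-- `H' = H / ℂ b₀`. -/
def HPrime : Type := LS ⧸ (ℂ ∙ (1 : LS))

instance : AddCommGroup HPrime := inferInstanceAs (AddCommGroup (LS ⧸ (ℂ ∙ (1 : LS))))

instance : Module ℂ HPrime := inferInstanceAs (Module ℂ (LS ⧸ (ℂ ∙ (1 : LS))))

/-- The projection `H → H'`. -/
def toHPrime : LS →ₗ[ℂ] HPrime := (ℂ ∙ (1 : LS)).mkQ

/-- The representative without constant term of a class in `H'`. -/
def rep : HPrime →ₗ[ℂ] LS :=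
  (ℂ ∙ (1 : LS)).liftQ dropConst (by
    rw [Submodule.span_singleton_le_iff_mem, LinearMap.mem_ker]
    ext n
    by_cases hn : n = 0 <;> simp [dropConst, hn, HahnSeries.coeff_one])

/-- The class of `b_n = t ^ n` in `H'`. -/
def b (n : ℤ) : HPrime := toHPrime (HahnSeries.single n 1)

/-- The coefficient of `b_n` in an element of `H'` (it is `0` for `n = 0`). -/
def cf (n : ℤ) : HPrime →ₗ[ℂ] ℂ where
  toFun x := (rep x).coeff n
  map_add' x y := by simp
  map_smul' c x := by simp

/-- The symplectic form on `H'` induced by `⟨ , ⟩`. -/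
def symp : LinearMap.BilinForm ℂ HPrime := resForm.comp rep rep

lemma symp_toHPrime (f g : LS) : symp (toHPrime f) (toHPrime g) = resForm f g := by
  have h1 : rep (toHPrime f) = dropConst f := rfl
  have h2 : rep (toHPrime g) = dropConst g := rfl
  simp only [symp, LinearMap.BilinForm.comp_apply, h1, h2, resForm, dropConst]
  simp

/-- `H_- = t⁻¹ ℂ[t⁻¹]` as a subspace of `H'`. -/
def HMinus : Submodule ℂ HPrime where
  carrier := {x | ∀ n : ℤ, 0 < n → cf n x = 0}
  add_mem' hx hy n hn := by simp [hx n hn, hy n hn]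
  zero_mem' := by simp
  smul_mem' c x hx n hn := by simp [hx n hn]

/-- `H'_+ = t ℂ⟦t⟧` as a subspace of `H'`. -/
def HPlus : Submodule ℂ HPrime where
  carrier := {x | ∀ n : ℤ, n < 0 → cf n x = 0}
  add_mem' hx hy n hn := by simp [hx n hn, hy n hn]
  zero_mem' := by simp
  smul_mem' c x hx n hn := by simp [hx n hn]

lemma toHPrime_rep (x : HPrime) : toHPrime (rep x) = x := by
  obtain ⟨f, rfl⟩ := Submodule.mkQ_surjective _ x
  change toHPrime (dropConst f) = toHPrime f
  rw [← sub_eq_zero, ← map_sub]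
  refine (Submodule.Quotient.mk_eq_zero _).2 (Submodule.mem_span_singleton.2 ⟨-f.coeff 0, ?_⟩)
  ext n
  by_cases hn : n = 0 <;> simp [dropConst, hn, HahnSeries.coeff_one, HahnSeries.coeff_single_of_ne]

lemma hprime_ext {x y : HPrime} (h : ∀ n, cf n x = cf n y) : x = y := by
  rw [← toHPrime_rep x, ← toHPrime_rep y]
  congr 1
  ext n
  exact h n

lemma cf_toHPrime (n : ℤ) (f : LS) : cf n (toHPrime f) = if n = 0 then 0 else f.coeff n := by
  change (dropConst f).coeff n = _
  by_cases hn : n = 0 <;> simp [dropConst, hn, HahnSeries.coeff_single_of_ne]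

lemma cf_zero (x : HPrime) : cf 0 x = 0 := by
  rw [← toHPrime_rep x, cf_toHPrime]; simp

lemma cf_b (n m : ℤ) (hm : m ≠ 0) : cf n (b m) = if n = m then 1 else 0 := by
  rw [b, cf_toHPrime]
  by_cases h : n = m
  · subst h; simp [hm]
  · simp [h, HahnSeries.coeff_single_of_ne]

/-- The projection of `H' = H_- ⊕ H'_+` onto `H_-`. -/
def prMinus : HPrime →ₗ[ℂ] HMinus :=
  LinearMap.codRestrict HMinus (toHPrime ∘ₗ HahnSeries.truncLTLinearMap ℂ 0 ∘ₗ rep) (by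
    intro x n hn
    simp only [LinearMap.comp_apply, cf_toHPrime]
    simp [hn.not_gt])

lemma cf_prMinus (n : ℤ) (x : HPrime) :
    cf n (prMinus x) = if n < 0 then cf n x else 0 := by
  change cf n (toHPrime (HahnSeries.truncLTLinearMap ℂ 0 (rep x))) = _
  rw [cf_toHPrime]
  by_cases hn : n < 0
  · simp [hn, hn.ne, cf]
  · simp [hn]

/-- The projection of `H' = H_- ⊕ H'_+` onto `H'_+`. -/
def prPlus : HPrime →ₗ[ℂ] HPlus :=
  LinearMap.codRestrict HPlus (LinearMap.id - HMinus.subtype ∘ₗ prMinus) (by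
    intro x n hn
    simp [cf_prMinus, hn])

lemma prMinus_add_prPlus (x : HPrime) : (prMinus x : HPrime) + prPlus x = x :=
  add_sub_cancel (prMinus x : HPrime) x

lemma resForm_eq_finsum (f g : LS) :
    resForm f g = ∑ᶠ n : ℤ, (n : ℂ) * f.coeff n * g.coeff (-n) := by
  have hb : resForm f g = ∑ ij ∈ Finset.antidiagonal f.isPWO_support
      (LaurentSeries.derivative ℂ g).isPWO_support (-1),
      ((ij.1 : ℂ) * f.coeff ij.1 * g.coeff (-ij.1)) := by
    change -(f * LaurentSeries.derivative ℂ g).coeff (-1) = _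
    rw [HahnSeries.coeff_mul, ← Finset.sum_neg_distrib]
    refine Finset.sum_congr rfl fun ij hij => ?_
    rw [Finset.mem_antidiagonal] at hij
    have h : ij.2 = -1 - ij.1 := by have := hij.2.2; omega
    rw [LaurentSeries.derivative_apply, LaurentSeries.hasseDeriv_coeff, h]
    simp only [Nat.cast_one, Ring.choose_one_right]
    have h2 : -1 - ij.1 + 1 = -ij.1 := by ring
    rw [h2]
    simp
    ring
  rw [hb]
  rw [finsum_eq_sum_of_support_subset (s := (Finset.antidiagonal f.isPWO_support
      (LaurentSeries.derivative ℂ g).isPWO_support (-1)).image Prod.fst)]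
  · rw [Finset.sum_image]
    intro x hx y hy hxy
    simp only [Finset.mem_coe, Finset.mem_antidiagonal] at hx hy
    ext
    · exact hxy
    · have := hx.2.2; have := hy.2.2; omega
  · intro n hn
    simp only [Function.mem_support, ne_eq, mul_eq_zero, not_or] at hn
    simp only [Finset.coe_image, Set.mem_image, Finset.mem_coe, Finset.mem_antidiagonal]
    refine ⟨(n, -1 - n), ⟨by simpa using hn.1.2, ?_, by ring⟩, rfl⟩
    rw [HahnSeries.mem_support, LaurentSeries.derivative_apply, LaurentSeries.hasseDeriv_coeff]
    have h2 : -1 - n + 1 = -n := by ring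
    simp only [Nat.cast_one, h2, Ring.choose_one_right]
    have : n ≠ 0 := by exact_mod_cast hn.1.1
    simp [this, hn.2]

lemma symp_eq_finsum (x y : HPrime) :
    symp x y = ∑ᶠ n : ℤ, (n : ℂ) * cf n x * cf (-n) y :=
  resForm_eq_finsum _ _

lemma symp_neg_swap (x y : HPrime) : symp x y = -symp y x := by
  rw [symp_eq_finsum, symp_eq_finsum, ← finsum_neg_distrib, ← finsum_comp_equiv (Equiv.neg ℤ)]
  refine finsum_congr fun n => ?_
  simp; ring

lemma symp_b (x : HPrime) (n : ℤ) (hn : n ≠ 0) : symp x (b (-n)) = n * cf n x := by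
  rw [symp_eq_finsum, finsum_eq_single _ n]
  · rw [cf_b _ _ (by simpa using hn)]; simp
  · intro m hm
    rw [cf_b _ _ (by simpa using hn)]; simp [hm]

lemma symp_plus {x y : HPrime} (hx : x ∈ HPlus) (hy : y ∈ HPlus) : symp x y = 0 := by
  rw [symp_eq_finsum]
  refine finsum_eq_zero_of_forall_eq_zero fun n => ?_
  rcases lt_trichotomy n 0 with h | h | h
  · simp [hx n h]
  · simp [h]
  · simp [hy (-n) (by omega)]

lemma symp_minus {x y : HPrime} (hx : x ∈ HMinus) (hy : y ∈ HMinus) : symp x y = 0 := by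
  rw [symp_eq_finsum]
  refine finsum_eq_zero_of_forall_eq_zero fun n => ?_
  rcases lt_trichotomy n 0 with h | h | h
  · simp [hy (-n) (by omega)]
  · simp [h]
  · simp [hx n h]

lemma b_neg_mem {n : ℤ} (hn : 0 < n) : b (-n) ∈ HMinus := by
  intro m hm
  rw [cf_b _ _ (by omega), if_neg (by omega)]

lemma plus_eq_zero {x : HPrime} (hx : x ∈ HPlus) (h : ∀ y ∈ HMinus, symp x y = 0) : x = 0 := by
  refine hprime_ext fun n => ?_
  rw [map_zero]
  rcases lt_trichotomy n 0 with hn | hn | hn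
  · exact hx n hn
  · subst hn; exact cf_zero x
  · have := h _ (b_neg_mem hn)
    rw [symp_b _ _ hn.ne'] at this
    rcases mul_eq_zero.1 this with h | h
    · exact absurd h (by exact_mod_cast hn.ne')
    · exact h

/-! ## Symplectic algebras -/

/-- Continuity of a linear endomorphism of `H'` for the `t`-adic topology. -/
def IsTAdicContinuous (X : Module.End ℂ HPrime) : Prop :=
  ∀ N : ℤ, ∃ M : ℤ, ∀ x : HPrime, (∀ k < M, cf k x = 0) → ∀ k < N, cf k (X x) = 0

/-- The symplectic algebra `sp(H')` of continuous endomorphisms of `H'`. -/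
def sp : LieSubalgebra ℂ (Module.End ℂ HPrime) where
  carrier := {X | IsTAdicContinuous X ∧ ∀ x y, symp (X x) y + symp x (X y) = 0}
  add_mem' := by
    rintro X Y ⟨hX, hX'⟩ ⟨hY, hY'⟩
    refine ⟨fun N => ?_, fun x y => ?_⟩
    · obtain ⟨M, hM⟩ := hX N
      obtain ⟨M', hM'⟩ := hY N
      refine ⟨max M M', fun x hx k hk => ?_⟩
      have h1 := hM x (fun j hj => hx j (lt_max_of_lt_left hj)) k hk
      have h2 := hM' x (fun j hj => hx j (lt_max_of_lt_right hj)) k hk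
      simp [h1, h2]
    · have h1 := hX' x y
      have h2 := hY' x y
      simp only [LinearMap.add_apply, map_add]
      linear_combination h1 + h2
  zero_mem' := ⟨fun N => ⟨0, fun x _ k _ => by simp⟩, fun x y => by simp⟩
  smul_mem' := by
    rintro c X ⟨hX, hX'⟩
    refine ⟨fun N => ?_, fun x y => ?_⟩
    · obtain ⟨M, hM⟩ := hX N
      exact ⟨M, fun x hx k hk => by simp [hM x hx k hk]⟩
    · have h1 := hX' x y
      simp only [LinearMap.smul_apply, map_smul, smul_eq_mul]
      linear_combination c * h1
  lie_mem' := by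
    rintro X Y ⟨hX, hX'⟩ ⟨hY, hY'⟩
    refine ⟨fun N => ?_, fun x y => ?_⟩
    · obtain ⟨M, hM⟩ := hX N
      obtain ⟨M1, hM1⟩ := hY M
      obtain ⟨M', hM'⟩ := hY N
      obtain ⟨M2, hM2⟩ := hX M'
      refine ⟨max M1 M2, fun x hx k hk => ?_⟩
      have h1 := hM _ (hM1 x fun j hj => hx j (lt_max_of_lt_left hj)) k hk
      have h2 := hM' _ (hM2 x fun j hj => hx j (lt_max_of_lt_right hj)) k hk
      simp [Ring.lie_def, h1, h2]
    · have h1 := hX' (Y x) y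
      have h2 := hY' (X x) y
      have h3 := hX' x (Y y)
      have h4 := hY' x (X y)
      simp only [Ring.lie_def, LinearMap.sub_apply, Module.End.mul_apply, map_sub]
      linear_combination h1 - h2 + h3 - h4

/-- `sp⁺(H')`, the elements of `sp(H')` which preserve `H'_+`. -/
def spPlus : LieSubalgebra ℂ (Module.End ℂ HPrime) where
  carrier := {X | X ∈ sp ∧ ∀ x ∈ HPlus, X x ∈ HPlus}
  add_mem' := fun hX hY =>
    ⟨add_mem hX.1 hY.1, fun x hx => add_mem (hX.2 x hx) (hY.2 x hx)⟩
  zero_mem' := ⟨zero_mem _, fun _ _ => zero_mem _⟩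
  smul_mem' := fun c _ hX =>
    ⟨Submodule.smul_mem _ c hX.1, fun x hx => Submodule.smul_mem _ c (hX.2 x hx)⟩
  lie_mem' := fun hX hY =>
    ⟨LieSubalgebra.lie_mem _ hX.1 hY.1, fun x hx =>
      sub_mem (hX.2 _ (hY.2 x hx)) (hY.2 _ (hX.2 x hx))⟩

/-- `sp_F(H') = {X ∈ sp(H') | X(F^⊥) ⊆ F}`. -/
def spF (F : Submodule ℂ HPrime) : Submodule ℂ (Module.End ℂ HPrime) where
  carrier := {X | X ∈ sp ∧ ∀ x ∈ symp.orthogonal F, X x ∈ F}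
  add_mem' := fun hX hY =>
    ⟨add_mem hX.1 hY.1, fun x hx => add_mem (hX.2 x hx) (hY.2 x hx)⟩
  zero_mem' := ⟨zero_mem _, fun _ _ => zero_mem _⟩
  smul_mem' := fun c _ hX =>
    ⟨Submodule.smul_mem _ c hX.1, fun x hx => Submodule.smul_mem _ c (hX.2 x hx)⟩

/-- The isotropy algebra `sp⁺_F(H') = sp⁺(H') ∩ sp_F(H')`. -/
def spPlusF (F : Submodule ℂ HPrime) : Submodule ℂ (Module.End ℂ HPrime) :=
  spPlus.toSubmodule ⊓ spF F

/-! ## Extended PPAVs -/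

/-- `F^⊥_+ = F^⊥ ∩ H'_+`. -/
def perpPlus (F : Submodule ℂ HPrime) : Submodule ℂ HPrime := symp.orthogonal F ⊓ HPlus

/-- With `K ⊆ F^⊥` the preimage of a lattice `L ⊂ F^⊥/F`, the real span of `K` is the preimage of
`L_ℝ`. The classes of `x` and `y` in `F^⊥/F` are conjugate for the real structure given by `L_ℝ`
when `x + y` and `i (x - y)` are both real. -/
def IsConjugate (K : AddSubgroup HPrime) (x y : HPrime) : Prop :=
  x + y ∈ Submodule.span ℝ (K : Set HPrime) ∧
    Complex.I • (x - y) ∈ Submodule.span ℝ (K : Set HPrime)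

/-- An extended PPAV `(Z, F, L)` of dimension `g`. The lattice `L ⊂ F^⊥/F` is recorded by its
preimage `K` under `F^⊥ → F^⊥/F`, that is, `L = K/F`. -/
@[ext]
structure ExtPPAV (g : ℕ) where
  Z : Submodule ℂ HPrime
  F : Submodule ℂ HPrime
  K : AddSubgroup HPrime
  /-- `Z` is Lagrangian -/
  lagrangian : symp.orthogonal Z = Z
  F_le_Z : F ≤ Z
  /-- `F` has codimension `g` in `Z` -/
  codim : Module.rank ℂ (Z ⧸ F.submoduleOf Z) = g
  F_le_K : F.toAddSubgroup ≤ K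
  K_le : K ≤ (symp.orthogonal F).toAddSubgroup
  /-- `L = K/F` is a lattice of rank `2g` -/
  lattice : ∃ v : Fin (2 * g) → HPrime, LinearIndependent ℝ (fun i => F.mkQ (v i)) ∧
    K = F.toAddSubgroup ⊔ AddSubgroup.closure (Set.range v)
  /-- `Z ∩ H'_+ = 0` -/
  transversal : Z ⊓ HPlus = ⊥
  /-- `L_ℝ ∩ F^⊥_+ = 0` in `F^⊥/F` -/
  real_inter : ∀ x ∈ perpPlus F, x ∈ Submodule.span ℝ (K : Set HPrime) → x = 0
  /-- the real structure on `F^⊥/F` given by `L_ℝ` identifies `F^⊥_+` with the conjugate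
  of `Z/F` -/
  conj : ∀ z ∈ Z, ∃ w ∈ perpPlus F, IsConjugate K z w
  /-- `(2πi)⁻¹ ⟨ , ⟩` is integral on `L` -/
  integral : ∀ x ∈ K, ∀ y ∈ K, ∃ n : ℤ, symp x y = 2 * Real.pi * Complex.I * n
  /-- `(2πi)⁻¹ ⟨ , ⟩` is unimodular on `L`: the map `L → Hom(L, ℤ)` is injective ... -/
  unimodular_inj : ∀ x ∈ K, (∀ y ∈ K, symp x y = 0) → x ∈ F
  /-- ... and surjective -/
  unimodular_surj : ∀ f : K →+ ℤ, (∀ x : K, (x : HPrime) ∈ F → f x = 0) →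
    ∃ x ∈ K, ∀ y : K, symp x y = 2 * Real.pi * Complex.I * f y
  /-- the Hermitian form `B(u, v) = π⁻¹ ⟨ū, v⟩` on `Z/F` is positive definite -/
  positive : ∀ z ∈ Z, ∀ w ∈ perpPlus F, IsConjugate K z w → z ∉ F →
    0 < ((Real.pi : ℂ)⁻¹ * symp w z).re

/-- The Hermitian form on `ℂ^g` with matrix `M`, antilinear in the first variable. -/
def herm {g : ℕ} (M : Matrix (Fin g) (Fin g) ℂ) (u v : Fin g → ℂ) : ℂ :=
  dotProduct (star u) (M.mulVec v)

/-- A principally polarized abelian variety `X = ℂ^g/Λ` of dimension `g`, with the polarization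
given by a positive definite Hermitian form whose imaginary part is integral and unimodular
on the lattice `Λ`. -/
structure PPAV (g : ℕ) where
  Λ : Submodule ℤ (Fin g → ℂ)
  discrete : DiscreteTopology Λ
  spans : Submodule.span ℝ (Λ : Set (Fin g → ℂ)) = ⊤
  M : Matrix (Fin g) (Fin g) ℂ
  posDef : M.PosDef
  integral : ∀ x ∈ Λ, ∀ y ∈ Λ, ∃ n : ℤ, (herm M x y).im = n
  unimodular_inj : ∀ x ∈ Λ, (∀ y ∈ Λ, (herm M x y).im = 0) → x = 0
  unimodular_surj : ∀ f : Λ →+ ℤ, ∃ x ∈ Λ, ∀ y : Λ, (herm M x y).im = f y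

/-- The PPAV determined by `(Z, F, L)` is isomorphic to `(X, Θ)`: there is a linear isomorphism
`Z/F ≅ ℂ^g` taking the image of `L` under `F^⊥/F = Z/F ⊕ F^⊥_+ → Z/F` to the lattice of `X` and the
form `B(u, v) = π⁻¹ ⟨ū, v⟩` to the one of `Θ`. -/
def ExtPPAV.HasUnderlying {g : ℕ} (a : ExtPPAV g) (X : PPAV g) : Prop :=
  ∃ ψ : a.Z →ₗ[ℂ] (Fin g → ℂ),
    Function.Surjective ψ ∧ (∀ z : a.Z, ψ z = 0 ↔ (z : HPrime) ∈ a.F) ∧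
    (∀ z : a.Z, ψ z ∈ X.Λ ↔ ∃ w ∈ perpPlus a.F, (z : HPrime) + w ∈ a.K) ∧
    ∀ z z' : a.Z, ∀ w ∈ perpPlus a.F, IsConjugate a.K z w →
      (Real.pi : ℂ)⁻¹ * symp w z' = herm X.M (ψ z) (ψ z')

/-- `Sp(X, Θ)`: the extended PPAVs with underlying PPAV `(X, Θ)`. -/
def SpX {g : ℕ} (X : PPAV g) : Type := {a : ExtPPAV g // a.HasUnderlying X}

/-! ## The complex manifold structure on `Sp(X, Θ)` -/

/-- The space of symmetric linear maps `φ : H_- → H'_+`, i.e. those for which `⟨a, φ(b)⟩` is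
symmetric in `a` and `b`; equivalently, the graph of `φ` is Lagrangian. -/
def SymMap : Submodule ℂ (HMinus →ₗ[ℂ] HPlus) where
  carrier := {φ | ∀ x y : HMinus, symp x (φ y) = symp y (φ x)}
  add_mem' := fun hφ hψ x y => by simp [hφ x y, hψ x y]
  zero_mem' := fun x y => by simp
  smul_mem' := fun c φ hφ x y => by simp [hφ x y]

/-- Pairs `(φ, h)` with `φ` symmetric and `h ∈ (H'_+)^g`. -/
structure Model (g : ℕ) where
  φ : SymMap
  h : Fin g → HPlus

namespace Model

variable {g : ℕ}

/-- `h` is a frame, so that `(φ, h)` is a point of `S̃²(H'_+) × 𝓑_g(H'_+)`. -/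
def IsFrame (p : Model g) : Prop := LinearIndependent ℂ p.h

/-- The coordinates of `(φ, h)`: the coefficients of `φ(b_k)` and of `h_i`. -/
def coord (p : Model g) : (ℤ × ℤ) ⊕ (Fin g × ℤ) → ℂ
  | Sum.inl (k, l) => cf l (p.φ.1 (prMinus (b k)))
  | Sum.inr (i, l) => cf l (p.h i)

/-- The topology of coordinatewise convergence. -/
instance : TopologicalSpace (Model g) := TopologicalSpace.induced coord inferInstance

/-- A function is holomorphic at `p` when, near `p`, it is a holomorphic function of finitely many
of the coordinates. -/
def HolAt (f : Model g → ℂ) (p : Model g) : Prop :=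
  ∃ (s : Finset ((ℤ × ℤ) ⊕ (Fin g × ℤ))) (G : (s → ℂ) → ℂ),
    AnalyticAt ℂ G (fun i => p.coord i) ∧ ∀ᶠ q in nhds p, f q = G (fun i => q.coord i)

/-- The map `H_- → H'` with `x ↦ x + φ(x)`. -/
def graphMap (p : Model g) : HMinus →ₗ[ℂ] HPrime := HMinus.subtype + HPlus.subtype ∘ₗ p.φ.1

/-- The Lagrangian subspace `Z`: the graph of `φ`. -/
def Z (p : Model g) : Submodule ℂ HPrime := LinearMap.range p.graphMap

/-- The linear forms `π⁻¹ ⟨h_i, ·⟩`. -/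
def psi (p : Model g) : HPrime →ₗ[ℂ] (Fin g → ℂ) :=
  LinearMap.pi fun i => (Real.pi : ℂ)⁻¹ • symp (p.h i)

/-- The subspace `F` of `Z` defined by `h_1 = ⋯ = h_g = 0`. -/
def F (p : Model g) : Submodule ℂ HPrime := p.Z ⊓ LinearMap.ker p.psi

/-- The element `w` in the span of the `h_i` with `π⁻¹ ⟨w, z⟩ = B(u, ψ(z))`, where `B` is the
Hermitian form of `(X, Θ)`. -/
def bar (X : PPAV g) (p : Model g) (u : Fin g → ℂ) : HPrime :=
  ∑ i, (Matrix.vecMul (star u) X.M i) • (p.h i : HPrime)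

lemma bar_add (X : PPAV g) (p : Model g) (u v : Fin g → ℂ) :
    p.bar X (u + v) = p.bar X u + p.bar X v := by
  simp [bar, Matrix.add_vecMul, add_smul, Finset.sum_add_distrib]

lemma bar_smul (X : PPAV g) (p : Model g) (c : ℂ) (u : Fin g → ℂ) :
    p.bar X (c • u) = star c • p.bar X u := by
  simp [bar, Matrix.smul_vecMul, mul_smul, Finset.smul_sum]

/-- The preimage `K` of the lattice `L = {(λ, λ̄) | λ ∈ Λ} ⊂ Z/F ⊕ F^⊥_+`, where `Z/F` is
identified with `ℂ^g ⊃ Λ` by means of the frame. -/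
def K (X : PPAV g) (p : Model g) : AddSubgroup HPrime where
  carrier := {x | ∃ z ∈ p.Z, p.psi z ∈ X.Λ ∧ x = z + p.bar X (p.psi z)}
  add_mem' := by
    rintro _ _ ⟨z, hz, hl, rfl⟩ ⟨z', hz', hl', rfl⟩
    refine ⟨z + z', add_mem hz hz', by rw [map_add]; exact add_mem hl hl', ?_⟩
    rw [map_add, bar_add]; abel
  zero_mem' := ⟨0, zero_mem _, by simp, by simp [bar]⟩
  neg_mem' := by
    rintro _ ⟨z, hz, hl, rfl⟩
    refine ⟨-z, neg_mem hz, by rw [map_neg]; exact neg_mem hl, ?_⟩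
    have := p.bar_smul X (-1) (p.psi z)
    simp only [neg_smul, one_smul, star_neg, star_one] at this
    rw [map_neg, this]; abel

variable (p : Model g) (X : PPAV g)

lemma graphMap_apply (x : HMinus) : p.graphMap x = x + p.φ.1 x := rfl

lemma symp_graph (x y : HMinus) : symp (p.graphMap x) (p.graphMap y) = 0 := by
  simp only [graphMap_apply, map_add, LinearMap.add_apply, symp_minus x.2 y.2,
    symp_plus (p.φ.1 x).2 (p.φ.1 y).2, p.φ.2 x y]
  rw [symp_neg_swap (p.φ.1 x) y]; ring

lemma sub_graph_mem (x : HPrime) : x - p.graphMap (prMinus x) ∈ HPlus := by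
  rw [graphMap_apply, ← sub_sub, sub_eq_of_eq_add' (prMinus_add_prPlus x).symm]
  exact sub_mem (prPlus x).2 (p.φ.1 _).2

lemma symp_plus_graph {w : HPrime} (hw : w ∈ HPlus) (x : HMinus) :
    symp w (p.graphMap x) = symp w x := by
  rw [graphMap_apply, map_add, symp_plus hw (p.φ.1 x).2, add_zero]

lemma lagrangian : symp.orthogonal p.Z = p.Z := by
  ext x
  constructor
  · intro hx
    have h0 : x - p.graphMap (prMinus x) = 0 := by
      refine plus_eq_zero (p.sub_graph_mem x) fun y hy => ?_
      rw [← p.symp_plus_graph (p.sub_graph_mem x) ⟨y, hy⟩, map_sub, LinearMap.sub_apply,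
        symp_graph, sub_zero, symp_neg_swap]
      rw [hx _ ⟨_, rfl⟩, neg_zero]
    rw [sub_eq_zero] at h0
    exact ⟨_, h0.symm⟩
  · rintro ⟨y, rfl⟩ _ ⟨z, rfl⟩
    exact p.symp_graph z y

lemma Z_inf_plus {x : HPrime} (hx : x ∈ p.Z) (hx' : x ∈ HPlus) : x = 0 := by
  refine plus_eq_zero hx' fun y hy => ?_
  obtain ⟨z, rfl⟩ := hx
  rw [← p.symp_plus_graph hx' ⟨y, hy⟩, symp_graph]

lemma psi_plus {w : HPrime} (hw : w ∈ HPlus) : p.psi w = 0 := by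
  ext i
  simp [psi, symp_plus (p.h i).2 hw]

lemma bar_mem_plus (u : Fin g → ℂ) : p.bar X u ∈ HPlus :=
  Submodule.sum_mem _ fun i _ => Submodule.smul_mem _ _ (p.h i).2

lemma symp_bar (u : Fin g → ℂ) (x : HPrime) :
    symp (p.bar X u) x = Real.pi * herm X.M u (p.psi x) := by
  have hpi : (Real.pi : ℂ) ≠ 0 := by exact_mod_cast Real.pi_ne_zero
  rw [herm, Matrix.dotProduct_mulVec, dotProduct, Finset.mul_sum, bar, map_sum,
    LinearMap.sum_apply]
  refine Finset.sum_congr rfl fun i _ => ?_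
  simp only [map_smul, LinearMap.smul_apply, smul_eq_mul, psi, LinearMap.pi_apply]
  field_simp

lemma bar_mem (u : Fin g → ℂ) : p.bar X u ∈ perpPlus p.F := by
  refine ⟨fun x hx => ?_, p.bar_mem_plus X u⟩
  change symp x _ = 0
  rw [symp_neg_swap, symp_bar, (LinearMap.mem_ker.1 hx.2)]
  simp [herm]

lemma psi_surj (hp : p.IsFrame) (u : Fin g → ℂ) : ∃ z ∈ p.Z, p.psi z = u := by
  by_contra hu
  have hlt : Submodule.map p.psi p.Z < ⊤ := by
    rw [lt_top_iff_ne_top]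
    intro h
    have : u ∈ Submodule.map p.psi p.Z := by rw [h]; trivial
    obtain ⟨z, hz, hzu⟩ := this
    exact hu ⟨z, hz, hzu⟩
  obtain ⟨f, hf, hfle⟩ := Submodule.exists_le_ker_of_lt_top _ hlt
  apply hf
  have key : ∑ i, f (Pi.single i 1) • p.h i = 0 := by
    apply Subtype.ext
    refine plus_eq_zero (Subtype.mem _) fun y hy => ?_
    rw [← p.symp_plus_graph (Subtype.mem _) ⟨y, hy⟩]
    have h0 : f (p.psi (p.graphMap ⟨y, hy⟩)) = 0 := hfle ⟨_, ⟨_, rfl⟩, rfl⟩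
    rw [LinearMap.pi_apply_eq_sum_univ f] at h0
    have hpi : (Real.pi : ℂ) ≠ 0 := by exact_mod_cast Real.pi_ne_zero
    simp only [psi, LinearMap.pi_apply, LinearMap.smul_apply, smul_eq_mul, mul_assoc] at h0
    rw [← Finset.mul_sum] at h0
    have h1 := (mul_eq_zero.1 h0).resolve_left (inv_ne_zero hpi)
    simp only [Submodule.coe_sum, Submodule.coe_smul, map_sum, map_smul, LinearMap.sum_apply,
      LinearMap.smul_apply, smul_eq_mul]
    rw [← h1]
    refine Finset.sum_congr rfl fun i _ => ?_
    have : (fun j => if i = j then (1 : ℂ) else 0) = Pi.single i 1 := by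
      ext j; simp [Pi.single_apply, eq_comm]
    rw [this]; ring
  have hz := Fintype.linearIndependent_iff.1 hp _ key
  refine LinearMap.pi_ext' fun i => ?_
  ext
  simpa using hz i

lemma span_K {x : HPrime} (hx : x ∈ Submodule.span ℝ (p.K X : Set HPrime)) :
    ∃ z ∈ p.Z, x = z + p.bar X (p.psi z) := by
  induction hx using Submodule.span_induction with
  | mem x hx =>
    obtain ⟨z, hz, -, h⟩ := hx
    exact ⟨z, hz, h⟩
  | zero => exact ⟨0, zero_mem _, by simp [bar]⟩
  | add x y _ _ hx hy =>
    obtain ⟨z, hz, rfl⟩ := hx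
    obtain ⟨z', hz', rfl⟩ := hy
    exact ⟨z + z', add_mem hz hz', by rw [map_add, bar_add]; abel⟩
  | smul c x _ hx =>
    obtain ⟨z, hz, rfl⟩ := hx
    refine ⟨(c : ℂ) • z, Submodule.smul_mem _ _ hz, ?_⟩
    rw [map_smul, bar_smul, smul_add]
    congr 1
    simp

lemma K_of_F {x : HPrime} (hx : x ∈ p.F) : x ∈ p.K X :=
  ⟨x, hx.1, by rw [LinearMap.mem_ker.1 hx.2]; exact zero_mem _,
    by rw [LinearMap.mem_ker.1 hx.2]; simp [bar]⟩

lemma span_K_mem (hp : p.IsFrame) {z : HPrime} (hz : z ∈ p.Z) :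
    z + p.bar X (p.psi z) ∈ Submodule.span ℝ (p.K X : Set HPrime) := by
  have hu : p.psi z ∈ Submodule.span ℝ (X.Λ : Set (Fin g → ℂ)) := by rw [X.spans]; trivial
  suffices h : ∀ u ∈ Submodule.span ℝ (X.Λ : Set (Fin g → ℂ)), ∀ z ∈ p.Z, p.psi z = u →
      z + p.bar X (p.psi z) ∈ Submodule.span ℝ (p.K X : Set HPrime) from h _ hu z hz rfl
  intro u hu
  induction hu using Submodule.span_induction with
  | mem u hu =>
    intro z hz hzu
    exact Submodule.subset_span ⟨z, hz, by rw [hzu]; exact hu, rfl⟩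
  | zero =>
    intro z hz hzu
    rw [hzu]
    refine Submodule.subset_span ?_
    simpa [bar] using p.K_of_F X ⟨hz, hzu⟩
  | add u v _ _ hu hv =>
    intro z hz hzu
    obtain ⟨y, hy, hyv⟩ := p.psi_surj hp v
    have h1 := hu (z - y) (sub_mem hz hy) (by rw [map_sub, hzu, hyv]; simp)
    have h2 := hv y hy hyv
    have := add_mem h1 h2
    convert this using 1
    have h3 := p.bar_add X (p.psi (z - y)) (p.psi y)
    rw [← map_add, sub_add_cancel] at h3
    rw [h3]; abel
  | smul c u _ hu =>
    intro z hz hzu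
    obtain ⟨y, hy, hyu⟩ := p.psi_surj hp u
    have h1 := Submodule.smul_mem _ c (hu y hy hyu)
    have h2 : z - (c : ℂ) • y ∈ p.K X := by
      refine p.K_of_F X ⟨sub_mem hz (Submodule.smul_mem _ _ hy), ?_⟩
      change p.psi (z - (c : ℂ) • y) = 0
      rw [map_sub, map_smul, hzu, hyu]
      ext i; simp
    have := add_mem (Submodule.subset_span h2) h1
    convert this using 1
    rw [hzu, ← hyu]
    have h3 := p.bar_smul X (c : ℂ) (p.psi y)
    have h4 : c • p.psi y = (c : ℂ) • p.psi y := by ext i; simp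
    have h5 : c • (y + p.bar X (p.psi y)) = (c : ℂ) • (y + p.bar X (p.psi y)) := rfl
    rw [h4, h3, h5, smul_add, Complex.star_def, Complex.conj_ofReal]
    abel

lemma real_inter {x : HPrime} (hx : x ∈ HPlus)
    (hx' : x ∈ Submodule.span ℝ (p.K X : Set HPrime)) : x = 0 := by
  obtain ⟨z, hz, rfl⟩ := p.span_K X hx'
  have hz' : z ∈ HPlus := by
    have := sub_mem hx (p.bar_mem_plus X (p.psi z))
    simpa using this
  have h0 := p.Z_inf_plus hz hz'
  simp [h0, bar]

lemma isConjugate (hp : p.IsFrame) {z : HPrime} (hz : z ∈ p.Z) :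
    IsConjugate (p.K X) z (p.bar X (p.psi z)) := by
  refine ⟨p.span_K_mem X hp hz, ?_⟩
  have := p.span_K_mem X hp (Submodule.smul_mem _ Complex.I hz)
  rw [map_smul, bar_smul] at this
  convert this using 1
  simp [sub_eq_add_neg]

lemma eq_bar (hp : p.IsFrame) {z w : HPrime} (hz : z ∈ p.Z) (hw : w ∈ HPlus)
    (h : IsConjugate (p.K X) z w) : w = p.bar X (p.psi z) := by
  rw [← sub_eq_zero]
  refine p.real_inter X (sub_mem hw (p.bar_mem_plus X _)) ?_
  have := sub_mem h.1 (p.isConjugate X hp hz).1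
  simpa using this

lemma herm_swap (u v : Fin g → ℂ) : herm X.M v u = star (herm X.M u v) := by
  have h := X.posDef.1
  rw [herm, herm, Matrix.star_dotProduct, Matrix.star_mulVec, h.eq,
    ← Matrix.dotProduct_mulVec]

lemma symp_K {z z' : HPrime} (hz : z ∈ p.Z) (hz' : z' ∈ p.Z) :
    symp (z + p.bar X (p.psi z)) (z' + p.bar X (p.psi z')) =
      2 * Real.pi * Complex.I * ((herm X.M (p.psi z) (p.psi z')).im : ℂ) := by
  have h0 : symp z z' = 0 := by
    have : z' ∈ symp.orthogonal p.Z := by rw [p.lagrangian]; exact hz'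
    exact this z hz
  have h1 := symp_plus (p.bar_mem_plus X (p.psi z)) (p.bar_mem_plus X (p.psi z'))
  simp only [map_add, LinearMap.add_apply, h0, h1]
  rw [symp_neg_swap z, symp_bar, symp_bar, herm_swap X (p.psi z) (p.psi z')]
  apply Complex.ext
  · simp
  · simp; ring

end Model

/-- The extended PPAV `(Z, F, L)` assigned to `(φ, h)`. -/
def Model.toExt {g : ℕ} (X : PPAV g) (p : Model g) (hp : p.IsFrame) : ExtPPAV g where
  Z := p.Z
  F := p.F
  K := p.K X
  lagrangian := p.lagrangian
  F_le_Z := inf_le_left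
  codim := by
    have hs : Function.Surjective (p.psi ∘ₗ p.Z.subtype) := fun u => by
      obtain ⟨z, hz, h⟩ := p.psi_surj hp u
      exact ⟨⟨z, hz⟩, h⟩
    have hk : p.F.submoduleOf p.Z = LinearMap.ker (p.psi ∘ₗ p.Z.subtype) := by
      ext z
      exact ⟨fun h => h.2, fun h => ⟨z.2, h⟩⟩
    rw [hk, (LinearMap.quotKerEquivOfSurjective _ hs).rank_eq]
    simp
  F_le_K := fun _ hx => p.K_of_F X hx
  K_le := by
    rintro _ ⟨z, hz, -, rfl⟩ x hx
    have h1 : z ∈ symp.orthogonal p.Z := by rw [p.lagrangian]; exact hz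
    change symp x (z + _) = 0
    rw [map_add, h1 x hx.1, zero_add]
    exact (p.bar_mem X _).1 x hx
  lattice := by
    have := X.discrete
    have : IsZLattice ℝ X.Λ := ⟨X.spans⟩
    have := ZLattice.module_free ℝ X.Λ
    have := ZLattice.module_finite ℝ X.Λ
    have hr : Module.finrank ℤ X.Λ = 2 * g := by
      rw [ZLattice.rank ℝ X.Λ, Module.finrank_pi_fintype]
      simp [Complex.finrank_real_complex, mul_comm]
    let β : Module.Basis (Fin (2 * g)) ℤ X.Λ := (Module.finBasisOfFinrankEq ℤ X.Λ hr)
    have hβ : LinearIndependent ℝ (fun i => (β i : Fin g → ℂ)) := by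
      have := (β.ofZLatticeBasis ℝ X.Λ).linearIndependent
      have h : (fun i => (β i : Fin g → ℂ)) = β.ofZLatticeBasis ℝ X.Λ := by
        ext i : 1
        simp
      rw [h]
      exact this
    choose z hz hzu using fun i => p.psi_surj hp (β i)
    let v : Fin (2 * g) → HPrime := fun i => z i + p.bar X (p.psi (z i))
    refine ⟨v, ?_, ?_⟩
    · let q : (HPrime ⧸ p.F) →ₗ[ℂ] (Fin g → ℂ) := p.F.liftQ p.psi (fun x hx => hx.2)
      refine LinearIndependent.of_comp (q.restrictScalars ℝ) ?_
      convert hβ using 1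
      ext i : 1
      change p.psi (z i + p.bar X (p.psi (z i))) = _
      rw [map_add, p.psi_plus (p.bar_mem_plus X _), add_zero, hzu]
    · apply le_antisymm
      · rintro _ ⟨y, hy, hl, rfl⟩
        have hrepr := β.sum_repr ⟨p.psi y, hl⟩
        have hrepr' : ∑ i, (β.repr ⟨p.psi y, hl⟩ i : ℂ) • p.psi (z i) = p.psi y := by
          have := congrArg Subtype.val hrepr
          simp only [AddSubmonoidClass.coe_finsetSum, Submodule.coe_smul] at this
          refine Eq.trans (Finset.sum_congr rfl fun i _ => ?_) this
          rw [hzu, Int.cast_smul_eq_zsmul]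
        set n := fun i => β.repr ⟨p.psi y, hl⟩ i with hn
        have hbar : p.bar X (p.psi y) = ∑ i, (n i : ℂ) • p.bar X (p.psi (z i)) := by
          let B : (Fin g → ℂ) →+ HPrime := AddMonoidHom.mk' (p.bar X) (p.bar_add X)
          rw [← hrepr']
          change B _ = _
          rw [map_sum]
          refine Finset.sum_congr rfl fun i _ => ?_
          change p.bar X _ = _
          rw [p.bar_smul]
          simp [hn]
        have h1 : y + p.bar X (p.psi y) =
            (y - ∑ i, (n i : ℂ) • z i) + ∑ i, (n i : ℂ) • v i := by
          rw [hbar]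
          simp only [v, smul_add, Finset.sum_add_distrib]
          abel
        rw [h1]
        refine add_mem (AddSubgroup.mem_sup_left ?_) (AddSubgroup.mem_sup_right ?_)
        · refine ⟨sub_mem hy (Submodule.sum_mem _ fun i _ => Submodule.smul_mem _ _ (hz i)), ?_⟩
          change p.psi _ = 0
          rw [map_sub, map_sum, sub_eq_zero, ← hrepr']
          exact Finset.sum_congr rfl fun i _ => (map_smul _ _ _).symm
        · refine sum_mem fun i _ => ?_
          rw [Int.cast_smul_eq_zsmul]
          have hv : v i ∈ AddSubgroup.closure (Set.range v) :=
            AddSubgroup.subset_closure (Set.mem_range_self i)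
          exact zsmul_mem hv _
      · refine sup_le (fun _ hx => p.K_of_F X hx) ?_
        rw [AddSubgroup.closure_le]
        rintro _ ⟨i, rfl⟩
        exact ⟨z i, hz i, by rw [hzu]; exact (β i).2, rfl⟩
  transversal := by
    rw [eq_bot_iff]
    intro x hx
    exact p.Z_inf_plus hx.1 hx.2
  real_inter := fun _ hx hx' => p.real_inter X hx.2 hx'
  conj := fun z hz => ⟨_, p.bar_mem X (p.psi z), p.isConjugate X hp hz⟩
  integral := by
    rintro _ ⟨z, hz, hl, rfl⟩ _ ⟨z', hz', hl', rfl⟩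
    obtain ⟨n, hn⟩ := X.integral _ hl _ hl'
    exact ⟨n, by rw [p.symp_K X hz hz', hn]; simp⟩
  unimodular_inj := by
    rintro _ ⟨z, hz, hl, rfl⟩ h
    have h0 : p.psi z = 0 := by
      refine X.unimodular_inj _ hl fun y hy => ?_
      obtain ⟨z', hz', rfl⟩ := p.psi_surj hp y
      have := h _ ⟨z', hz', hy, rfl⟩
      rw [p.symp_K X hz hz'] at this
      simpa [Real.pi_ne_zero] using this
    have hF : z ∈ p.F := ⟨hz, h0⟩
    rw [h0]
    simpa [Model.bar] using hF
  unimodular_surj := by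
    intro f hf
    obtain ⟨σ, hσ⟩ := (p.psi ∘ₗ p.Z.subtype).exists_rightInverse_of_surjective
      (LinearMap.range_eq_top.2 fun u => by
        obtain ⟨z, hz, h⟩ := p.psi_surj hp u
        exact ⟨⟨z, hz⟩, h⟩)
    have hσ' : ∀ u, p.psi (σ u) = u := fun u => LinearMap.congr_fun hσ u
    let j : X.Λ →+ p.K X := AddMonoidHom.mk'
      (fun u => ⟨σ u + p.bar X (p.psi (σ u)), σ u, (σ u).2, by rw [hσ']; exact u.2, rfl⟩)
      (fun u v => by
        apply Subtype.ext
        simp only [Submodule.coe_add, map_add, p.bar_add, AddSubgroup.coe_add]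
        abel)
    obtain ⟨x, hx, hxf⟩ := X.unimodular_surj (f.comp j)
    refine ⟨j ⟨x, hx⟩, (j ⟨x, hx⟩).2, ?_⟩
    rintro ⟨_, z, hz, hl, rfl⟩
    change symp (σ x + p.bar X (p.psi (σ x))) _ = _
    rw [p.symp_K X (σ x).2 hz, hσ']
    have h1 := hxf ⟨p.psi z, hl⟩
    change (herm X.M x (p.psi z)).im = _ at h1
    rw [h1, AddMonoidHom.comp_apply]
    have h2 : f (⟨z + p.bar X (p.psi z), z, hz, hl, rfl⟩ - j ⟨p.psi z, hl⟩) = 0 := by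
      apply hf
      change z + p.bar X (p.psi z) - (σ (p.psi z) + p.bar X (p.psi (σ (p.psi z)))) ∈ p.F
      rw [hσ']
      refine ⟨?_, ?_⟩
      · rw [add_sub_add_right_eq_sub]; exact sub_mem hz (σ _).2
      · change p.psi _ = 0
        rw [add_sub_add_right_eq_sub, map_sub, hσ', sub_self]
    rw [map_sub, sub_eq_zero] at h2
    rw [h2]
    simp
  positive := by
    intro z hz w hw hc hzF
    rw [p.eq_bar X hp hz hw.2 hc, p.symp_bar]
    have hpi : (Real.pi : ℂ) ≠ 0 := by exact_mod_cast Real.pi_ne_zero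
    rw [← mul_assoc, inv_mul_cancel₀ hpi, one_mul]
    have h0 : p.psi z ≠ 0 := fun h => hzF ⟨hz, h⟩
    have := X.posDef.dotProduct_mulVec_pos h0
    exact (Complex.pos_iff.1 this).1

lemma Model.toExt_hasUnderlying {g : ℕ} (X : PPAV g) (p : Model g) (hp : p.IsFrame) :
    (p.toExt X hp).HasUnderlying X := by
  have hpi : (Real.pi : ℂ) ≠ 0 := by exact_mod_cast Real.pi_ne_zero
  refine ⟨p.psi ∘ₗ p.Z.subtype, fun u => ?_, fun z => ?_, fun z => ?_, fun z z' w hw hc => ?_⟩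
  · obtain ⟨z, hz, h⟩ := p.psi_surj hp u
    exact ⟨⟨z, hz⟩, h⟩
  · exact ⟨fun h => ⟨z.2, h⟩, fun h => h.2⟩
  · constructor
    · intro h
      exact ⟨_, p.bar_mem X (p.psi z), z, z.2, h, rfl⟩
    · rintro ⟨w, hw, z', hz', hl, h⟩
      have h1 : p.psi z = p.psi z' := by
        have := congrArg p.psi h
        rwa [map_add, map_add, p.psi_plus hw.2, p.psi_plus (p.bar_mem_plus X _), add_zero,
          add_zero] at this
      change p.psi z ∈ X.Λ
      rw [h1]; exact hl
  · rw [p.eq_bar X hp z.2 hw.2 hc, p.symp_bar, ← mul_assoc, inv_mul_cancel₀ hpi, one_mul]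
    rfl

/-- The surjection `S̃²(H'_+) × 𝓑_g(H'_+) → Sp(X, Θ)`, `(φ, h) ↦ (Z, F, L)`. -/
def ofFrame {g : ℕ} (X : PPAV g) (p : {p : Model g // p.IsFrame}) : SpX X :=
  ⟨p.1.toExt X p.2, p.1.toExt_hasUnderlying X p.2⟩

lemma exists_plus_of_dual (f : HMinus →ₗ[ℂ] ℂ) : ∃ w ∈ HPlus, ∀ y : HMinus, symp w y = f y := by
  let c : ℕ → ℂ := fun n => if h : 0 < (n : ℤ) then (n : ℂ)⁻¹ * f ⟨b (-n), b_neg_mem h⟩ else 0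
  let w : HPrime := toHPrime (HahnSeries.ofPowerSeries ℤ ℂ (PowerSeries.mk c))
  have hw : w ∈ HPlus := by
    intro n hn
    rw [cf_toHPrime, if_neg hn.ne, HahnSeries.ofPowerSeries_apply,
      HahnSeries.embDomain_of_notMem_range]
    rintro ⟨m, hm⟩
    change (m : ℤ) = n at hm
    omega
  have hwb : ∀ n : ℤ, (hn : 0 < n) → symp w (b (-n)) = f ⟨b (-n), b_neg_mem hn⟩ := by
    intro n hn
    lift n to ℕ using hn.le
    rw [symp_b _ _ hn.ne', cf_toHPrime, if_neg hn.ne', HahnSeries.ofPowerSeries_apply_coeff,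
      PowerSeries.coeff_mk]
    have hn' : (n : ℂ) ≠ 0 := by
      have : n ≠ 0 := by omega
      exact_mod_cast this
    simp only [c, dif_pos hn]
    push_cast
    field_simp
  refine ⟨w, hw, fun y => ?_⟩
  obtain ⟨N, hN⟩ : ∃ N : ℕ, ∀ n : ℤ, n < -N → cf n y = 0 := by
    by_cases h0 : rep (y : HPrime) = 0
    · exact ⟨0, fun n _ => by simp [cf, h0]⟩
    · refine ⟨(rep (y : HPrime)).order.natAbs, fun n hn => ?_⟩
      exact HahnSeries.coeff_eq_zero_of_lt_order (by omega)
  have hy : y = ∑ n ∈ Finset.range N, cf (-(n + 1 : ℤ)) y •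
      (⟨b (-(n + 1 : ℤ)), b_neg_mem (by omega)⟩ : HMinus) := by
    apply Subtype.ext
    refine hprime_ext fun m => ?_
    simp only [AddSubmonoidClass.coe_finsetSum, Submodule.coe_smul, map_sum, map_smul, smul_eq_mul]
    rcases le_or_gt 0 m with hm | hm
    · have h1 : cf m y = 0 := by
        rcases hm.eq_or_lt with rfl | hm
        · exact cf_zero _
        · exact y.2 m hm
      rw [h1, Finset.sum_eq_zero]
      intro n _
      rw [cf_b _ _ (by omega), if_neg (by omega), mul_zero]
    · rcases lt_or_ge m (-N) with hmN | hmN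
      · rw [hN m hmN, Finset.sum_eq_zero]
        intro n hn
        rw [Finset.mem_range] at hn
        rw [cf_b _ _ (by omega), if_neg (by omega), mul_zero]
      · rw [Finset.sum_eq_single (-m - 1).toNat]
        · have h2 : -(((-m - 1).toNat : ℤ) + 1) = m := by omega
          rw [h2, cf_b _ _ (by omega), if_pos rfl, mul_one]
        · intro n _ hn
          rw [cf_b _ _ (by omega), if_neg (by omega), mul_zero]
        · intro h
          exact absurd (Finset.mem_range.2 (by omega)) h
  rw [hy]
  simp only [AddSubmonoidClass.coe_finsetSum, Submodule.coe_smul, map_sum, map_smul]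
  exact Finset.sum_congr rfl fun n _ => by rw [hwb _ (by omega)]

lemma ExtPPAV.prMinus_bijective {g : ℕ} (a : ExtPPAV g) :
    Function.Bijective (prMinus ∘ₗ a.Z.subtype) := by
  constructor
  · rw [← LinearMap.ker_eq_bot, eq_bot_iff]
    intro z hz
    have h0 : prMinus (z : HPrime) = 0 := hz
    have h1 : (z : HPrime) ∈ a.Z ⊓ HPlus := by
      refine ⟨z.2, ?_⟩
      rw [← prMinus_add_prPlus (z : HPrime), h0]
      simp
    rw [a.transversal] at h1
    exact Subtype.ext h1
  · rw [← LinearMap.range_eq_top]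
    by_contra hne
    obtain ⟨f, hf, hfle⟩ := Submodule.exists_le_ker_of_lt_top _ (lt_top_iff_ne_top.2 hne)
    obtain ⟨w, hw, hwf⟩ := exists_plus_of_dual f
    have hwZ : w ∈ a.Z := by
      rw [← a.lagrangian]
      intro z hz
      change symp z w = 0
      rw [symp_neg_swap, ← prMinus_add_prPlus z, map_add, symp_plus hw (prPlus z).2, hwf]
      have : f (prMinus z) = 0 := hfle ⟨⟨z, hz⟩, rfl⟩
      simp [this]
    have h0 : w ∈ a.Z ⊓ HPlus := ⟨hwZ, hw⟩
    rw [a.transversal] at h0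
    apply hf
    ext y
    rw [← hwf, (Submodule.mem_bot ℂ).1 h0]
    simp

lemma ofFrame_surjective {g : ℕ} (X : PPAV g) : Function.Surjective (ofFrame X) := by
  rintro ⟨a, ψ, hsurj, hker, hlat, hherm⟩
  have hpi : (Real.pi : ℂ) ≠ 0 := by exact_mod_cast Real.pi_ne_zero
  let e : a.Z ≃ₗ[ℂ] HMinus := LinearEquiv.ofBijective _ a.prMinus_bijective
  have he : ∀ z : a.Z, prMinus (z : HPrime) = e z := fun z => rfl
  let φ : HMinus →ₗ[ℂ] HPlus := prPlus ∘ₗ a.Z.subtype ∘ₗ e.symm.toLinearMap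
  have hφ : ∀ x : HMinus, (x : HPrime) + φ x = e.symm x := fun x => by
    have := prMinus_add_prPlus (e.symm x : HPrime)
    rw [he, e.apply_symm_apply] at this
    exact this
  have hiso : ∀ z z' : a.Z, symp z z' = 0 := fun z z' => by
    have : (z' : HPrime) ∈ symp.orthogonal a.Z := by rw [a.lagrangian]; exact z'.2
    exact this z z.2
  have hφsym : φ ∈ SymMap := fun x y => by
    have := hiso (e.symm x) (e.symm y)
    rw [← hφ, ← hφ] at this
    simp only [map_add, LinearMap.add_apply, symp_minus x.2 y.2, symp_plus (φ x).2 (φ y).2,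
      symp_neg_swap (φ x) y] at this
    linear_combination this
  choose h hh hhf using fun i => exists_plus_of_dual
    ((Real.pi : ℂ) • (LinearMap.proj i ∘ₗ ψ ∘ₗ e.symm.toLinearMap))
  let p : Model g := ⟨⟨φ, hφsym⟩, fun i => ⟨h i, hh i⟩⟩
  have hgr : ∀ x, p.graphMap x = e.symm x := fun x => hφ x
  have hZ : p.Z = a.Z := by
    ext z
    constructor
    · rintro ⟨x, rfl⟩
      rw [hgr]; exact (e.symm x).2
    · intro hz
      exact ⟨e ⟨z, hz⟩, by rw [hgr]; simp⟩
  have hpsi : ∀ z : a.Z, p.psi z = ψ z := fun z => by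
    have hz : (z : HPrime) = p.graphMap (e z) := by rw [hgr]; simp
    ext i
    have h1 : symp (h i) (z : HPrime) = Real.pi * ψ z i := by
      rw [hz, p.symp_plus_graph (hh i), hhf]; simp
    change (Real.pi : ℂ)⁻¹ * symp (h i) z = _
    rw [h1, ← mul_assoc, inv_mul_cancel₀ hpi, one_mul]
  have hp : p.IsFrame := by
    rw [Model.IsFrame, Fintype.linearIndependent_iff]
    intro c hc i
    obtain ⟨z, hz⟩ := hsurj (Pi.single i 1)
    have h1 : symp (∑ j, c j • h j) (z : HPrime) = 0 := by
      have := congrArg Subtype.val hc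
      simp only [AddSubmonoidClass.coe_finsetSum, Submodule.coe_smul] at this
      rw [show ∑ j, c j • h j = 0 from this]; simp
    have h2 : ∀ j, symp (h j) (z : HPrime) = Real.pi * ψ z j := fun j => by
      have := congrFun (hpsi z) j
      change (Real.pi : ℂ)⁻¹ * symp (h j) z = _ at this
      rw [← this, ← mul_assoc, mul_inv_cancel₀ hpi, one_mul]
    simp only [map_sum, map_smul, LinearMap.sum_apply, LinearMap.smul_apply, h2, hz,
      smul_eq_mul] at h1
    rw [Finset.sum_eq_single i (fun j _ hj => by simp [hj]) (by simp)] at h1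
    simpa [Real.pi_ne_zero] using h1
  have hF : p.F = a.F := by
    ext z
    constructor
    · rintro ⟨hz, hz'⟩
      rw [hZ] at hz
      exact (hker ⟨z, hz⟩).1 (by rw [← hpsi]; exact hz')
    · intro hz
      refine ⟨by rw [hZ]; exact a.F_le_Z hz, ?_⟩
      change p.psi z = 0
      rw [hpsi ⟨z, a.F_le_Z hz⟩, hker]; exact hz
  have hbar : ∀ z : a.Z, ∀ w ∈ perpPlus a.F, IsConjugate a.K z w → w = p.bar X (p.psi z) := by
    intro z w hw hc
    rw [← sub_eq_zero]
    refine plus_eq_zero (sub_mem hw.2 (p.bar_mem_plus X _)) fun y hy => ?_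
    have h1 := hherm z (e.symm ⟨y, hy⟩) w hw hc
    rw [← p.symp_plus_graph (sub_mem hw.2 (p.bar_mem_plus X _)) ⟨y, hy⟩, hgr, map_sub,
      LinearMap.sub_apply, p.symp_bar, hpsi, hpsi, ← h1, ← mul_assoc, mul_inv_cancel₀ hpi, one_mul,
      sub_self]
  have hconj : ∀ z : a.Z, ∀ w ∈ perpPlus a.F, (z : HPrime) + w ∈ a.K →
      w = p.bar X (p.psi z) := by
    intro z w hw hzw
    obtain ⟨w', hw', hc⟩ := a.conj z z.2
    rw [← hbar z w' hw' hc, ← sub_eq_zero]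
    refine a.real_inter _ (sub_mem hw hw') ?_
    have := sub_mem (Submodule.subset_span (R := ℝ) hzw) hc.1
    simpa using this
  have hK : p.K X = a.K := by
    ext x
    constructor
    · rintro ⟨z, hz, hl, rfl⟩
      rw [hZ] at hz
      obtain ⟨w, hw, hzw⟩ := (hlat ⟨z, hz⟩).1 (by rw [← hpsi]; exact hl)
      rw [← hconj ⟨z, hz⟩ w hw hzw]; exact hzw
    · intro hx
      let z : a.Z := e.symm (prMinus x)
      have hzx : x - z ∈ HPlus := by
        have := p.sub_graph_mem x
        rwa [hgr] at this
      have hw : x - z ∈ perpPlus a.F := by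
        refine ⟨sub_mem (a.K_le hx) ?_, hzx⟩
        intro y hy
        exact hiso ⟨y, a.F_le_Z hy⟩ z
      have hzw : (z : HPrime) + (x - z) ∈ a.K := by simpa using hx
      refine ⟨z, by rw [hZ]; exact z.2, ?_, ?_⟩
      · rw [hpsi]
        exact (hlat z).2 ⟨_, hw, hzw⟩
      · rw [← hconj z _ hw hzw]; simp
  exact ⟨⟨p, hp⟩, Subtype.ext (ExtPPAV.ext hZ hF hK)⟩

section Manifold

variable {g : ℕ} (X : PPAV g)

/-- `Sp(X, Θ)` has the quotient topology. Two pairs `(φ, h)` give the same point exactly when they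
differ by the change of frame given by an automorphism of `(X, Θ)`. -/
instance : TopologicalSpace (SpX X) := TopologicalSpace.coinduced (ofFrame X) inferInstance

/-- The pull-back of a function on `Sp(X, Θ)` to the space of pairs `(φ, h)`, extended by `0`
outside the open set where `h` is a frame. -/
def pull {β : Type*} [Zero β] (f : SpX X → β) (p : Model g) : β :=
  open Classical in if hp : p.IsFrame then f (ofFrame X ⟨p, hp⟩) else 0

/-- `f` is a holomorphic function on `U`, i.e. a section over `U` of the structure sheaf `𝒪` of
`Sp(X, Θ)`. Here and below, sections over an open set `U` are represented by functions on the whole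
space, of which only the values on `U` matter. -/
def IsHolOn (U : TopologicalSpace.Opens (SpX X)) (f : SpX X → ℂ) : Prop :=
  ∀ (p : Model g) (hp : p.IsFrame), ofFrame X ⟨p, hp⟩ ∈ U → p.HolAt (pull X f)

/-- The tangent vector at the Lagrangian subspace `Z = graph φ` given by `S ∈ sp⁺(H')`: it is the
map `Z → H'/Z` induced by `S`, where `Z` is identified with `H_-` and `H'/Z` with `H'_+`. -/
def Model.tangent (p : Model g) (S : spPlus) : SymMap :=
  ⟨prPlus ∘ₗ S.1 ∘ₗ p.graphMap - p.φ.1 ∘ₗ prMinus ∘ₗ S.1 ∘ₗ p.graphMap, by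
    have key : ∀ x y : HMinus, symp x ((prPlus ∘ₗ S.1 ∘ₗ p.graphMap -
        p.φ.1 ∘ₗ prMinus ∘ₗ S.1 ∘ₗ p.graphMap) y : HPlus) =
          symp (p.graphMap x) (S.1 (p.graphMap y)) := by
      intro x y
      set w := (prPlus ∘ₗ S.1 ∘ₗ p.graphMap - p.φ.1 ∘ₗ prMinus ∘ₗ S.1 ∘ₗ p.graphMap) y with hw
      have h1 : (w : HPrime) = S.1 (p.graphMap y) -
          p.graphMap (prMinus (S.1 (p.graphMap y))) := by
        have := prMinus_add_prPlus (S.1 (p.graphMap y))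
        rw [p.graphMap_apply (prMinus _)]
        rw [hw]
        simp only [LinearMap.sub_apply, LinearMap.comp_apply, AddSubgroupClass.coe_sub]
        rw [eq_sub_of_add_eq' this]; abel
      have h2 : symp x w = symp (p.graphMap x) w := by
        rw [p.graphMap_apply x, map_add, LinearMap.add_apply, symp_plus (p.φ.1 x).2 w.2, add_zero]
      rw [h2, h1, map_sub, p.symp_graph, sub_zero]
    intro x y
    rw [key, key, symp_neg_swap]
    have := S.2.1.2 (p.graphMap y) (p.graphMap x)
    linear_combination -this⟩

/-- `(φ, h) + ε (φ', S h)`: the first order displacement of `(φ, h)` under the action of `1 + ε S`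
on `Z` and on the frame `h` of `F^⊥_+`. -/
def Model.move (p : Model g) (S : spPlus) (ε : ℂ) : Model g :=
  ⟨p.φ + ε • p.tangent S, fun i => p.h i + ε • ⟨S.1 (p.h i), S.2.2 _ (p.h i).2⟩⟩

/-- A pair `(φ, h)` over a point of `Sp(X, Θ)`. -/
def chart (a : SpX X) : Model g := (Function.surjInv (ofFrame_surjective X) a).1

/-- The action of `S ∈ sp⁺(H')` on functions on `Sp(X, Θ)` induced by the action of symplectic
automorphisms on `Sp(X, Θ)`: the derivative at `ε = 0` of `a ↦ f(exp(-ε S) a)`. The value does not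
depend on the pair `(φ, h)` over `a`, because changes of frame commute with `S`. -/
def lieDeriv (S : spPlus) (f : SpX X → ℂ) (a : SpX X) : ℂ :=
  -deriv (fun ε : ℂ => pull X f ((chart X a).move S ε)) 0

/-- The extension of `lieDeriv` to functions with values in a vector space, by
`S(f ⊗ v) = S(f) ⊗ v`. -/
def lieDerivV {V : Type*} [AddCommGroup V] [Module ℂ V] (S : spPlus) (s : SpX X → V)
    (a : SpX X) : V :=
  ∑ᶠ i, lieDeriv X S (fun x => (Module.Basis.ofVectorSpace ℂ V).repr (s x) i) a •
    Module.Basis.ofVectorSpace ℂ V i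

/-- Sections over `U` of the tautological sheaf `𝔽 ⊂ H' ⊗̂ 𝒪` with fiber `F` at `(Z, F, L)`: the
coefficients are holomorphic and the order of the pole is locally bounded. -/
def IsTautSection (U : TopologicalSpace.Opens (SpX X)) (f : SpX X → HPrime) : Prop :=
  (∀ a ∈ U, f a ∈ a.1.F) ∧ (∀ n : ℤ, IsHolOn X U fun a => cf n (f a)) ∧
    ∀ a ∈ U, ∃ W : TopologicalSpace.Opens (SpX X), a ∈ W ∧ ∃ N : ℤ, ∀ x ∈ W, ∀ n < N,
      cf n (f x) = 0

section Sheaves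

variable {V : Type*} [AddCommGroup V] [Module ℂ V]

/-- The sections over `U` which are locally in a given presheaf `P`. -/
def locallyIn (P : TopologicalSpace.Opens (SpX X) → Submodule ℂ (SpX X → V)) (hP : Antitone P)
    (U : TopologicalSpace.Opens (SpX X)) : Submodule ℂ (SpX X → V) where
  carrier := {s | ∀ a ∈ U, ∃ W : TopologicalSpace.Opens (SpX X), a ∈ W ∧ W ≤ U ∧
    ∃ t ∈ P W, ∀ x ∈ W, s x = t x}
  add_mem' := by
    intro s s' hs hs' a ha
    obtain ⟨W, haW, hWU, t, ht, hst⟩ := hs a ha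
    obtain ⟨W', haW', -, t', ht', hst'⟩ := hs' a ha
    refine ⟨W ⊓ W', ⟨haW, haW'⟩, inf_le_left.trans hWU, t + t',
      add_mem (hP inf_le_left ht) (hP inf_le_right ht'), fun x hx => ?_⟩
    simp [hst x hx.1, hst' x hx.2]
  zero_mem' := fun a ha => ⟨U, ha, le_rfl, 0, zero_mem _, fun _ _ => rfl⟩
  smul_mem' := by
    intro c s hs a ha
    obtain ⟨W, haW, hWU, t, ht, hst⟩ := hs a ha
    exact ⟨W, haW, hWU, c • t, Submodule.smul_mem _ c ht, fun x hx => by simp [hst x hx]⟩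

lemma locallyIn_antitone (P : TopologicalSpace.Opens (SpX X) → Submodule ℂ (SpX X → V))
    (hP : Antitone P) : Antitone (locallyIn X P hP) := by
  intro U U' hU s hs a ha
  obtain ⟨W, haW, hWU, t, ht, hst⟩ := hs a (hU ha)
  exact ⟨W ⊓ U, ⟨haW, ha⟩, inf_le_right, t, hP inf_le_left ht, fun x hx => hst x hx.1⟩

variable (V) in
/-- Finite sums `∑ fᵢ ⊗ vᵢ` with `fᵢ` holomorphic on `U`. -/
def tensorPre (U : TopologicalSpace.Opens (SpX X)) : Submodule ℂ (SpX X → V) :=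
  Submodule.span ℂ {s | ∃ (f : SpX X → ℂ) (v : V), IsHolOn X U f ∧ s = fun x => f x • v}

variable (V) in
lemma tensorPre_antitone : Antitone (tensorPre X V) := by
  intro U U' hU
  refine Submodule.span_mono ?_
  rintro s ⟨f, v, hf, rfl⟩
  exact ⟨f, v, fun p hp h => hf p hp (hU h), rfl⟩

variable (V) in
/-- The sections over `U` of the sheaf `V ⊗ 𝒪`. -/
def VO (U : TopologicalSpace.Opens (SpX X)) : Submodule ℂ (SpX X → V) :=
  locallyIn X (tensorPre X V) (tensorPre_antitone X V) U

end Sheaves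

end Manifold

/-! ## Heisenberg vertex algebras -/

section Heisenberg

variable {𝔥 : Type*} [AddCommGroup 𝔥] [Module ℂ 𝔥] (κ : LinearMap.BilinForm ℂ 𝔥) (ℓ : ℂ)

/-- The form `(A ⊗ f, B ⊗ g) ↦ -(A, B) Res f dg` on `𝔥((t)) = 𝔥 ⊗ ℂ((t))`. -/
def loopForm : LinearMap.BilinForm ℂ (𝔥 ⊗[ℂ] LS) := LinearMap.BilinForm.tmul κ resForm

/-- The relations `x y - y x = ℓ (x, y)`. -/
inductive WeylRel : TensorAlgebra ℂ (𝔥 ⊗[ℂ] LS) → TensorAlgebra ℂ (𝔥 ⊗[ℂ] LS) → Prop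
  | comm (x y : 𝔥 ⊗[ℂ] LS) : WeylRel
      (TensorAlgebra.ι ℂ x * TensorAlgebra.ι ℂ y)
      (TensorAlgebra.ι ℂ y * TensorAlgebra.ι ℂ x +
        algebraMap ℂ (TensorAlgebra ℂ (𝔥 ⊗[ℂ] LS)) (ℓ * loopForm κ x y))

/-- The enveloping algebra of the Heisenberg algebra `𝔥((t)) ⊕ ℂ𝟏` modulo `𝟏 = ℓ`. For `ℓ = 1` its
completion is the Weyl algebra; the completion acts on the modules below through locally finite
sums. -/
abbrev Weyl : Type _ := RingQuot (WeylRel κ ℓ)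

/-- The class of an element of `𝔥((t))` in the Weyl algebra. -/
def Weyl.of : (𝔥 ⊗[ℂ] LS) →ₗ[ℂ] Weyl κ ℓ :=
  (RingQuot.mkAlgHom ℂ (WeylRel κ ℓ)).toLinearMap ∘ₗ TensorAlgebra.ι ℂ

/-- The left ideal generated by `𝔥⟦t⟧`. -/
def vacuumIdeal : Submodule (Weyl κ ℓ) (Weyl κ ℓ) :=
  Submodule.span (Weyl κ ℓ)
    {w | ∃ (A : 𝔥) (f : LS), (∀ n : ℤ, n < 0 → f.coeff n = 0) ∧ w = Weyl.of κ ℓ (A ⊗ₜ f)}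

/-- The Fock representation of level `ℓ`, induced from the one-dimensional representation of
`𝔥⟦t⟧ ⊕ ℂ𝟏` on which `𝔥⟦t⟧` acts by `0` and `𝟏` by `ℓ`. -/
abbrev Fock : Type _ := Weyl κ ℓ ⧸ vacuumIdeal κ ℓ

/-- The action of `A ⊗ f` on the Fock representation. -/
def op (A : 𝔥) (f : LS) (v : Fock κ ℓ) : Fock κ ℓ := Weyl.of κ ℓ (A ⊗ₜ f) • v

/-- The action of `A_n = A ⊗ t ^ n`. -/
def mode (A : 𝔥) (n : ℤ) (v : Fock κ ℓ) : Fock κ ℓ := op κ ℓ A (HahnSeries.single n 1) v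

/-- The action of the normally ordered product `:A_m A_n:`. -/
def normalOrdered (A : 𝔥) (m n : ℤ) (v : Fock κ ℓ) : Fock κ ℓ :=
  mode κ ℓ A (min m n) (mode κ ℓ A (max m n) v)

/-- The action of `sp⁺(H')` on the Fock representation of level `1`. An element `S` is the quadratic
element `½ ∑ s_{mn} :b_m b_n:` with `n s_{mn}` the coefficient of `b_m` in `S(b_{-n})`, for the
action `x ↦ b_m ⟨b_n, x⟩ + b_n ⟨b_m, x⟩` of `b_m b_n` on `H'`; and `:b_m b_n:` acts as
`∑ᵢ :Hⁱ_m Hⁱ_n:` for an orthonormal basis `(Hⁱ)` of `𝔥`. All but finitely many terms vanish on a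
given vector. -/
def quadAct {d : ℕ} (H : Module.Basis (Fin d) ℂ 𝔥) (S : spPlus) (v : Fock κ 1) : Fock κ 1 :=
  (1 / 2 : ℂ) • ∑ᶠ mn : ℤ × ℤ, (cf mn.1 (S.1 (b (-mn.2))) / (mn.2 : ℂ)) •
    ∑ i, normalOrdered κ 1 (H i) mn.1 mn.2 v

/-- `S` as an endomorphism of `ℂ((t))`. -/
def liftEnd (S : Module.End ℂ HPrime) : LS →ₗ[ℂ] LS := rep ∘ₗ S ∘ₗ toHPrime

/-- `S` as an endomorphism of `𝔥((t))`, with `A ⊗ f ↦ A ⊗ S(f)`. -/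
def loopEnd (S : Module.End ℂ HPrime) : (𝔥 ⊗[ℂ] LS) →ₗ[ℂ] (𝔥 ⊗[ℂ] LS) :=
  LinearMap.lTensor 𝔥 (liftEnd S)

lemma resForm_liftEnd (S : spPlus) (f g : LS) :
    resForm (liftEnd S.1 f) g + resForm f (liftEnd S.1 g) = 0 := by
  rw [← symp_toHPrime, ← symp_toHPrime]
  simp only [liftEnd, LinearMap.comp_apply, toHPrime_rep]
  exact S.2.1.2 _ _

lemma loopForm_loopEnd (S : spPlus) (x y : 𝔥 ⊗[ℂ] LS) :
    loopForm κ (loopEnd S.1 x) y + loopForm κ x (loopEnd S.1 y) = 0 := by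
  induction x with
  | zero => simp
  | add x x' hx hx' =>
    simp only [map_add, LinearMap.add_apply]
    linear_combination hx + hx'
  | tmul A f =>
    induction y with
    | zero => simp
    | add y y' hy hy' =>
      simp only [map_add]
      linear_combination hy + hy'
    | tmul B g =>
      have := resForm_liftEnd S f g
      change resForm (liftEnd S.1 f) g * κ A B + resForm f (liftEnd S.1 g) * κ A B = 0
      rw [← add_mul, this, zero_mul]

lemma Weyl.comm (x y : 𝔥 ⊗[ℂ] LS) : Weyl.of κ ℓ x * Weyl.of κ ℓ y =
    Weyl.of κ ℓ y * Weyl.of κ ℓ x + algebraMap ℂ (Weyl κ ℓ) (ℓ * loopForm κ x y) := by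
  have := RingQuot.mkAlgHom_rel ℂ (WeylRel.comm (κ := κ) (ℓ := ℓ) x y)
  rw [map_mul, map_add, map_mul, AlgHom.commutes] at this
  exact this

/-- The algebra homomorphism `w ↦ w + ε D(w)`, where `D` is the derivation of the Weyl algebra
extending the endomorphism `A ⊗ f ↦ A ⊗ S(f)` of `𝔥((t))`. -/
def weylDual (S : spPlus) : Weyl κ ℓ →ₐ[ℂ] TrivSqZeroExt (Weyl κ ℓ) (Weyl κ ℓ) :=
  RingQuot.liftAlgHom ℂ ⟨TensorAlgebra.lift ℂ
    ((TrivSqZeroExt.inlAlgHom ℂ (Weyl κ ℓ) (Weyl κ ℓ)).toLinearMap ∘ₗ Weyl.of κ ℓ +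
      (TrivSqZeroExt.inrHom (Weyl κ ℓ) (Weyl κ ℓ)).restrictScalars ℂ ∘ₗ Weyl.of κ ℓ ∘ₗ
        loopEnd S.1), by
    rintro _ _ ⟨x, y⟩
    simp only [map_mul, map_add, TensorAlgebra.lift_ι_apply, AlgHom.commutes]
    have h1 := Weyl.comm κ ℓ x y
    have h2 := Weyl.comm κ ℓ x (loopEnd S.1 y)
    have h3 := Weyl.comm κ ℓ (loopEnd S.1 x) y
    have h4 := loopForm_loopEnd κ S x y
    ext
    · simpa [TrivSqZeroExt.algebraMap_eq_inl'] using h1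
    · simp only [TrivSqZeroExt.algebraMap_eq_inl']
      simp
      rw [h2, h3]
      have h5 : algebraMap ℂ (Weyl κ ℓ) (ℓ * loopForm κ (loopEnd S.1 x) y) =
          -algebraMap ℂ (Weyl κ ℓ) (ℓ * loopForm κ x (loopEnd S.1 y)) := by
        rw [← map_neg, eq_neg_of_add_eq_zero_left h4, mul_neg]
      rw [h5]; abel⟩

lemma weylDual_of (S : spPlus) (x : 𝔥 ⊗[ℂ] LS) : weylDual κ ℓ S (Weyl.of κ ℓ x) =
    TrivSqZeroExt.inl (Weyl.of κ ℓ x) + TrivSqZeroExt.inr (Weyl.of κ ℓ (loopEnd S.1 x)) := by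
  change weylDual κ ℓ S (RingQuot.mkAlgHom ℂ (WeylRel κ ℓ) (TensorAlgebra.ι ℂ x)) = _
  rw [weylDual, RingQuot.liftAlgHom_mkAlgHom_apply, TensorAlgebra.lift_ι_apply]
  rfl

lemma weylDual_fst (S : spPlus) (w : Weyl κ ℓ) : (weylDual κ ℓ S w).fst = w := by
  have : (TrivSqZeroExt.fstHom ℂ (Weyl κ ℓ) (Weyl κ ℓ)).comp (weylDual κ ℓ S) =
      AlgHom.id ℂ (Weyl κ ℓ) := by
    apply RingQuot.ringQuot_ext'
    refine TensorAlgebra.hom_ext (LinearMap.ext fun x => ?_)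
    change (weylDual κ ℓ S (Weyl.of κ ℓ x)).fst = Weyl.of κ ℓ x
    rw [weylDual_of]
    simp
  exact DFunLike.congr_fun this w

/-- The derivation of the Weyl algebra extending the endomorphism `A ⊗ f ↦ A ⊗ S(f)`
of `𝔥((t))`. -/
def weylDer (S : spPlus) : Weyl κ ℓ →ₗ[ℂ] Weyl κ ℓ :=
  ((TrivSqZeroExt.sndHom (Weyl κ ℓ) (Weyl κ ℓ)).restrictScalars ℂ) ∘ₗ
    (weylDual κ ℓ S).toLinearMap

lemma weylDer_mul (S : spPlus) (w w' : Weyl κ ℓ) :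
    weylDer κ ℓ S (w * w') = w * weylDer κ ℓ S w' + weylDer κ ℓ S w * w' := by
  change (weylDual κ ℓ S (w * w')).snd = _
  rw [map_mul, TrivSqZeroExt.snd_mul, weylDual_fst, weylDual_fst]
  rfl

lemma weylDer_vacuumIdeal (S : spPlus) (w : Weyl κ ℓ) (hw : w ∈ vacuumIdeal κ ℓ) :
    weylDer κ ℓ S w ∈ vacuumIdeal κ ℓ := by
  induction hw using Submodule.span_induction with
  | mem w hw =>
    obtain ⟨A, f, hf, rfl⟩ := hw
    refine Submodule.subset_span ⟨A, liftEnd S.1 f, fun n hn => ?_, ?_⟩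
    · refine S.2.2 (toHPrime f) (fun m hm => ?_) n hn
      rw [cf_toHPrime, if_neg hm.ne, hf m hm]
    · change (weylDual κ ℓ S _).snd = _
      rw [weylDual_of]
      simp [loopEnd]
  | zero => simp
  | add w w' _ _ hw hw' => rw [map_add]; exact add_mem hw hw'
  | smul u w hw hw' =>
    rw [smul_eq_mul, weylDer_mul]
    exact add_mem (Submodule.smul_mem _ u hw') (Submodule.smul_mem _ _ hw)

/-- The endomorphism of the Fock representation induced by the derivation of the Weyl algebra with
`A ⊗ f ↦ A ⊗ S(f)`. -/
def fockDer (S : spPlus) : Fock κ ℓ →ₗ[ℂ] Fock κ ℓ :=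
  (Submodule.Quotient.restrictScalarsEquiv ℂ (vacuumIdeal κ ℓ)).toLinearMap ∘ₗ
    Submodule.mapQ ((vacuumIdeal κ ℓ).restrictScalars ℂ) ((vacuumIdeal κ ℓ).restrictScalars ℂ)
      (weylDer κ ℓ S) (weylDer_vacuumIdeal κ ℓ S) ∘ₗ
    (Submodule.Quotient.restrictScalarsEquiv ℂ (vacuumIdeal κ ℓ)).symm.toLinearMap

end Heisenberg

/-! ## Coinvariants -/

/-- The two kinds of Heisenberg vertex algebras: `π_Γ`, of level `1`, and `π_Γ^0`, of level `0`. -/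
inductive Kind
  | pi
  | piZero

/-- The level of a Heisenberg vertex algebra. -/
def Kind.level : Kind → ℂ
  | Kind.pi => 1
  | Kind.piZero => 0

section Coinvariants

variable {𝔥 : Type*} [AddCommGroup 𝔥] [Module ℂ 𝔥] (κ : LinearMap.BilinForm ℂ 𝔥) (k : Kind)

/-- The underlying space of the Heisenberg vertex algebra `V`. -/
abbrev HVA : Type _ := Fock κ k.level

/-- The action of `sp⁺(H')` on `V`. On `π_Γ` it is the one by normally ordered quadratic elements.
The space `π_Γ^0 = Sym(𝔥 ⊗ H'/H'_+)` is the limit for `ℓ → 0` of the representations of level `ℓ`,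
on which `:b_m b_n:` acts as `ℓ⁻¹ ∑ᵢ :Hⁱ_m Hⁱ_n:`; the limit of these actions of `sp⁺(H')` is the
action by derivations induced by the natural action of `sp⁺(H')` on `H'/H'_+`. -/
def spAct {d : ℕ} (H : Module.Basis (Fin d) ℂ 𝔥) :
    (k : Kind) → spPlus → HVA κ k → HVA κ k
  | Kind.pi => quadAct κ H
  | Kind.piZero => fun S => fockDer κ 0 S

variable {g : ℕ} (X : PPAV g)

/-- The action of `S ∈ sp⁺(H')` on `V ⊗ 𝒪`, with `S(A ⊗ f) = S(A) ⊗ f + A ⊗ S(f)`. -/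
def act {d : ℕ} (H : Module.Basis (Fin d) ℂ 𝔥) (S : spPlus) (s : SpX X → HVA κ k) :
    SpX X → HVA κ k :=
  fun a => spAct κ H k S (s a) + lieDerivV X S s a

/-- Finite sums of sections `(A ⊗ f) s` with `A ∈ 𝔥`, `f` a section of `𝔽` over `U`, and `s` a
section of `V ⊗ 𝒪` over `U`. -/
def houtPre (U : TopologicalSpace.Opens (SpX X)) : Submodule ℂ (SpX X → HVA κ k) :=
  Submodule.span ℂ {s | ∃ (A : 𝔥) (f : SpX X → HPrime) (t : SpX X → HVA κ k),
    IsTautSection X U f ∧ t ∈ VO X (HVA κ k) U ∧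
      s = fun x => op κ k.level A (rep (f x)) (t x)}

lemma houtPre_antitone : Antitone (houtPre κ k X) := by
  intro U U' hU
  refine Submodule.span_mono ?_
  rintro s ⟨A, f, t, hf, ht, rfl⟩
  refine ⟨A, f, t, ⟨fun a ha => hf.1 a (hU ha), fun n p hp h => hf.2.1 n p hp (hU h),
    fun a ha => hf.2.2 a (hU ha)⟩, locallyIn_antitone X _ _ hU ht, rfl⟩

/-- The sections over `U` of the subsheaf `𝔥^out(X, Θ)(V ⊗ 𝒪)` of `V ⊗ 𝒪`, the image of
`(𝔥 ⊗ 𝔽) ⊗ (V ⊗ 𝒪)`. -/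
def hout (U : TopologicalSpace.Opens (SpX X)) : Submodule ℂ (SpX X → HVA κ k) :=
  locallyIn X (houtPre κ k X) (houtPre_antitone κ k X) U

/-- The functions representing germs at `a` of sections of `V ⊗ 𝒪`. -/
def VOat (a : SpX X) : Submodule ℂ (SpX X → HVA κ k) :=
  ⨆ (U : TopologicalSpace.Opens (SpX X)) (_ : a ∈ U), VO X (HVA κ k) U

/-- The functions representing germs at `a` of sections of `𝔥^out(X, Θ)(V ⊗ 𝒪)`. -/
def houtAt (a : SpX X) : Submodule ℂ (SpX X → HVA κ k) :=
  ⨆ (U : TopologicalSpace.Opens (SpX X)) (_ : a ∈ U), hout κ k X U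

/-- The stalk at `a` of the sheaf of coinvariants
`V̂(X, Θ, V) = V ⊗ 𝒪 / 𝔥^out(X, Θ)(V ⊗ 𝒪)`. -/
def Stalk (a : SpX X) : Type _ :=
  VOat κ k X a ⧸ (houtAt κ k X a).submoduleOf (VOat κ k X a)

instance (a : SpX X) : AddCommGroup (Stalk κ k X a) :=
  inferInstanceAs (AddCommGroup (VOat κ k X a ⧸ (houtAt κ k X a).submoduleOf (VOat κ k X a)))

instance (a : SpX X) : Module ℂ (Stalk κ k X a) :=
  inferInstanceAs (Module ℂ (VOat κ k X a ⧸ (houtAt κ k X a).submoduleOf (VOat κ k X a)))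

/-- The projection from functions representing germs to the stalk of `V̂(X, Θ, V)`. -/
def toStalk (a : SpX X) : VOat κ k X a →ₗ[ℂ] Stalk κ k X a :=
  ((houtAt κ k X a).submoduleOf (VOat κ k X a)).mkQ

/-- The germ at `a ∈ U` of the section of `V̂(X, Θ, V)` given by a section of `V ⊗ 𝒪` over `U`. -/
def germ (U : TopologicalSpace.Opens (SpX X)) (a : SpX X) (ha : a ∈ U) :
    VO X (HVA κ k) U →ₗ[ℂ] Stalk κ k X a :=
  toStalk κ k X a ∘ₗ Submodule.inclusion
    (le_iSup₂ (f := fun (U : TopologicalSpace.Opens (SpX X)) (_ : a ∈ U) => VO X (HVA κ k) U) U ha)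

/-- The sections over `U` of the quotient sheaf `V̂(X, Θ, V)`: the families of germs which are
locally given by sections of `V ⊗ 𝒪`. -/
def Vhat (U : TopologicalSpace.Opens (SpX X)) : Submodule ℂ ((a : U) → Stalk κ k X a) where
  carrier := {σ | ∀ a ∈ U, ∃ (W : TopologicalSpace.Opens (SpX X)) (hW : W ≤ U),
    a ∈ W ∧ ∃ s : VO X (HVA κ k) W, ∀ (x : SpX X) (hx : x ∈ W),
      σ ⟨x, hW hx⟩ = germ κ k X W x hx s}
  add_mem' := by
    intro σ τ hσ hτ a ha
    obtain ⟨W, hW, haW, s, hs⟩ := hσ a ha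
    obtain ⟨W', hW', haW', s', hs'⟩ := hτ a ha
    refine ⟨W ⊓ W', inf_le_left.trans hW, ⟨haW, haW'⟩,
      ⟨s.1 + s'.1, add_mem (locallyIn_antitone X _ _ inf_le_left s.2)
        (locallyIn_antitone X _ _ inf_le_right s'.2)⟩, fun x hx => ?_⟩
    rw [Pi.add_apply, hs x hx.1, hs' x hx.2]
    rfl
  zero_mem' := fun a ha => ⟨U, le_rfl, ha, 0, fun x hx => by rw [map_zero]; rfl⟩
  smul_mem' := by
    intro c σ hσ a ha
    obtain ⟨W, hW, haW, s, hs⟩ := hσ a ha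
    exact ⟨W, hW, haW, c • s, fun x hx => by rw [Pi.smul_apply, hs x hx, map_smul]⟩

/-- The quotient map `V ⊗ 𝒪 → V̂(X, Θ, V)` on sections over `U`. -/
def toVhat (U : TopologicalSpace.Opens (SpX X)) : VO X (HVA κ k) U →ₗ[ℂ] Vhat κ k X U :=
  LinearMap.codRestrict (Vhat κ k X U) (LinearMap.pi fun a => germ κ k X U a a.2)
    (fun s _ ha => ⟨U, le_rfl, ha, s, fun _ _ => rfl⟩)

/-- The restriction of sections of `V̂(X, Θ, V)`. -/
def resVhat {U U' : TopologicalSpace.Opens (SpX X)} (hU : U ≤ U') :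
    Vhat κ k X U' →ₗ[ℂ] Vhat κ k X U :=
  LinearMap.codRestrict (Vhat κ k X U)
    (LinearMap.pi fun a => LinearMap.proj (⟨a, hU a.2⟩ : U') ∘ₗ (Vhat κ k X U').subtype)
    (by
      intro σ a ha
      obtain ⟨W, hW, haW, s, hs⟩ := σ.2 a (hU ha)
      refine ⟨W ⊓ U, inf_le_right, ⟨haW, ha⟩,
        ⟨s.1, locallyIn_antitone X _ _ inf_le_left s.2⟩, fun x hx => ?_⟩
      exact hs x hx.1)

/-- `𝔪_a` times the stalk at `a`, where `𝔪_a` is the maximal ideal of `𝒪_a`. -/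
def maxIdealStalk (a : SpX X) : Submodule ℂ (Stalk κ k X a) :=
  Submodule.map (toStalk κ k X a) (Submodule.submoduleOf (Submodule.span ℂ
    {s | ∃ (U : TopologicalSpace.Opens (SpX X)) (f : SpX X → ℂ) (t : SpX X → HVA κ k),
      a ∈ U ∧ IsHolOn X U f ∧ f a = 0 ∧ t ∈ VO X (HVA κ k) U ∧ s = fun x => f x • t x})
    (VOat κ k X a))

/-- The fiber at `a` of the sheaf `V̂(X, Θ, V)`. -/
abbrev Fiber (a : SpX X) : Type _ := Stalk κ k X a ⧸ maxIdealStalk κ k X a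

/-- `𝔥^out(a)(V)`, where `𝔥^out(a) = 𝔥 ⊗ F` for `a = (Z, F, L)`. -/
def houtFiber (a : ExtPPAV g) : Submodule ℂ (HVA κ k) :=
  Submodule.span ℂ {v | ∃ (A : 𝔥) (f : HPrime) (u : HVA κ k),
    f ∈ a.F ∧ v = op κ k.level A (rep f) u}

/-- The space of coinvariants `V̂(a, V) = V / 𝔥^out(a)(V)` at an extended PPAV. -/
abbrev Coinv (a : ExtPPAV g) : Type _ := HVA κ k ⧸ houtFiber κ k a

end Coinvariants

/-- An even positive definite lattice: the form on `Γ` is symmetric, even and positive definite. -/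
structure IsEvenPosDef {Γ : Type*} [AddCommGroup Γ] (q : LinearMap.BilinForm ℤ Γ) : Prop where
  symm : ∀ x y, q x y = q y x
  even : ∀ x, Even (q x x)
  pos : ∀ x, x ≠ 0 → 0 < q x x

/-- The abelian Lie algebra `𝔥_Γ = ℂ ⊗ Γ`. -/
def Cartan (Γ : Type*) [AddCommGroup Γ] : Type _ := ℂ ⊗[ℤ] Γ

instance (Γ : Type*) [AddCommGroup Γ] : AddCommGroup (Cartan Γ) :=
  inferInstanceAs (AddCommGroup (ℂ ⊗[ℤ] Γ))

instance (Γ : Type*) [AddCommGroup Γ] : Module ℂ (Cartan Γ) :=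
  inferInstanceAs (Module ℂ (ℂ ⊗[ℤ] Γ))

/-- The complex bilinear extension to `𝔥_Γ` of the form on `Γ`. -/
def cartanForm {Γ : Type*} [AddCommGroup Γ] (q : LinearMap.BilinForm ℤ Γ) :
    LinearMap.BilinForm ℂ (Cartan Γ) :=
  LinearMap.BilinForm.baseChange ℂ q

end HeisPPAV

end

open HeisPPAV

attribute [local instance] LieRing.ofAssociativeRing

noncomputable section

namespace HeisPPAV

open scoped TensorProduct ComplexOrder
open TopologicalSpace

/-! ## Laurent series and classes in `H'` -/

/-! On `V` every `S` acts by the operator `fockDer S`, which kills the vacuum and satisfies `[S, A ⊗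
f] = A ⊗ S(f)`. At level 0 this is the definition. At level 1 the normally ordered quadratic
operator has the same two properties (`quadLin_vac`, `quadLin_op`), and they determine an operator
because the vacuum generates the Fock representation.

Part (i) is then a Leibniz rule (`derAct_op`): `S((A ⊗ f) t) = (A ⊗ (S f + u)) t + (A ⊗ f)(S t)`,
where `u` is the coefficientwise derivative of the section `f` of `𝔽`. What has to be shown is that
`S f + u` is again a section of `𝔽`. This is the infinitesimal form of the equivariance `F(e^{εS} a)
= e^{εS} F(a)`, and `add_deriv_mem_F` proves it by differentiating the two equations that define
`F`: lying on the graph of `φ`, and being orthogonal to the frame `h`. The Lie algebra relation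
needs in addition that the vector fields of `sp⁺(H')` on pairs `(φ, h)` have the expected brackets
(`dir_dir`). All calculus takes place on pairs, where a holomorphic function involves finitely many
coordinates, and descends because two pairs over one point differ by an automorphism of `(X, Θ)`
(`exists_isAut`), which commutes with the action.

For the fiber in part (ii), every vector of `F` at `a` extends to a local section of `𝔽`
(`exists_tautSection`), so the values at `a` of `𝔥^out(X, Θ)(V ⊗ 𝒪)` fill `(𝔥 ⊗ F)(V)`. A section
with value in that subspace is, modulo the subsheaf, a section vanishing at `a`, hence lies in `𝔪_a`
times the stalk (`maxIdealStalk_eq_ker`).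

For `S` in `sp⁺_F(H')` the point `a` is fixed to first order: `S Z ⊆ F ⊆ Z` and `S h_i ∈ F ∩ H'_+ =
0`. The derivative terms therefore vanish at `a`, and only `fockDer S v` remains. As `H' = Z +
H'_+`, the space `V` is generated from the vacuum by `𝔥 ⊗ Z` alone. Applying `S` to a product of
such operators replaces one factor `z` by `S z ∈ F`; since `Z` is isotropic this factor can be moved
to the front, so the result lies in `(𝔥 ⊗ F)(V)` (`fockDer_mem_houtFiber`). -/

lemma rep_toHPrime (f : LS) : rep (toHPrime f) = f - HahnSeries.single 0 (f.coeff 0) := rfl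

lemma exists_cf_bound (x : HPrime) : ∃ N : ℤ, ∀ n < N, cf n x = 0 := by
  by_cases h0 : rep x = 0
  · exact ⟨0, fun n _ => by simp [cf, h0]⟩
  · exact ⟨(rep x).order, fun n hn => HahnSeries.coeff_eq_zero_of_lt_order hn⟩

lemma exists_coeff_bound (f : LS) : ∃ N : ℤ, ∀ n < N, f.coeff n = 0 := by
  by_cases h0 : f = 0
  · exact ⟨0, fun n _ => by simp [h0]⟩
  · exact ⟨f.order, fun n hn => HahnSeries.coeff_eq_zero_of_lt_order hn⟩

lemma resForm_single_zero (c : ℂ) (g : LS) : resForm (HahnSeries.single 0 c) g = 0 := by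
  rw [resForm_eq_finsum]
  refine finsum_eq_zero_of_forall_eq_zero fun n => ?_
  by_cases hn : n = 0 <;> simp [hn, HahnSeries.coeff_single_of_ne]

lemma resForm_eq_zero {f g : LS} {M N : ℤ} (hf : ∀ n < M, f.coeff n = 0)
    (hg : ∀ n < N, g.coeff n = 0) (h : 0 < M + N) : resForm f g = 0 := by
  rw [resForm_eq_finsum]
  refine finsum_eq_zero_of_forall_eq_zero fun n => ?_
  rcases lt_or_ge n M with hn | hn
  · simp [hf n hn]
  · simp [hg (-n) (by omega)]

lemma resForm_single_single (m n : ℤ) :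
    resForm (HahnSeries.single m 1) (HahnSeries.single n 1) = if m = -n then (m : ℂ) else 0 := by
  rw [resForm_eq_finsum, finsum_eq_single _ m]
  · by_cases h : m = -n
    · subst h; simp
    · rw [if_neg h, HahnSeries.coeff_single_of_ne (a := n) (by omega)]; simp
  · intro k hk
    rw [HahnSeries.coeff_single_of_ne hk]; simp

/-! ### The Fock representation: commutators, generation by the vacuum, local finiteness. -/

section Heisenberg

variable {𝔥 : Type*} [AddCommGroup 𝔥] [Module ℂ 𝔥] (κ : LinearMap.BilinForm ℂ 𝔥) (ℓ : ℂ)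

/-- The action of `𝔥((t))` on the Fock representation as a trilinear map. -/
def opL : 𝔥 →ₗ[ℂ] LS →ₗ[ℂ] Module.End ℂ (Fock κ ℓ) :=
  (TensorProduct.mk ℂ 𝔥 LS).compr₂
    ((Algebra.lsmul ℂ ℂ (Fock κ ℓ)).toLinearMap ∘ₗ Weyl.of κ ℓ)

lemma opL_apply (A : 𝔥) (f : LS) (v : Fock κ ℓ) : opL κ ℓ A f v = op κ ℓ A f v := rfl

lemma op_comm (A B : 𝔥) (f g : LS) (v : Fock κ ℓ) :
    op κ ℓ A f (op κ ℓ B g v) =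
      op κ ℓ B g (op κ ℓ A f v) + (ℓ * (resForm f g * κ A B)) • v := by
  have h := Weyl.comm κ ℓ (A ⊗ₜ f) (B ⊗ₜ g)
  simp only [op, ← mul_smul, h, add_smul, algebraMap_smul]
  rfl

lemma fock_zero_smul (v : Fock κ ℓ) : (0 : ℂ) • v = 0 := zero_smul ℂ v

lemma fock_smul_zero (c : ℂ) : c • (0 : Fock κ ℓ) = 0 := smul_zero (A := Fock κ ℓ) c

lemma fock_smul_add (c : ℂ) (v w : Fock κ ℓ) : c • (v + w) = c • v + c • w :=
  smul_add (M := ℂ) (A := Fock κ ℓ) c v w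

lemma fock_smul_sum {ι : Type*} (c : ℂ) (s : Finset ι) (v : ι → Fock κ ℓ) :
    c • ∑ i ∈ s, v i = ∑ i ∈ s, c • v i :=
  Finset.smul_sum (M := ℂ) (N := Fock κ ℓ)

lemma fock_smul_smul (c e : ℂ) (v : Fock κ ℓ) : c • e • v = (c * e) • v :=
  smul_smul (α := Fock κ ℓ) c e v

/-- The vacuum vector. -/
def vac : Fock κ ℓ := Submodule.Quotient.mk 1

lemma op_vac {A : 𝔥} {f : LS} (hf : ∀ n : ℤ, n < 0 → f.coeff n = 0) :
    op κ ℓ A f (vac κ ℓ) = 0 := by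
  change Submodule.Quotient.mk (Weyl.of κ ℓ (A ⊗ₜ f) * 1) = _
  rw [mul_one]
  exact (Submodule.Quotient.mk_eq_zero _).2 (Submodule.subset_span ⟨A, f, hf, rfl⟩)

variable {κ ℓ}

/-- The Fock representation is the cyclic module of the vacuum over an algebra generated by the
classes of `𝔥((t))`. Operator identities below are therefore checked on the vacuum and propagated
through `op`. -/
lemma fock_submodule_eq_top (N : Submodule ℂ (Fock κ ℓ)) (h0 : vac κ ℓ ∈ N)
    (h1 : ∀ (A : 𝔥) (f : LS), ∀ v ∈ N, op κ ℓ A f v ∈ N) : N = ⊤ := by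
  have h2 : ∀ (x : 𝔥 ⊗[ℂ] LS), ∀ v ∈ N, Weyl.of κ ℓ x • v ∈ N := by
    intro x v hv
    induction x with
    | zero => rw [map_zero, zero_smul]; exact zero_mem _
    | add x y hx hy => rw [map_add, add_smul]; exact add_mem hx hy
    | tmul A f => exact h1 A f v hv
  have h3 : ∀ (w : TensorAlgebra ℂ (𝔥 ⊗[ℂ] LS)), ∀ v ∈ N,
      RingQuot.mkAlgHom ℂ (WeylRel κ ℓ) w • v ∈ N := by
    intro w
    induction w using TensorAlgebra.induction with
    | algebraMap r =>
      intro v hv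
      rw [AlgHom.commutes, algebraMap_smul]
      exact N.smul_mem r hv
    | ι x => exact h2 x
    | mul a b ha hb => intro v hv; rw [map_mul, mul_smul]; exact ha _ (hb _ hv)
    | add a b ha hb => intro v hv; rw [map_add, add_smul]; exact add_mem (ha _ hv) (hb _ hv)
  rw [eq_top_iff]
  rintro v -
  obtain ⟨w, rfl⟩ := Submodule.mkQ_surjective _ v
  obtain ⟨w, rfl⟩ := RingQuot.mkAlgHom_surjective ℂ (WeylRel κ ℓ) w
  have := h3 w _ h0
  rw [vac, ← Submodule.Quotient.mk_smul, smul_eq_mul, mul_one] at this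
  exact this

lemma fock_induction {P : Fock κ ℓ → Prop} (h0 : P (vac κ ℓ))
    (hadd : ∀ v w, P v → P w → P (v + w)) (hsmul : ∀ (c : ℂ) v, P v → P (c • v))
    (hop : ∀ (A : 𝔥) (f : LS) v, P v → P (op κ ℓ A f v)) (v : Fock κ ℓ) : P v := by
  have := fock_submodule_eq_top (κ := κ) (ℓ := ℓ)
    { carrier := {v | P v}
      add_mem' := fun {v w} hv hw => hadd v w hv hw
      zero_mem' := by
        have := hsmul 0 _ h0
        rwa [fock_zero_smul] at this
      smul_mem' := fun c v hv => hsmul c v hv } h0 (fun A f v hv => hop A f v hv)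
  have hv : v ∈ (⊤ : Submodule ℂ (Fock κ ℓ)) := trivial
  rw [← this] at hv
  exact hv

lemma linearMap_ext_fock {W : Type*} [AddCommGroup W] [Module ℂ W] {D E : Fock κ ℓ →ₗ[ℂ] W}
    (h0 : D (vac κ ℓ) = E (vac κ ℓ))
    (hop : ∀ (A : 𝔥) (f : LS) v, D v = E v → D (op κ ℓ A f v) = E (op κ ℓ A f v)) : D = E :=
  LinearMap.ext <| fock_induction h0 (fun v w hv hw => by rw [map_add, map_add, hv, hw])
    (fun c v hv => by rw [map_smul, map_smul, hv]) hop

variable (κ ℓ)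

/-- A constant pairs to zero with every series, so `A ⊗ 1` commutes with all of `𝔥((t))`; it also
kills the vacuum. Consequently the action of `𝔥((t))` depends only on classes in `H'`. -/
lemma op_single_zero (A : 𝔥) (c : ℂ) (v : Fock κ ℓ) :
    op κ ℓ A (HahnSeries.single 0 c) v = 0 := by
  induction v using fock_induction with
  | h0 => exact op_vac κ ℓ fun n hn => HahnSeries.coeff_single_of_ne hn.ne
  | hadd v w hv hw => rw [← opL_apply, map_add, opL_apply, opL_apply, hv, hw, add_zero]
  | hsmul c v hv => rw [← opL_apply, map_smul, opL_apply, hv, fock_smul_zero]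
  | hop B g v hv =>
    rw [op_comm, hv, resForm_single_zero, ← opL_apply, map_zero]
    simp [fock_zero_smul]

lemma op_rep_toHPrime (A : 𝔥) (f : LS) (v : Fock κ ℓ) :
    op κ ℓ A (rep (toHPrime f)) v = op κ ℓ A f v := by
  rw [rep_toHPrime, ← opL_apply, map_sub, LinearMap.sub_apply, opL_apply, opL_apply,
    op_single_zero, sub_zero]

variable {κ ℓ} in
/-- Every vector of the Fock representation is killed by `𝔥 ⊗ t ^ M ℂ⟦t⟧` for large `M`. -/
lemma exists_op_eq_zero (v : Fock κ ℓ) :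
    ∃ M : ℤ, ∀ (A : 𝔥) (f : LS), (∀ n < M, f.coeff n = 0) → op κ ℓ A f v = 0 := by
  induction v using fock_induction with
  | h0 => exact ⟨0, fun A f hf => op_vac κ ℓ hf⟩
  | hadd v w hv hw =>
    obtain ⟨M, hM⟩ := hv
    obtain ⟨M', hM'⟩ := hw
    refine ⟨max M M', fun A f hf => ?_⟩
    rw [← opL_apply, map_add, opL_apply, opL_apply, hM A f fun n hn => hf n (lt_max_of_lt_left hn),
      hM' A f fun n hn => hf n (lt_max_of_lt_right hn), add_zero]
  | hsmul c v hv =>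
    obtain ⟨M, hM⟩ := hv
    exact ⟨M, fun A f hf => by rw [← opL_apply, map_smul, opL_apply, hM A f hf, fock_smul_zero]⟩
  | hop B g v hv =>
    obtain ⟨M, hM⟩ := hv
    obtain ⟨N, hN⟩ := exists_coeff_bound g
    -- With `g` starting at `N`, a series starting at `1 - N` pairs to zero with `g`, so the
    -- commutator term drops out.
    refine ⟨max M (1 - N), fun A f hf => ?_⟩
    rw [op_comm, hM A f fun n hn => hf n (lt_max_of_lt_left hn),
      resForm_eq_zero (M := 1 - N) (fun n hn => hf n (lt_max_of_lt_right hn)) hN (by omega),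
      ← opL_apply, map_zero]
    simp [fock_zero_smul]

lemma coeff_sum_single (f : LS) (s : Finset ℤ) (n : ℤ) :
    (∑ m ∈ s, f.coeff m • HahnSeries.single m (1 : ℂ)).coeff n =
      if n ∈ s then f.coeff n else 0 := by
  rw [HahnSeries.coeff_sum]
  simp only [HahnSeries.coeff_smul, smul_eq_mul]
  split_ifs with h
  · rw [Finset.sum_eq_single n]
    · simp
    · intro m _ hm
      rw [HahnSeries.coeff_single_of_ne hm.symm, mul_zero]
    · exact fun h' => absurd h h'
  · refine Finset.sum_eq_zero fun m hm => ?_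
    rw [HahnSeries.coeff_single_of_ne, mul_zero]
    rintro rfl
    exact h hm

/-- Poles bound the modes from below and `v` bounds them from above. The window depends on `f` only
through `N`, so the same finite expansion serves a whole family of series with a common pole bound;
this is how `(A ⊗ f) t` becomes a finite sum of holomorphic functions times vectors. -/
lemma op_eq_sum (A : 𝔥) (f : LS) (v : Fock κ ℓ) {M N : ℤ} (hN : ∀ n < N, f.coeff n = 0)
    (hM : ∀ (A : 𝔥) (f : LS), (∀ n < M, f.coeff n = 0) → op κ ℓ A f v = 0) :
    op κ ℓ A f v = ∑ n ∈ Finset.Ico N M, f.coeff n • mode κ ℓ A n v := by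
  have h := hM A (f - ∑ m ∈ Finset.Ico N M, f.coeff m • HahnSeries.single m (1 : ℂ)) (by
    intro n hn
    rw [HahnSeries.coeff_sub, coeff_sum_single]
    by_cases h : N ≤ n
    · simp [h, hn]
    · simp [h, hN n (not_le.1 h)])
  rw [← opL_apply, map_sub, LinearMap.sub_apply, sub_eq_zero, opL_apply] at h
  rw [h, map_sum, LinearMap.sum_apply]
  refine Finset.sum_congr rfl fun n _ => ?_
  rw [map_smul, LinearMap.smul_apply]
  rfl

/-! ## The derivations `fockDer` -/

lemma fockDer_vac (S : spPlus) : fockDer κ ℓ S (vac κ ℓ) = 0 := by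
  have h : weylDer κ ℓ S 1 = 0 := by
    change (weylDual κ ℓ S 1).snd = 0
    rw [map_one, TrivSqZeroExt.snd_one]
  change Submodule.Quotient.mk (weylDer κ ℓ S 1) = _
  rw [h]
  rfl

lemma fockDer_op (S : spPlus) (A : 𝔥) (f : LS) (v : Fock κ ℓ) :
    fockDer κ ℓ S (op κ ℓ A f v) =
      op κ ℓ A (liftEnd S.1 f) v + op κ ℓ A f (fockDer κ ℓ S v) := by
  obtain ⟨w, rfl⟩ := Submodule.mkQ_surjective _ v
  have h : weylDer κ ℓ S (Weyl.of κ ℓ (A ⊗ₜ f)) = Weyl.of κ ℓ (A ⊗ₜ liftEnd S.1 f) := by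
    change (weylDual κ ℓ S _).snd = _
    rw [weylDual_of]
    simp [loopEnd]
  change Submodule.Quotient.mk (weylDer κ ℓ S (Weyl.of κ ℓ (A ⊗ₜ f) * w)) = _
  rw [weylDer_mul, h, add_comm, Submodule.Quotient.mk_add]
  rfl

lemma liftEnd_lie (S T : Module.End ℂ HPrime) (f : LS) :
    liftEnd ⁅S, T⁆ f = liftEnd S (liftEnd T f) - liftEnd T (liftEnd S f) := by
  simp [liftEnd, Ring.lie_def, toHPrime_rep]

/-- This and the next two lemmas make `S ↦ fockDer S` a representation: in each case both sides kill
the vacuum and have the same commutators with `op`. -/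
lemma fockDer_add (S T : spPlus) : fockDer κ ℓ (S + T) = fockDer κ ℓ S + fockDer κ ℓ T := by
  refine linearMap_ext_fock ?_ fun A f v hv => ?_
  · simp [fockDer_vac]
  · have h : liftEnd (S + T : spPlus).1 f = liftEnd S.1 f + liftEnd T.1 f := by simp [liftEnd]
    simp only [LinearMap.add_apply, fockDer_op, hv, h]
    simp only [← opL_apply, map_add, LinearMap.add_apply]
    abel

lemma fockDer_smul (c : ℂ) (S : spPlus) : fockDer κ ℓ (c • S) = c • fockDer κ ℓ S := by
  refine linearMap_ext_fock ?_ fun A f v hv => ?_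
  · simp [fockDer_vac]
  · have h : liftEnd (c • S : spPlus).1 f = c • liftEnd S.1 f := by simp [liftEnd]
    simp only [LinearMap.smul_apply, fockDer_op, hv, h]
    simp only [← opL_apply, map_smul, LinearMap.smul_apply, smul_add]

lemma fockDer_lie (S T : spPlus) : fockDer κ ℓ ⁅S, T⁆ =
    fockDer κ ℓ S ∘ₗ fockDer κ ℓ T - fockDer κ ℓ T ∘ₗ fockDer κ ℓ S := by
  refine linearMap_ext_fock ?_ fun A f v hv => ?_
  · simp [fockDer_vac]
  · have h : liftEnd (⁅S, T⁆ : spPlus).1 f = _ := liftEnd_lie S.1 T.1 f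
    simp only [LinearMap.sub_apply, LinearMap.comp_apply, fockDer_op, hv, h, map_add]
    simp only [← opL_apply, map_sub, LinearMap.sub_apply]
    abel

end Heisenberg

/-! ## The quadratic action at level one -/

/-- The matrix `s_{mn}` of an endomorphism `S`. -/
def quadCoeff (S : spPlus) (m n : ℤ) : ℂ := cf m (S.1 (b (-n))) / (n : ℂ)

/-- This is skewness of `S` tested on `b (-n)` and `b (-m)`. If an index is `0`, both sides vanish
because elements of `H'` have no zeroth coefficient and division by `0` gives `0`. -/
lemma quadCoeff_symm (S : spPlus) (m n : ℤ) : quadCoeff S m n = quadCoeff S n m := by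
  rcases eq_or_ne m 0 with rfl | hm
  · simp [quadCoeff, cf_zero]
  rcases eq_or_ne n 0 with rfl | hn
  · simp [quadCoeff, cf_zero]
  have h := S.2.1.2 (b (-n)) (b (-m))
  rw [symp_b _ _ hm, symp_neg_swap, symp_b _ _ hn] at h
  have hm' : (m : ℂ) ≠ 0 := by exact_mod_cast hm
  have hn' : (n : ℂ) ≠ 0 := by exact_mod_cast hn
  rw [quadCoeff, quadCoeff, div_eq_div_iff hn' hm']
  linear_combination h

/-- For `n < 0` the vector `b (-n)` lies in `H'_+`, which `S` preserves. Hence no term consists of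
two creation operators, which is what makes the vacuum invariant. -/
lemma quadCoeff_of_neg (S : spPlus) {m n : ℤ} (hm : m ≤ 0) (hn : n ≤ 0) : quadCoeff S m n = 0 := by
  rcases hn.eq_or_lt with rfl | hn
  · simp [quadCoeff]
  rcases hm.eq_or_lt with rfl | hm
  · simp [quadCoeff, cf_zero]
  rw [quadCoeff, S.2.2 (b (-n)) (fun k hk => ?_) m hm, zero_div]
  rw [cf_b _ _ (by omega), if_neg (by omega)]

lemma exists_cf_bound_finset {ι : Type*} (s : Finset ι) (u : ι → HPrime) :
    ∃ N : ℤ, ∀ i ∈ s, ∀ n < N, cf n (u i) = 0 := by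
  classical
  induction s using Finset.induction_on with
  | empty => exact ⟨0, by simp⟩
  | insert i s _ ih =>
    obtain ⟨N, hN⟩ := ih
    obtain ⟨N', hN'⟩ := exists_cf_bound (u i)
    refine ⟨min N N', fun j hj n hn => ?_⟩
    rcases Finset.mem_insert.1 hj with rfl | hj
    · exact hN' n (lt_of_lt_of_le hn (min_le_right _ _))
    · exact hN j hj n (lt_of_lt_of_le hn (min_le_left _ _))

section Heisenberg

variable {𝔥 : Type*} [AddCommGroup 𝔥] [Module ℂ 𝔥] (κ : LinearMap.BilinForm ℂ 𝔥)

section Quadratic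

variable {d : ℕ} (H : Module.Basis (Fin d) ℂ 𝔥)

/-- The summand of the quadratic action with index `(m, n)`. -/
def quadTerm (S : spPlus) (mn : ℤ × ℤ) : Module.End ℂ (Fock κ 1) :=
  quadCoeff S mn.1 mn.2 • ∑ i, opL κ 1 (H i) (HahnSeries.single (min mn.1 mn.2) 1) ∘ₗ
    opL κ 1 (H i) (HahnSeries.single (max mn.1 mn.2) 1)

lemma quadTerm_apply (S : spPlus) (mn : ℤ × ℤ) (v : Fock κ 1) :
    quadTerm κ H S mn v = (cf mn.1 (S.1 (b (-mn.2))) / (mn.2 : ℂ)) •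
      ∑ i, normalOrdered κ 1 (H i) mn.1 mn.2 v := by
  rw [quadTerm, LinearMap.smul_apply, LinearMap.sum_apply]
  rfl

/-- The square of side `2 R` around the origin. -/
def box (R : ℤ) : Finset (ℤ × ℤ) := Finset.Ico (-R) R ×ˢ Finset.Ico (-R) R

/-- A nonzero term has a positive index. Its larger index is below `M`, since otherwise the
right-hand factor kills `v`. The other index is then bounded below by the orders of the finitely
many series `S (b (-n))` with `0 < n < M`, using the symmetry of the coefficients when the positive
index is the first one. -/
lemma exists_quadTerm_eq_zero (S : spPlus) (v : Fock κ 1) :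
    ∃ R : ℤ, ∀ mn ∉ box R, quadTerm κ H S mn v = 0 := by
  obtain ⟨M, hM⟩ := exists_op_eq_zero v
  obtain ⟨N, hN⟩ := exists_cf_bound_finset (Finset.Ico 0 M) (fun n => S.1 (b (-n)))
  refine ⟨max (max M (-N)) 1, fun mn hmn => ?_⟩
  obtain ⟨m, n⟩ := mn
  by_cases hs : quadCoeff S m n = 0
  · simp [quadTerm, hs, fock_zero_smul]
  have hpos : 0 < m ∨ 0 < n := by
    by_contra! h
    exact hs (quadCoeff_of_neg S h.1 h.2)
  by_cases hmax : M ≤ max m n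
  · simp only [quadTerm, LinearMap.smul_apply, LinearMap.sum_apply, LinearMap.comp_apply]
    rw [Finset.sum_eq_zero, fock_smul_zero]
    intro i _
    rw [opL_apply κ 1 (H i) (HahnSeries.single (max m n) 1),
      hM (H i) _ fun k hk => HahnSeries.coeff_single_of_ne (by omega), map_zero]
  have key : ∀ m n : ℤ, 0 < n → n < M → quadCoeff S m n ≠ 0 → N ≤ m := by
    intro m n h0 h1 h2
    by_contra! h3
    exact h2 (by rw [quadCoeff, hN n (by simp; omega) m h3, zero_div])
  exfalso
  apply hmn
  simp only [box, Finset.mem_product, Finset.mem_Ico]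
  rcases hpos with h | h
  · have := key n m h (by omega) (by rwa [quadCoeff_symm])
    omega
  · have := key m n h (by omega) hs
    omega

lemma box_mono {R R' : ℤ} (h : R ≤ R') : box R ⊆ box R' := by
  intro mn
  simp only [box, Finset.mem_product, Finset.mem_Ico]
  omega

lemma quadAct_eq_sum (S : spPlus) (v : Fock κ 1) {E : Finset (ℤ × ℤ)}
    (hE : ∀ mn ∉ E, quadTerm κ H S mn v = 0) :
    quadAct κ H S v = (1 / 2 : ℂ) • ∑ mn ∈ E, quadTerm κ H S mn v := by
  rw [quadAct]
  simp only [← quadTerm_apply]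
  rw [finsum_eq_sum_of_support_subset]
  intro mn hmn
  by_contra h
  exact hmn (hE mn h)

/-- The quadratic action as a linear map. -/
def quadLin (S : spPlus) : Module.End ℂ (Fock κ 1) where
  toFun := quadAct κ H S
  map_add' v w := by
    obtain ⟨R, hR⟩ := exists_quadTerm_eq_zero κ H S v
    obtain ⟨R', hR'⟩ := exists_quadTerm_eq_zero κ H S w
    have h1 : ∀ mn ∉ box (max R R'), quadTerm κ H S mn v = 0 := fun mn h =>
      hR mn fun h' => h (box_mono (le_max_left _ _) h')
    have h2 : ∀ mn ∉ box (max R R'), quadTerm κ H S mn w = 0 := fun mn h =>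
      hR' mn fun h' => h (box_mono (le_max_right _ _) h')
    rw [quadAct_eq_sum κ H S v h1, quadAct_eq_sum κ H S w h2,
      quadAct_eq_sum κ H S (v + w) (E := box (max R R'))
        fun mn h => by rw [map_add, h1 mn h, h2 mn h, add_zero]]
    simp only [map_add, Finset.sum_add_distrib]
    exact fock_smul_add κ 1 _ _ _
  map_smul' c v := by
    obtain ⟨R, hR⟩ := exists_quadTerm_eq_zero κ H S v
    rw [quadAct_eq_sum κ H S v hR, quadAct_eq_sum κ H S (c • v) (E := box R)
        fun mn h => by rw [map_smul, hR mn h, fock_smul_zero]]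
    simp only [map_smul, RingHom.id_apply]
    rw [← fock_smul_sum, fock_smul_smul, fock_smul_smul, mul_comm]

/-- Each term with nonzero coefficient has a positive index, and normal ordering places that mode
next to the vacuum. -/
lemma quadLin_vac (S : spPlus) : quadLin κ H S (vac κ 1) = 0 := by
  change quadAct κ H S _ = 0
  rw [quadAct_eq_sum κ H S _ (E := ∅), Finset.sum_empty, fock_smul_zero]
  rintro ⟨m, n⟩ -
  by_cases hs : quadCoeff S m n = 0
  · simp [quadTerm, hs, fock_zero_smul]
  have hpos : 0 < m ∨ 0 < n := by
    by_contra! h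
    exact hs (quadCoeff_of_neg S h.1 h.2)
  simp only [quadTerm, LinearMap.smul_apply, LinearMap.sum_apply, LinearMap.comp_apply]
  rw [Finset.sum_eq_zero, fock_smul_zero]
  intro i _
  rw [opL_apply κ 1 (H i) (HahnSeries.single (max m n) 1),
    op_vac κ 1 fun k hk => HahnSeries.coeff_single_of_ne (by omega), map_zero]

variable {κ H}

/-- Moving the mode past the two factors leaves one contraction for each. Contractions are scalars,
so their sum does not depend on which factor normal ordering puts first. -/
lemma normalOrdered_mode (hH : ∀ i j, κ (H i) (H j) = if i = j then 1 else 0) (i j : Fin d)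
    (m n k : ℤ) (v : Fock κ 1) :
    opL κ 1 (H i) (HahnSeries.single (min m n) 1) (opL κ 1 (H i) (HahnSeries.single (max m n) 1)
        (mode κ 1 (H j) k v)) =
      mode κ 1 (H j) k (opL κ 1 (H i) (HahnSeries.single (min m n) 1)
        (opL κ 1 (H i) (HahnSeries.single (max m n) 1) v)) +
      if i = j then (if n = -k then (n : ℂ) else 0) • mode κ 1 (H j) m v +
        (if m = -k then (m : ℂ) else 0) • mode κ 1 (H j) n v else 0 := by
  simp only [mode, opL_apply]
  rw [op_comm κ 1 (H i) (H j), ← opL_apply κ 1 (H i) (HahnSeries.single (min m n) 1), map_add,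
    map_smul, opL_apply, opL_apply, op_comm κ 1 (H i) (H j), resForm_single_single,
    resForm_single_single, hH, add_assoc]
  congr 1
  by_cases hij : i = j
  · subst hij
    simp only [if_true]
    rcases le_total m n with h | h
    · simp only [min_eq_left h, max_eq_right h, mul_one, one_mul]
      exact add_comm _ _
    · simp only [min_eq_right h, max_eq_left h, mul_one, one_mul]
  · simp [hij, fock_zero_smul]

lemma quadTerm_mode (hH : ∀ i j, κ (H i) (H j) = if i = j then 1 else 0) (S : spPlus) (j : Fin d)
    (mn : ℤ × ℤ) (k : ℤ) (v : Fock κ 1) :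
    quadTerm κ H S mn (mode κ 1 (H j) k v) = mode κ 1 (H j) k (quadTerm κ H S mn v) +
      quadCoeff S mn.1 mn.2 • ((if mn.2 = -k then (mn.2 : ℂ) else 0) • mode κ 1 (H j) mn.1 v +
        (if mn.1 = -k then (mn.1 : ℂ) else 0) • mode κ 1 (H j) mn.2 v) := by
  simp only [quadTerm, LinearMap.smul_apply, LinearMap.sum_apply, LinearMap.comp_apply,
    normalOrdered_mode hH, Finset.sum_add_distrib, Finset.sum_ite_eq', Finset.mem_univ, if_true]
  have h : ∀ (c : ℂ) (w : Fin d → Fock κ 1), mode κ 1 (H j) k (c • ∑ i, w i) =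
      c • ∑ i, mode κ 1 (H j) k (w i) := by
    intro c w
    change opL κ 1 _ _ _ = _
    rw [map_smul, map_sum]
    rfl
  rw [h]
  exact fock_smul_add κ 1 _ _ _

/-- The contractions with the first factor and those with the second factor each sum to the operator
of `S (b k)`, by symmetry of the coefficients; the factor `1/2` compensates for this doubling. For
`k = 0` all three terms are zero. -/
lemma quadLin_mode (hH : ∀ i j, κ (H i) (H j) = if i = j then 1 else 0) (S : spPlus) (j : Fin d)
    (k : ℤ) (v : Fock κ 1) :
    quadLin κ H S (mode κ 1 (H j) k v) =
      op κ 1 (H j) (liftEnd S.1 (HahnSeries.single k 1)) v +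
        mode κ 1 (H j) k (quadLin κ H S v) := by
  rcases eq_or_ne k 0 with rfl | hk
  · have h0 : liftEnd S.1 (HahnSeries.single 0 1) = 0 := by
      have : toHPrime (HahnSeries.single 0 1) = 0 := by
        refine hprime_ext fun n => ?_
        rw [cf_toHPrime, map_zero]
        split_ifs with hn
        · rfl
        · exact HahnSeries.coeff_single_of_ne hn
      rw [liftEnd, LinearMap.comp_apply, LinearMap.comp_apply, this, map_zero, map_zero]
    rw [mode, mode, op_single_zero, op_single_zero, h0, map_zero, ← opL_apply, map_zero]
    simp
  obtain ⟨R₁, h₁⟩ := exists_quadTerm_eq_zero κ H S v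
  obtain ⟨R₂, h₂⟩ := exists_quadTerm_eq_zero κ H S (mode κ 1 (H j) k v)
  obtain ⟨M, hM⟩ := exists_op_eq_zero v
  obtain ⟨N, hN⟩ := exists_cf_bound (S.1 (b k))
  -- One box serves every sum: it contains the nonzero terms on `v` and on the shifted vector, the
  -- relevant modes of `S (b k)`, and the contracted index `-k`.
  obtain ⟨R, hR₁, hR₂, hRM, hRN, hRk, hRk'⟩ : ∃ R : ℤ, R₁ ≤ R ∧ R₂ ≤ R ∧ M ≤ R ∧ -N ≤ R ∧
      k < R ∧ -k < R :=
    ⟨max (max (max R₁ R₂) (max M (-N))) (max k (-k) + 1), by omega⟩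
  change quadAct κ H S _ = _ + mode κ 1 (H j) k (quadAct κ H S v)
  rw [quadAct_eq_sum κ H S v (E := box R) fun mn h => h₁ mn fun h' => h (box_mono hR₁ h'),
    quadAct_eq_sum κ H S _ (E := box R) fun mn h => h₂ mn fun h' => h (box_mono hR₂ h')]
  simp only [quadTerm_mode hH, Finset.sum_add_distrib]
  have hsum : op κ 1 (H j) (liftEnd S.1 (HahnSeries.single k 1)) v =
      ∑ m ∈ Finset.Ico (-R) R, cf m (S.1 (b k)) • mode κ 1 (H j) m v := by
    refine op_eq_sum κ 1 (H j) (rep (S.1 (b k))) v (fun n hn => hN n (by omega))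
      (fun A f hf => hM A f fun n hn => hf n (by omega))
  have hk' : (k : ℂ) ≠ 0 := by exact_mod_cast hk
  -- The contraction with `t ^ k` contributes the factor `-k`, which is exactly the denominator in
  -- the coefficient with index `-k`.
  have hcoef : ∀ m, quadCoeff S m (-k) * (-(k : ℂ)) = cf m (S.1 (b k)) := fun m => by
    rw [quadCoeff, neg_neg]
    push_cast
    rw [div_mul_cancel₀ _ (neg_ne_zero.2 hk')]
  have hmem : -k ∈ Finset.Ico (-R) R := by simp; omega
  have hA : ∑ mn ∈ box R, quadCoeff S mn.1 mn.2 •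
      ((if mn.2 = -k then (mn.2 : ℂ) else 0) • mode κ 1 (H j) mn.1 v) =
        ∑ m ∈ Finset.Ico (-R) R, cf m (S.1 (b k)) • mode κ 1 (H j) m v := by
    rw [box, Finset.sum_product]
    refine Finset.sum_congr rfl fun m _ => ?_
    rw [Finset.sum_eq_single_of_mem (-k) hmem]
    · rw [if_pos rfl, fock_smul_smul, Int.cast_neg, hcoef]
    · intro n _ hn
      rw [if_neg hn, fock_zero_smul, fock_smul_zero]
  have hB : ∑ mn ∈ box R, quadCoeff S mn.1 mn.2 •
      ((if mn.1 = -k then (mn.1 : ℂ) else 0) • mode κ 1 (H j) mn.2 v) =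
        ∑ m ∈ Finset.Ico (-R) R, cf m (S.1 (b k)) • mode κ 1 (H j) m v := by
    rw [box, Finset.sum_product_right]
    refine Finset.sum_congr rfl fun m _ => ?_
    rw [Finset.sum_eq_single_of_mem (-k) hmem]
    · rw [if_pos rfl, fock_smul_smul, Int.cast_neg, quadCoeff_symm, hcoef]
    · intro n _ hn
      rw [if_neg hn, fock_zero_smul, fock_smul_zero]
  have hC : mode κ 1 (H j) k ((1 / 2 : ℂ) • ∑ mn ∈ box R, quadTerm κ H S mn v) =
      (1 / 2 : ℂ) • ∑ mn ∈ box R, mode κ 1 (H j) k (quadTerm κ H S mn v) := by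
    change opL κ 1 _ _ _ = _
    rw [map_smul, map_sum]
    rfl
  simp only [fock_smul_add κ 1, Finset.sum_add_distrib, hA, hB, hC, hsum]
  module

/-- The defect `E` is bilinear in `A` and `f`, so `A` may be a basis vector. It vanishes on
monomials by `quadLin_mode` and on series of high order, and `f` is a finite sum of monomials plus
such a tail. -/
lemma quadLin_op (hH : ∀ i j, κ (H i) (H j) = if i = j then 1 else 0) (S : spPlus) (A : 𝔥)
    (f : LS) (v : Fock κ 1) :
    quadLin κ H S (op κ 1 A f v) =
      op κ 1 A (liftEnd S.1 f) v + op κ 1 A f (quadLin κ H S v) := by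
  let E : 𝔥 →ₗ[ℂ] LS →ₗ[ℂ] Fock κ 1 := LinearMap.mk₂ ℂ
    (fun A f => quadLin κ H S (opL κ 1 A f v) - opL κ 1 A (liftEnd S.1 f) v -
      opL κ 1 A f (quadLin κ H S v))
    (fun A B f => by simp only [map_add, LinearMap.add_apply]; abel)
    (fun c A f => by simp only [map_smul, LinearMap.smul_apply]; module)
    (fun A f g => by simp only [map_add, LinearMap.add_apply]; abel)
    (fun c A f => by simp only [map_smul, LinearMap.smul_apply]; module)
  suffices h : E A f = 0 by
    have h' : quadLin κ H S (opL κ 1 A f v) - opL κ 1 A (liftEnd S.1 f) v -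
      opL κ 1 A f (quadLin κ H S v) = 0 := h
    rw [sub_sub, sub_eq_zero] at h'
    exact h'
  suffices h : ∀ j, E (H j) f = 0 by
    have : E.flip f = 0 := H.ext fun j => h j
    exact LinearMap.congr_fun this A
  intro j
  obtain ⟨M₁, h₁⟩ := exists_op_eq_zero v
  obtain ⟨M₂, h₂⟩ := exists_op_eq_zero (quadLin κ H S v)
  -- Continuity of `S` is needed here: series starting at `M₃` are mapped to series starting at
  -- `M₁`, which kill `v`.
  obtain ⟨M₃, h₃⟩ := S.2.1.1 M₁
  set M := max M₁ (max M₂ M₃)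
  have htail : ∀ g : LS, (∀ n < M, g.coeff n = 0) → E (H j) g = 0 := by
    intro g hg
    change quadLin κ H S (op κ 1 (H j) g v) - op κ 1 (H j) (liftEnd S.1 g) v -
      op κ 1 (H j) g (quadLin κ H S v) = 0
    rw [h₁ _ g fun n hn => hg n (by omega), h₂ _ g fun n hn => hg n (by omega),
      h₁ _ (liftEnd S.1 g) (h₃ (toHPrime g) fun n hn => ?_), map_zero, sub_zero, sub_zero]
    rw [cf_toHPrime]
    split_ifs with h
    · rfl
    · exact hg n (by omega)
  obtain ⟨N, hN⟩ := exists_coeff_bound f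
  have h := htail (f - ∑ m ∈ Finset.Ico N M, f.coeff m • HahnSeries.single m (1 : ℂ)) (by
    intro n hn
    rw [HahnSeries.coeff_sub, coeff_sum_single]
    by_cases h : N ≤ n
    · simp [h, hn]
    · simp [h, hN n (not_le.1 h)])
  rw [map_sub, sub_eq_zero] at h
  rw [h, map_sum]
  refine Finset.sum_eq_zero fun n _ => ?_
  rw [map_smul]
  have h0 : E (H j) (HahnSeries.single n 1) = 0 := by
    change quadLin κ H S (mode κ 1 (H j) n v) -
      op κ 1 (H j) (liftEnd S.1 (HahnSeries.single n 1)) v -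
      mode κ 1 (H j) n (quadLin κ H S v) = 0
    rw [quadLin_mode hH, add_sub_cancel_left, sub_self]
  rw [h0, fock_smul_zero]

/-- The quadratic action at level one is the action by derivations. -/
lemma quadAct_eq_fockDer (hH : ∀ i j, κ (H i) (H j) = if i = j then 1 else 0) (S : spPlus)
    (v : Fock κ 1) : quadAct κ H S v = fockDer κ 1 S v := by
  have h : quadLin κ H S = fockDer κ 1 S := by
    refine linearMap_ext_fock ?_ fun A f v hv => ?_
    · rw [quadLin_vac, fockDer_vac]
    · rw [quadLin_op hH, fockDer_op, hv]
  exact LinearMap.congr_fun h v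

lemma spAct_eq_fockDer (hH : ∀ i j, κ (H i) (H j) = if i = j then 1 else 0) (k : Kind)
    (S : spPlus) (v : HVA κ k) : spAct κ H k S v = fockDer κ k.level S v := by
  cases k
  · exact quadAct_eq_fockDer hH S v
  · rfl

end Quadratic

/-! ## The action of the isotropy algebra on the Fock representation -/

variable {κ} {ℓ : ℂ}

/-- Let `N₀` be the smallest subspace containing the vacuum and stable under `𝔥 ⊗ Z`, and `P` the
part of `N₀` that `𝔥 ⊗ H'_+` maps into `N₀`. The vacuum lies in `P` because `H'_+` kills it, and `P`
is stable under `𝔥 ⊗ Z` because commutators are scalars. By minimality `N₀ = P`, so `N₀` is stable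
under `Z + H'_+ = H'` and is everything. -/
lemma fock_submodule_eq_top_of_transversal (Z : Submodule ℂ HPrime)
    (hZ : ∀ x, ∃ z ∈ Z, x - z ∈ HPlus) (N : Submodule ℂ (Fock κ ℓ)) (h0 : vac κ ℓ ∈ N)
    (h1 : ∀ (A : 𝔥), ∀ z ∈ Z, ∀ v ∈ N, op κ ℓ A (rep z) v ∈ N) : N = ⊤ := by
  let N₀ : Submodule ℂ (Fock κ ℓ) := sInf {N | vac κ ℓ ∈ N ∧
    ∀ (A : 𝔥), ∀ z ∈ Z, ∀ v ∈ N, op κ ℓ A (rep z) v ∈ N}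
  have hvac : vac κ ℓ ∈ N₀ := Submodule.mem_sInf.2 fun N hN => hN.1
  have hst : ∀ (A : 𝔥), ∀ z ∈ Z, ∀ v ∈ N₀, op κ ℓ A (rep z) v ∈ N₀ := fun A z hz v hv =>
    Submodule.mem_sInf.2 fun N hN => hN.2 A z hz v (Submodule.mem_sInf.1 hv N hN)
  let P : Submodule ℂ (Fock κ ℓ) :=
    { carrier := {v | v ∈ N₀ ∧ ∀ (A : 𝔥), ∀ w ∈ HPlus, op κ ℓ A (rep w) v ∈ N₀}
      add_mem' := fun {v v'} hv hv' => ⟨add_mem hv.1 hv'.1, fun A w hw => by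
        rw [← opL_apply, map_add]; exact add_mem (hv.2 A w hw) (hv'.2 A w hw)⟩
      zero_mem' := ⟨zero_mem _, fun A w _ => by rw [← opL_apply, map_zero]; exact zero_mem _⟩
      smul_mem' := fun c v hv => ⟨N₀.smul_mem c hv.1, fun A w hw => by
        rw [← opL_apply, map_smul]; exact N₀.smul_mem c (hv.2 A w hw)⟩ }
  have hP : N₀ ≤ P := by
    refine sInf_le ⟨⟨hvac, fun A w hw => ?_⟩, fun A z hz v hv => ⟨hst A z hz v hv.1, ?_⟩⟩
    · rw [op_vac κ ℓ hw]; exact zero_mem _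
    · intro B w hw
      rw [op_comm]
      exact add_mem (hst A z hz _ (hv.2 B w hw)) (N₀.smul_mem _ hv.1)
  have htop : N₀ = ⊤ := by
    refine fock_submodule_eq_top N₀ hvac fun A f v hv => ?_
    obtain ⟨z, hz, hw⟩ := hZ (toHPrime f)
    rw [← op_rep_toHPrime, ← add_sub_cancel z (toHPrime f), map_add, ← opL_apply, map_add]
    exact add_mem (hst A z hz v hv) ((hP hv).2 A _ hw)
  rw [eq_top_iff, ← htop]
  exact sInf_le ⟨h0, h1⟩

lemma ExtPPAV.exists_sub_mem_plus {g : ℕ} (a : ExtPPAV g) (x : HPrime) :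
    ∃ z ∈ a.Z, x - z ∈ HPlus := by
  obtain ⟨z, hz⟩ := a.prMinus_bijective.2 (prMinus x)
  refine ⟨z, z.2, ?_⟩
  have h : prMinus (x - z) = 0 := by
    rw [map_sub, ← hz]
    exact sub_self _
  rw [← prMinus_add_prPlus (x - z), h, ZeroMemClass.coe_zero, zero_add]
  exact (prPlus _).2

lemma ExtPPAV.symp_Z {g : ℕ} (a : ExtPPAV g) {z z' : HPrime} (hz : z ∈ a.Z) (hz' : z' ∈ a.Z) :
    symp z z' = 0 := by
  rw [← a.lagrangian] at hz'
  exact hz' z hz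

lemma ExtPPAV.Z_le_perp {g : ℕ} (a : ExtPPAV g) : a.Z ≤ symp.orthogonal a.F :=
  fun _ hz _ hx => a.symp_Z (a.F_le_Z hx) hz

/-- The vectors that `fockDer S` sends into `(𝔥 ⊗ F)(V)` include the vacuum and are stable under `𝔥
⊗ Z`. Indeed `S z ∈ F` because `Z ⊆ F^⊥`, and `(𝔥 ⊗ F)(V)` is stable under `𝔥 ⊗ Z` because `Z` is
isotropic and so commutes with `F`. -/
lemma fockDer_mem_houtFiber {g : ℕ} (a : ExtPPAV g) (k : Kind) {S : spPlus}
    (hS : S.1 ∈ spPlusF a.F) (v : HVA κ k) : fockDer κ k.level S v ∈ houtFiber κ k a := by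
  have hZ : ∀ (A : 𝔥), ∀ z ∈ a.Z, ∀ w ∈ houtFiber κ k a,
      op κ k.level A (rep z) w ∈ houtFiber κ k a := by
    intro A z hz w hw
    induction hw using Submodule.span_induction with
    | mem w hw =>
      obtain ⟨B, f, u, hf, rfl⟩ := hw
      rw [op_comm, show resForm (rep z) (rep f) = 0 from a.symp_Z hz (a.F_le_Z hf), zero_mul,
        mul_zero, fock_zero_smul, add_zero]
      exact Submodule.subset_span ⟨B, f, _, hf, rfl⟩
    | zero => rw [← opL_apply, map_zero]; exact zero_mem _
    | add w w' _ _ hw hw' => rw [← opL_apply, map_add]; exact add_mem hw hw'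
    | smul c w _ hw => rw [← opL_apply, map_smul]; exact Submodule.smul_mem _ c hw
  have h := fock_submodule_eq_top_of_transversal (κ := κ) (ℓ := k.level) a.Z a.exists_sub_mem_plus
    ((houtFiber κ k a).comap (fockDer κ k.level S)) ?_ ?_
  · have hv : v ∈ (⊤ : Submodule ℂ (HVA κ k)) := trivial
    rw [← h] at hv
    exact hv
  · rw [Submodule.mem_comap, fockDer_vac]; exact zero_mem _
  · intro A z hz v hv
    rw [Submodule.mem_comap, fockDer_op]
    refine add_mem (Submodule.subset_span ⟨A, S.1 z, v, hS.2.2 z (a.Z_le_perp hz), ?_⟩)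
      (hZ A z hz _ hv)
    simp [liftEnd, toHPrime_rep]

end Heisenberg

/-! ## Truncation in `H'` -/

lemma b_zero : b 0 = 0 := by
  refine hprime_ext fun n => ?_
  rw [b, cf_toHPrime, map_zero]
  split_ifs with hn
  · rfl
  · exact HahnSeries.coeff_single_of_ne hn

lemma cf_sum_b (x : HPrime) (s : Finset ℤ) (n : ℤ) :
    cf n (∑ m ∈ s, cf m x • b m) = if n ∈ s then cf n x else 0 := by
  rcases eq_or_ne n 0 with rfl | hn
  · simp [cf_zero]
  rw [map_sum]
  have h : ∀ m ∈ s, cf n (cf m x • b m) = if n = m then cf n x else 0 := by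
    intro m _
    rcases eq_or_ne m 0 with rfl | hm
    · rw [b_zero, smul_zero, map_zero, if_neg hn]
    · rw [map_smul, cf_b _ _ hm]
      split_ifs with h
      · simp [h]
      · simp
  rw [Finset.sum_congr rfl h, Finset.sum_ite_eq]

lemma prMinus_of_plus {x : HPrime} (hx : x ∈ HPlus) : prMinus x = 0 := by
  apply Subtype.ext
  refine hprime_ext fun n => ?_
  rw [cf_prMinus]
  split_ifs with hn
  · simp [hx n hn]
  · simp

lemma prPlus_of_plus {x : HPrime} (hx : x ∈ HPlus) : (prPlus x : HPrime) = x := by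
  have := prMinus_add_prPlus x
  rwa [prMinus_of_plus hx, ZeroMemClass.coe_zero, zero_add] at this

lemma prMinus_of_minus (x : HMinus) : prMinus (x : HPrime) = x := by
  apply Subtype.ext
  refine hprime_ext fun n => ?_
  rw [cf_prMinus]
  split_ifs with hn
  · rfl
  · rcases (not_lt.1 hn).eq_or_lt with rfl | hn
    · rw [cf_zero]
    · rw [x.2 n hn]

/-- The vectors are written `prMinus (b n)` to match the coordinates of `φ` in `coord`; linear maps
out of `H_-` thus depend on finitely many coordinates at a given vector. -/
lemma minus_eq_sum (y : HMinus) {N : ℤ} (hN : ∀ n < N, cf n y = 0) :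
    y = ∑ n ∈ Finset.Ico N 0, cf n (y : HPrime) • prMinus (b n) := by
  have h : (y : HPrime) = ∑ n ∈ Finset.Ico N 0, cf n (y : HPrime) • b n := by
    refine hprime_ext fun n => ?_
    rw [cf_sum_b]
    split_ifs with hn
    · rfl
    · rw [Finset.mem_Ico, not_and_or] at hn
      rcases hn with hn | hn
      · exact hN n (by omega)
      · rcases (not_lt.1 hn).eq_or_lt with rfl | hn
        · exact cf_zero _
        · exact y.2 n hn
  have key := congrArg prMinus h
  rw [prMinus_of_minus, map_sum] at key
  simpa using key

/-- A continuous endomorphism is determined coefficientwise by finitely many coefficients. -/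
lemma exists_cf_eq_sum {T : Module.End ℂ HPrime} (hT : IsTAdicContinuous T) (l : ℤ) :
    ∃ M : ℤ, ∀ (x : HPrime) (N : ℤ), (∀ n < N, cf n x = 0) →
      cf l (T x) = ∑ n ∈ Finset.Ico N M, cf n x * cf l (T (b n)) := by
  obtain ⟨M, hM⟩ := hT (l + 1)
  refine ⟨M, fun x N hN => ?_⟩
  have h := hM (x - ∑ n ∈ Finset.Ico N M, cf n x • b n) (by
    intro n hn
    rw [map_sub, cf_sum_b]
    by_cases h : N ≤ n
    · simp [h, hn]
    · simp [h, hN n (not_le.1 h)]) l (by omega)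
  rw [map_sub, map_sub, sub_eq_zero] at h
  rw [h, map_sum, map_sum]
  simp

namespace Model

variable {g : ℕ}

/-! ## Holomorphic functions on the space of pairs `(φ, h)` -/

@[ext]
lemma ext' {p q : Model g} (hφ : p.φ = q.φ) (hh : p.h = q.h) : p = q := by
  cases p; cases q; simp_all

lemma continuous_coord : Continuous (coord : Model g → _) := continuous_induced_dom

/-- The coordinates with index in a finite set. -/
def coords (s : Finset ((ℤ × ℤ) ⊕ (Fin g × ℤ))) (p : Model g) : s → ℂ := fun i => p.coord i

lemma continuous_coords (s : Finset ((ℤ × ℤ) ⊕ (Fin g × ℤ))) : Continuous (coords s) :=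
  continuous_pi fun _ => (continuous_apply _).comp continuous_coord

lemma HolAt.congr {f f' : Model g → ℂ} {p : Model g} (hf : HolAt f p)
    (h : ∀ᶠ q in nhds p, f' q = f q) : HolAt f' p := by
  obtain ⟨s, G, hG, hf⟩ := hf
  exact ⟨s, G, hG, h.and hf |>.mono fun q hq => hq.1.trans hq.2⟩

/-- Finitely many holomorphic functions involve finitely many coordinates altogether, so they can be
written over a common index set. Sums, products and inverses are special cases. -/
lemma HolAt.comp_analytic {ι : Type*} [Fintype ι] {f : ι → Model g → ℂ} {p : Model g}
    (hf : ∀ i, HolAt (f i) p) {Φ : (ι → ℂ) → ℂ} (hΦ : AnalyticAt ℂ Φ fun i => f i p) :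
    HolAt (fun q => Φ fun i => f i q) p := by
  classical
  choose s G hG hfG using hf
  have hsub : ∀ i, s i ⊆ Finset.univ.biUnion s := fun i =>
    Finset.subset_biUnion_of_mem s (Finset.mem_univ i)
  let U := Finset.univ.biUnion s
  let r : (i : ι) → (U → ℂ) →L[ℂ] (s i → ℂ) := fun i =>
    ContinuousLinearMap.pi fun j => ContinuousLinearMap.proj (⟨j.1, hsub i j.2⟩ : U)
  refine ⟨U, fun x => Φ fun i => G i (r i x), ?_, ?_⟩
  · refine AnalyticAt.comp (g := Φ) (f := fun x i => G i (r i x)) ?_ (AnalyticAt.pi fun i => ?_)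
    · have : (fun i => G i (r i fun i => p.coord i)) = fun i => f i p := by
        ext i
        exact (hfG i).self_of_nhds.symm
      rw [this]
      exact hΦ
    · exact AnalyticAt.comp (g := G i) (f := r i) (hG i) ((r i).analyticAt _)
  · filter_upwards [Filter.eventually_all.2 hfG] with q hq
    congr 1
    ext i
    exact hq i

lemma holAt_const (c : ℂ) (p : Model g) : HolAt (fun _ => c) p :=
  ⟨∅, fun _ => c, analyticAt_const, Filter.Eventually.of_forall fun _ => rfl⟩

lemma holAt_coord (i : (ℤ × ℤ) ⊕ (Fin g × ℤ)) (p : Model g) : HolAt (fun q => q.coord i) p :=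
  ⟨{i}, fun x => x ⟨i, Finset.mem_singleton_self i⟩,
    (ContinuousLinearMap.proj (R := ℂ) (φ := fun _ => ℂ)
      (⟨i, Finset.mem_singleton_self i⟩ : ({i} : Finset _))).analyticAt _,
    Filter.Eventually.of_forall fun _ => rfl⟩

lemma HolAt.add {f f' : Model g → ℂ} {p : Model g} (hf : HolAt f p) (hf' : HolAt f' p) :
    HolAt (fun q => f q + f' q) p := by
  have := HolAt.comp_analytic (f := ![f, f']) (p := p) (by
    intro i; fin_cases i
    · exact hf
    · exact hf') (Φ := fun x => x 0 + x 1)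
    (((ContinuousLinearMap.proj (R := ℂ) (φ := fun _ : Fin 2 => ℂ) 0).analyticAt _).add
      ((ContinuousLinearMap.proj (R := ℂ) (φ := fun _ : Fin 2 => ℂ) 1).analyticAt _))
  exact this

lemma HolAt.mul {f f' : Model g → ℂ} {p : Model g} (hf : HolAt f p) (hf' : HolAt f' p) :
    HolAt (fun q => f q * f' q) p := by
  have := HolAt.comp_analytic (f := ![f, f']) (p := p) (by
    intro i; fin_cases i
    · exact hf
    · exact hf') (Φ := fun x => x 0 * x 1)
    (((ContinuousLinearMap.proj (R := ℂ) (φ := fun _ : Fin 2 => ℂ) 0).analyticAt _).mul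
      ((ContinuousLinearMap.proj (R := ℂ) (φ := fun _ : Fin 2 => ℂ) 1).analyticAt _))
  exact this

lemma HolAt.const_mul (c : ℂ) {f : Model g → ℂ} {p : Model g} (hf : HolAt f p) :
    HolAt (fun q => c * f q) p := (holAt_const c p).mul hf

lemma HolAt.neg {f : Model g → ℂ} {p : Model g} (hf : HolAt f p) :
    HolAt (fun q => -f q) p := by
  simpa using hf.const_mul (-1)

lemma HolAt.sub {f f' : Model g → ℂ} {p : Model g} (hf : HolAt f p) (hf' : HolAt f' p) :
    HolAt (fun q => f q - f' q) p := by
  simpa [sub_eq_add_neg] using hf.add hf'.neg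

lemma HolAt.sum {ι : Type*} (s : Finset ι) {f : ι → Model g → ℂ} {p : Model g}
    (hf : ∀ i ∈ s, HolAt (f i) p) : HolAt (fun q => ∑ i ∈ s, f i q) p := by
  classical
  induction s using Finset.induction_on with
  | empty => simpa using holAt_const 0 p
  | insert i s hi ih =>
    simp only [Finset.sum_insert hi]
    exact (hf i (Finset.mem_insert_self i s)).add
      (ih fun j hj => hf j (Finset.mem_insert_of_mem hj))

/-! ## The vector field of an element of `sp⁺(H')` -/

/-- The usual quadratic Riccati term in `φ` is absent because `S` preserves `H'_+`. The vector field
is therefore affine in `φ`, which makes its derivatives explicit in `vel_move`. -/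
lemma tangent_apply (p : Model g) (S : spPlus) (x : HMinus) :
    (((p.tangent S).1 x : HPlus) : HPrime) =
      prPlus (S.1 x) + S.1 (p.φ.1 x) - p.φ.1 (prMinus (S.1 x)) := by
  change (((prPlus (S.1 (p.graphMap x)) - p.φ.1 (prMinus (S.1 (p.graphMap x)))) : HPlus) :
    HPrime) = _
  have h : S.1 (p.φ.1 x) ∈ HPlus := S.2.2 _ (p.φ.1 x).2
  rw [graphMap_apply, map_add, map_add, map_add, prMinus_of_plus h, add_zero,
    AddSubgroupClass.coe_sub, Submodule.coe_add, prPlus_of_plus h]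

/-- The coordinates of the tangent vector at `(φ, h)` given by `S`. -/
def vel (S : spPlus) : (ℤ × ℤ) ⊕ (Fin g × ℤ) → Model g → ℂ
  | Sum.inl (k, l), p => cf l ((p.tangent S).1 (prMinus (b k)))
  | Sum.inr (i, l), p => cf l (S.1 (p.h i))

lemma coord_move (p : Model g) (S : spPlus) (ε : ℂ) (i : (ℤ × ℤ) ⊕ (Fin g × ℤ)) :
    (p.move S ε).coord i = p.coord i + ε * vel S i p := by
  rcases i with ⟨k, l⟩ | ⟨i, l⟩
  · simp [coord, move, vel]
  · simp [coord, move, vel]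

lemma move_zero (p : Model g) (S : spPlus) : p.move S 0 = p := by
  ext1
  · simp [move]
  · ext i; simp [move]

lemma continuous_move (p : Model g) (S : spPlus) : Continuous (p.move S) := by
  refine continuous_induced_rng.2 (continuous_pi fun i => ?_)
  have : (fun ε => (p.move S ε).coord i) = fun ε => p.coord i + ε * vel S i p :=
    funext fun ε => coord_move p S ε i
  change Continuous fun ε => (p.move S ε).coord i
  rw [this]
  fun_prop

lemma eventually_move {P : Model g → Prop} {p : Model g} (h : ∀ᶠ q in nhds p, P q) (S : spPlus) :
    ∀ᶠ ε in nhds (0 : ℂ), P (p.move S ε) := by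
  have := (continuous_move p S).continuousAt (x := 0)
  rw [ContinuousAt, move_zero] at this
  exact this.eventually h

/-- The derivative in the direction of the vector field of `S`. -/
def dir (S : spPlus) (f : Model g → ℂ) (p : Model g) : ℂ :=
  deriv (fun ε : ℂ => f (p.move S ε)) 0

lemma dir_congr {f f' : Model g → ℂ} {p : Model g} (h : ∀ᶠ q in nhds p, f q = f' q) (S : spPlus) :
    dir S f p = dir S f' p :=
  Filter.EventuallyEq.deriv_eq (eventually_move h S)

/-- The partial derivative with index `i`. -/
def pd {s : Finset ((ℤ × ℤ) ⊕ (Fin g × ℤ))} (i : s) (G : (s → ℂ) → ℂ) (x : s → ℂ) : ℂ :=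
  fderiv ℂ G x (open Classical in Pi.single i 1)

lemma analyticAt_pd {s : Finset ((ℤ × ℤ) ⊕ (Fin g × ℤ))} (i : s) {G : (s → ℂ) → ℂ} {x : s → ℂ}
    (hG : AnalyticAt ℂ G x) : AnalyticAt ℂ (pd i G) x :=
  ((ContinuousLinearMap.apply ℂ ℂ (open Classical in Pi.single i 1 : s → ℂ)).analyticAt _).comp
    hG.fderiv

lemma pd_comm {s : Finset ((ℤ × ℤ) ⊕ (Fin g × ℤ))} (i j : s) {G : (s → ℂ) → ℂ} {x : s → ℂ}
    (hG : AnalyticAt ℂ G x) : pd i (pd j G) x = pd j (pd i G) x := by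
  have h : ∀ i j : s, pd i (pd j G) x = fderiv ℂ (fderiv ℂ G) x
      (open Classical in Pi.single i 1) (open Classical in Pi.single j 1) := by
    intro i j
    change fderiv ℂ (fun y => fderiv ℂ G y _) x _ = _
    rw [fderiv_clm_apply hG.fderiv.differentiableAt (differentiableAt_const _)]
    simp
  rw [h, h]
  exact (hG.contDiffAt (n := ⊤)).isSymmSndFDerivAt_of_omega _ _

lemma hasDerivAt_move {s : Finset ((ℤ × ℤ) ⊕ (Fin g × ℤ))} {G : (s → ℂ) → ℂ} {p : Model g}
    (hG : AnalyticAt ℂ G (coords s p)) {f : Model g → ℂ}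
    (hf : ∀ᶠ q in nhds p, f q = G (coords s q)) (S : spPlus) :
    HasDerivAt (fun ε => f (p.move S ε)) (∑ i, pd i G (coords s p) * vel S i p) 0 := by
  classical
  have hc : HasDerivAt (fun ε => coords s (p.move S ε)) (fun i : s => vel S i p) 0 := by
    rw [hasDerivAt_pi]
    intro i
    have : (fun ε => coords s (p.move S ε) i) = fun ε => p.coord i + ε * vel S i p :=
      funext fun ε => coord_move p S ε i
    rw [this]
    simpa using ((hasDerivAt_id (0 : ℂ)).mul_const (vel S i p)).const_add (p.coord i)
  have hG' : HasFDerivAt G (fderiv ℂ G (coords s p)) (coords s (p.move S 0)) := by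
    rw [move_zero]
    exact hG.differentiableAt.hasFDerivAt
  have h := hG'.comp_hasDerivAt (0 : ℂ) hc
  have hsum : fderiv ℂ G (coords s p) (fun i : s => vel S i p) =
      ∑ i, pd i G (coords s p) * vel S i p := by
    conv_lhs => rw [pi_eq_sum_univ' (fun i : s => vel S i p)]
    rw [map_sum]
    refine Finset.sum_congr rfl fun i _ => ?_
    rw [map_smul, smul_eq_mul, mul_comm, pd]
  rw [← hsum]
  exact h.congr_of_eventuallyEq (eventually_move hf S)

lemma dir_eq_sum {s : Finset ((ℤ × ℤ) ⊕ (Fin g × ℤ))} {G : (s → ℂ) → ℂ} {p : Model g}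
    (hG : AnalyticAt ℂ G (coords s p)) {f : Model g → ℂ}
    (hf : ∀ᶠ q in nhds p, f q = G (coords s q)) (S : spPlus) :
    dir S f p = ∑ i, pd i G (coords s p) * vel S i p :=
  (hasDerivAt_move hG hf S).deriv

lemma HolAt.differentiableAt {f : Model g → ℂ} {p : Model g} (hf : HolAt f p) (S : spPlus) :
    DifferentiableAt ℂ (fun ε => f (p.move S ε)) 0 := by
  obtain ⟨s, G, hG, hf⟩ := hf
  exact (hasDerivAt_move hG hf S).differentiableAt

lemma dir_const (S : spPlus) (c : ℂ) (p : Model g) : dir S (fun _ => c) p = 0 := by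
  simp [dir]

lemma dir_add {f f' : Model g → ℂ} {p : Model g} (hf : HolAt f p) (hf' : HolAt f' p) (S : spPlus) :
    dir S (fun q => f q + f' q) p = dir S f p + dir S f' p :=
  deriv_fun_add (hf.differentiableAt S) (hf'.differentiableAt S)

lemma dir_mul {f f' : Model g → ℂ} {p : Model g} (hf : HolAt f p) (hf' : HolAt f' p) (S : spPlus) :
    dir S (fun q => f q * f' q) p = dir S f p * f' p + f p * dir S f' p := by
  have := deriv_fun_mul (hf.differentiableAt S) (hf'.differentiableAt S)
  rw [move_zero] at this
  exact this

lemma dir_const_mul (c : ℂ) {f : Model g → ℂ} {p : Model g} (hf : HolAt f p) (S : spPlus) :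
    dir S (fun q => c * f q) p = c * dir S f p := by
  rw [dir_mul (holAt_const c p) hf, dir_const, zero_mul, zero_add]

lemma dir_neg {f : Model g → ℂ} {p : Model g} (S : spPlus) :
    dir S (fun q => -f q) p = -dir S f p :=
  deriv.fun_neg

lemma dir_sum {ι : Type*} (s : Finset ι) {f : ι → Model g → ℂ} {p : Model g}
    (hf : ∀ i ∈ s, HolAt (f i) p) (S : spPlus) :
    dir S (fun q => ∑ i ∈ s, f i q) p = ∑ i ∈ s, dir S (f i) p :=
  deriv_fun_sum fun i hi => (hf i hi).differentiableAt S

lemma dir_coord (S : spPlus) (i : (ℤ × ℤ) ⊕ (Fin g × ℤ)) (p : Model g) :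
    dir S (fun q => q.coord i) p = vel S i p := by
  rw [dir]
  simp only [coord_move]
  simp

lemma cf_phi (p : Model g) (y : HMinus) (l : ℤ) {N : ℤ} (hN : ∀ n < N, cf n y = 0) :
    cf l (p.φ.1 y) = ∑ k ∈ Finset.Ico N 0, cf k (y : HPrime) * p.coord (Sum.inl (k, l)) := by
  conv_lhs => rw [minus_eq_sum y hN]
  simp [coord]

/-- A fixed coefficient of `S y`, for `y` in `H'_+`, involves finitely many coefficients of `y` by
continuity, and the `H_-` part of `S (b k)` is a finite sum. So each component is an affine function
of finitely many coordinates, and `dir S` preserves holomorphy. -/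
lemma holAt_vel (S : spPlus) (i : (ℤ × ℤ) ⊕ (Fin g × ℤ)) (p : Model g) : HolAt (vel S i) p := by
  rcases i with ⟨k, l⟩ | ⟨i, l⟩
  · obtain ⟨M, hM⟩ := exists_cf_eq_sum S.2.1.1 l
    obtain ⟨N, hN⟩ := exists_cf_bound (prMinus (S.1 (prMinus (b k))) : HPrime)
    have h : vel S (Sum.inl (k, l)) = fun q : Model g =>
        cf l (prPlus (S.1 (prMinus (b k)))) +
          (∑ n ∈ Finset.Ico 0 M, q.coord (Sum.inl (k, n)) * cf l (S.1 (b n))) -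
          ∑ j ∈ Finset.Ico N 0, cf j (prMinus (S.1 (prMinus (b k))) : HPrime) *
            q.coord (Sum.inl (j, l)) := by
      funext q
      change cf l (((q.tangent S).1 (prMinus (b k)) : HPlus) : HPrime) = _
      rw [tangent_apply, map_sub, map_add, cf_phi q _ l hN,
        hM _ 0 (fun n hn => (q.φ.1 _).2 n hn)]
      rfl
    rw [h]
    exact ((holAt_const _ p).add (HolAt.sum _ fun n _ =>
      (holAt_coord _ p).mul (holAt_const _ p))).sub
        (HolAt.sum _ fun n _ => (holAt_coord _ p).const_mul _)
  · obtain ⟨M, hM⟩ := exists_cf_eq_sum S.2.1.1 l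
    have h : vel S (Sum.inr (i, l)) = fun q : Model g =>
        ∑ n ∈ Finset.Ico 0 M, q.coord (Sum.inr (i, n)) * cf l (S.1 (b n)) := by
      funext q
      exact hM _ 0 (fun n hn => (q.h i).2 n hn)
    rw [h]
    exact HolAt.sum _ fun n _ => (holAt_coord _ p).mul (holAt_const _ p)

lemma HolAt.dir {f : Model g → ℂ} {p : Model g} (hf : HolAt f p) (S : spPlus) :
    HolAt (dir S f) p := by
  obtain ⟨s, G, hG, hf⟩ := hf
  have h1 : ∀ᶠ q in nhds p, AnalyticAt ℂ G (coords s q) :=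
    (continuous_coords s).continuousAt.eventually hG.eventually_analyticAt
  refine HolAt.congr (f := fun q => ∑ i : s, pd i G (coords s q) * vel S i q) ?_ ?_
  · refine HolAt.sum _ fun i _ => HolAt.mul ?_ (holAt_vel S i p)
    exact ⟨s, pd i G, analyticAt_pd i hG, Filter.Eventually.of_forall fun _ => rfl⟩
  · filter_upwards [h1, hf.eventually_nhds] with q h1 h2
    exact dir_eq_sum h1 h2 S

lemma vel_add (S T : spPlus) (i : (ℤ × ℤ) ⊕ (Fin g × ℤ)) (p : Model g) :
    vel (S + T) i p = vel S i p + vel T i p := by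
  rcases i with ⟨k, l⟩ | ⟨i, l⟩
  · have h : ∀ x, (S + T : spPlus).1 x = S.1 x + T.1 x := fun _ => rfl
    simp only [vel, tangent_apply, h, map_add, map_sub, Submodule.coe_add]
    ring
  · simp [vel]

lemma vel_smul (c : ℂ) (S : spPlus) (i : (ℤ × ℤ) ⊕ (Fin g × ℤ)) (p : Model g) :
    vel (c • S) i p = c * vel S i p := by
  rcases i with ⟨k, l⟩ | ⟨i, l⟩
  · have h : ∀ x, (c • S : spPlus).1 x = c • S.1 x := fun _ => rfl
    simp only [vel, tangent_apply, h, map_add, map_sub, map_smul, Submodule.coe_smul, smul_eq_mul]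
    ring
  · simp [vel]

lemma dir_add_left {f : Model g → ℂ} {p : Model g} (hf : HolAt f p) (S T : spPlus) :
    dir (S + T) f p = dir S f p + dir T f p := by
  obtain ⟨s, G, hG, hf⟩ := hf
  rw [dir_eq_sum hG hf, dir_eq_sum hG hf, dir_eq_sum hG hf, ← Finset.sum_add_distrib]
  exact Finset.sum_congr rfl fun i _ => by rw [vel_add]; ring

lemma dir_smul_left {f : Model g → ℂ} {p : Model g} (hf : HolAt f p) (c : ℂ) (S : spPlus) :
    dir (c • S) f p = c * dir S f p := by
  obtain ⟨s, G, hG, hf⟩ := hf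
  rw [dir_eq_sum hG hf, dir_eq_sum hG hf, Finset.mul_sum]
  exact Finset.sum_congr rfl fun i _ => by rw [vel_smul]; ring

/-- The derivative of the vector field of `S` in the direction of the one of `T`. -/
def velDeriv (S T : spPlus) : (ℤ × ℤ) ⊕ (Fin g × ℤ) → Model g → ℂ
  | Sum.inl (k, l), p => cf l (S.1 ((p.tangent T).1 (prMinus (b k)))) -
      cf l ((p.tangent T).1 (prMinus (S.1 (prMinus (b k)))))
  | Sum.inr (i, l), p => cf l (S.1 (T.1 (p.h i)))

lemma vel_move (S T : spPlus) (i : (ℤ × ℤ) ⊕ (Fin g × ℤ)) (p : Model g) (ε : ℂ) :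
    vel S i (p.move T ε) = vel S i p + ε * velDeriv S T i p := by
  rcases i with ⟨k, l⟩ | ⟨i, l⟩
  · have h : ∀ x, ((p.move T ε).φ.1 x : HPrime) = p.φ.1 x + ε • ((p.tangent T).1 x : HPrime) :=
      fun x => rfl
    simp only [vel, velDeriv]
    rw [tangent_apply, tangent_apply p S, h, h]
    simp only [map_add, map_sub, map_smul, smul_eq_mul]
    ring
  · have h : ((p.move T ε).h i : HPrime) = p.h i + ε • T.1 (p.h i) := rfl
    simp only [vel, velDeriv]
    rw [h]
    simp

lemma dir_vel (S T : spPlus) (i : (ℤ × ℤ) ⊕ (Fin g × ℤ)) (p : Model g) :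
    dir T (vel S i) p = velDeriv S T i p := by
  rw [dir]
  simp only [vel_move]
  simp

lemma velDeriv_sub (S T : spPlus) (i : (ℤ × ℤ) ⊕ (Fin g × ℤ)) (p : Model g) :
    velDeriv S T i p - velDeriv T S i p = vel ⁅S, T⁆ i p := by
  rcases i with ⟨k, l⟩ | ⟨i, l⟩
  · have hlie : ∀ x, (⁅S, T⁆ : spPlus).1 x = S.1 (T.1 x) - T.1 (S.1 x) := fun x => rfl
    -- Elements of `sp⁺(H')` are block triangular for `H_- ⊕ H'_+`. This and `hM` express the blocks
    -- of a product through those of its factors.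
    have hP : ∀ (S : spPlus) (x : HPrime), (prPlus (S.1 x) : HPrime) =
        prPlus (S.1 (prMinus x)) + S.1 (prPlus x) := fun S x => by
      conv_lhs => rw [← prMinus_add_prPlus x]
      rw [map_add, map_add, Submodule.coe_add, prPlus_of_plus (S.2.2 _ (prPlus x).2)]
    have hM : ∀ (S : spPlus) (x : HPrime), prMinus (S.1 x) = prMinus (S.1 (prMinus x)) :=
        fun S x => by
      conv_lhs => rw [← prMinus_add_prPlus x]
      rw [map_add, map_add, prMinus_of_plus (S.2.2 _ (prPlus x).2), add_zero]
    simp only [vel, velDeriv, tangent_apply, hlie, map_sub, AddSubgroupClass.coe_sub, map_add]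
    rw [hP S (T.1 _), hP T (S.1 _), hM S (T.1 _), hM T (S.1 _)]
    simp only [map_add]
    ring
  · change _ = cf l (S.1 (T.1 (p.h i)) - T.1 (S.1 (p.h i)))
    simp [velDeriv]

/-- The second-order terms cancel by symmetry of the second derivative, leaving the bracket of the
two vector fields. The minus sign is that of the vector fields of a left action; the sign in
`lieDeriv` turns the result into a Lie algebra homomorphism. -/
lemma dir_dir {f : Model g → ℂ} {p : Model g} (hf : HolAt f p) (S T : spPlus) :
    dir S (dir T f) p - dir T (dir S f) p = -dir ⁅S, T⁆ f p := by
  obtain ⟨s, G, hG, hf⟩ := hf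
  have h1 : ∀ᶠ q in nhds p, AnalyticAt ℂ G (coords s q) :=
    (continuous_coords s).continuousAt.eventually hG.eventually_analyticAt
  have hpd : ∀ i : s, HolAt (fun q => pd i G (coords s q)) p := fun i =>
    ⟨s, pd i G, analyticAt_pd i hG, Filter.Eventually.of_forall fun _ => rfl⟩
  have key : ∀ S T : spPlus, dir S (dir T f) p =
      (∑ i : s, ∑ j : s, pd j (pd i G) (coords s p) * vel S j p * vel T i p) +
        ∑ i : s, pd i G (coords s p) * velDeriv T S i p := by
    intro S T
    have h : ∀ᶠ q in nhds p, dir T f q = ∑ i : s, pd i G (coords s q) * vel T i q := by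
      filter_upwards [h1, hf.eventually_nhds] with q h1 h2
      exact dir_eq_sum h1 h2 T
    rw [dir_congr h, dir_sum _ fun i _ => (hpd i).mul (holAt_vel T i p), ← Finset.sum_add_distrib]
    refine Finset.sum_congr rfl fun i _ => ?_
    rw [dir_mul (hpd i) (holAt_vel T i p), dir_vel,
      dir_eq_sum (analyticAt_pd i hG) (Filter.Eventually.of_forall fun _ => rfl), Finset.sum_mul]
  rw [key, key, dir_eq_sum hG hf]
  have hsymm : ∑ i : s, ∑ j : s, pd j (pd i G) (coords s p) * vel S j p * vel T i p =
      ∑ i : s, ∑ j : s, pd j (pd i G) (coords s p) * vel T j p * vel S i p := by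
    rw [Finset.sum_comm]
    refine Finset.sum_congr rfl fun i _ => Finset.sum_congr rfl fun j _ => ?_
    rw [pd_comm _ _ (x := coords s p) hG]; ring
  rw [hsymm, add_sub_add_left_eq_sub, ← Finset.sum_sub_distrib, ← Finset.sum_neg_distrib]
  refine Finset.sum_congr rfl fun i _ => ?_
  rw [← velDeriv_sub]; ring

/-! ## Frames form an open set -/

/-- If the `h_i` are independent, their coefficient vectors span `ℂ^g`, and finitely many of these
already span. Independence is thus witnessed by finitely many coefficients, where it is an open
condition and where the topology on pairs sees it. -/
lemma IsFrame.eventually {p : Model g} (hp : p.IsFrame) : ∀ᶠ q in nhds p, q.IsFrame := by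
  classical
  have hspan : Submodule.span ℂ (Set.range fun l : ℤ => fun i : Fin g => cf l (p.h i)) = ⊤ := by
    by_contra hne
    obtain ⟨f, hf, hfle⟩ := Submodule.exists_le_ker_of_lt_top _ (lt_top_iff_ne_top.2 hne)
    apply hf
    have hsum : ∑ i, f (Pi.single i 1) • p.h i = 0 := by
      apply Subtype.ext
      refine hprime_ext fun l => ?_
      have h0 : f (fun i => cf l (p.h i)) = 0 := hfle (Submodule.subset_span ⟨l, rfl⟩)
      rw [LinearMap.pi_apply_eq_sum_univ f] at h0
      simp only [Submodule.coe_sum, Submodule.coe_smul, map_sum, map_smul, smul_eq_mul,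
        ZeroMemClass.coe_zero, map_zero]
      rw [← h0]
      refine Finset.sum_congr rfl fun i _ => ?_
      have : (fun j => if i = j then (1 : ℂ) else 0) = Pi.single i 1 := by
        ext j; simp [Pi.single_apply, eq_comm]
      rw [this, smul_eq_mul]; ring
    have hz := Fintype.linearIndependent_iff.1 hp _ hsum
    refine LinearMap.pi_ext' fun i => ?_
    ext
    simpa using hz i
  obtain ⟨t, ht, htspan⟩ := Submodule.fg_span_iff_fg_span_finset_subset _ |>.1
    (hspan ▸ (Module.Finite.fg_top : (⊤ : Submodule ℂ (Fin g → ℂ)).FG))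
  have ht' : ∀ u ∈ t, ∃ l : ℤ, (fun i : Fin g => cf l (p.h i)) = u := fun u hu => ht hu
  choose! L hL using ht'
  let E : Finset ℤ := t.image L
  have hind : LinearIndependent ℂ (fun (i : Fin g) (l : E) => cf l (p.h i)) := by
    rw [Fintype.linearIndependent_iff]
    intro c hc
    have h0 : ∀ u : Fin g → ℂ, ∑ i, c i * u i = 0 := by
      intro u
      have hu : u ∈ Submodule.span ℂ (t : Set (Fin g → ℂ)) := by
        rw [← htspan, hspan]; trivial
      induction hu using Submodule.span_induction with
      | mem u hu =>
        have := congrFun hc ⟨L u, Finset.mem_image_of_mem L hu⟩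
        rw [← hL u hu]
        simpa using this
      | zero => simp
      | add u v _ _ hu hv =>
        simp only [Pi.add_apply, mul_add, Finset.sum_add_distrib, hu, hv, add_zero]
      | smul a u _ hu =>
        simp only [Pi.smul_apply, smul_eq_mul, mul_left_comm _ a, ← Finset.mul_sum, hu, mul_zero]
    intro i
    simpa [Pi.single_apply] using h0 (Pi.single i 1)
  have hcont : Continuous fun (q : Model g) (i : Fin g) (l : E) => cf l (q.h i) := by
    refine continuous_pi fun i => continuous_pi fun l => ?_
    exact (continuous_apply (Sum.inr (i, (l : ℤ)))).comp continuous_coord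
  have hev := hcont.continuousAt.eventually hind.eventually
  filter_upwards [hev] with q hq
  let r : HPlus →ₗ[ℂ] (E → ℂ) := LinearMap.pi fun l => cf l ∘ₗ HPlus.subtype
  exact LinearIndependent.of_comp r hq

end Model

/-! ## Changes of frame -/

namespace Model

variable {g : ℕ}

/-- The change of frame `(φ, h) ↦ (φ, γ h)`. -/
def reframe (γ : Matrix (Fin g) (Fin g) ℂ) (p : Model g) : Model g :=
  ⟨p.φ, fun i => ∑ j, γ i j • p.h j⟩

lemma psi_apply (p : Model g) (x : HPrime) (i : Fin g) :
    p.psi x i = (Real.pi : ℂ)⁻¹ * symp (p.h i) x := rfl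

lemma psi_reframe (γ : Matrix (Fin g) (Fin g) ℂ) (p : Model g) (x : HPrime) :
    (p.reframe γ).psi x = γ.mulVec (p.psi x) := by
  ext i
  have h : ((p.reframe γ).h i : HPrime) = ∑ j, γ i j • (p.h j : HPrime) := by simp [reframe]
  rw [psi_apply, h]
  simp only [map_sum, map_smul, LinearMap.sum_apply, LinearMap.smul_apply, smul_eq_mul,
    Matrix.mulVec, dotProduct, psi_apply, Finset.mul_sum]
  exact Finset.sum_congr rfl fun j _ => by ring

lemma move_reframe (γ : Matrix (Fin g) (Fin g) ℂ) (p : Model g) (S : spPlus) (ε : ℂ) :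
    (p.reframe γ).move S ε = (p.move S ε).reframe γ := by
  ext1
  · rfl
  · ext1 i
    apply Subtype.ext
    simp [reframe, move, Finset.sum_add_distrib, Finset.smul_sum, smul_comm ε]

lemma reframe_reframe (γ δ : Matrix (Fin g) (Fin g) ℂ) (p : Model g) :
    (p.reframe γ).reframe δ = p.reframe (δ * γ) := by
  ext1
  · rfl
  · ext1 i
    simp only [reframe, Finset.smul_sum, smul_smul, Matrix.mul_apply, Finset.sum_smul]
    rw [Finset.sum_comm]

lemma reframe_one (p : Model g) : p.reframe 1 = p := by
  ext1
  · rfl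
  · ext1 i
    simp [reframe, Matrix.one_apply]

lemma IsFrame.reframe {γ : Matrix (Fin g) (Fin g) ℂ} (hγ : IsUnit γ) {p : Model g}
    (hp : p.IsFrame) : (p.reframe γ).IsFrame := by
  rw [IsFrame, Fintype.linearIndependent_iff] at hp ⊢
  intro c hc
  have h : Matrix.vecMul c γ = 0 := by
    ext j
    refine hp (Matrix.vecMul c γ) ?_ j
    rw [← hc]
    simp only [Matrix.vecMul, dotProduct, Finset.sum_smul, Model.reframe, Finset.smul_sum,
      smul_smul]
    rw [Finset.sum_comm]
  have h0 := (Matrix.vecMul_injective_iff_isUnit.2 hγ) (h.trans (Matrix.zero_vecMul γ).symm)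
  exact fun i => congrFun h0 i

lemma isFrame_reframe {γ : Matrix (Fin g) (Fin g) ℂ} (hγ : IsUnit γ) {p : Model g} :
    (p.reframe γ).IsFrame ↔ p.IsFrame := by
  refine ⟨fun h => ?_, fun h => h.reframe hγ⟩
  obtain ⟨u, rfl⟩ := hγ
  have := h.reframe (γ := (↑u⁻¹ : Matrix (Fin g) (Fin g) ℂ)) u⁻¹.isUnit
  rwa [reframe_reframe, Units.inv_mul, reframe_one] at this

variable (X : PPAV g)

/-- The matrix `γ` is an automorphism of `(X, Θ)`. -/
structure IsAut (γ : Matrix (Fin g) (Fin g) ℂ) : Prop where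
  isUnit : IsUnit γ
  lattice : ∀ u, γ.mulVec u ∈ X.Λ ↔ u ∈ X.Λ
  form : γ.conjTranspose * X.M * γ = X.M

lemma bar_reframe (γ : Matrix (Fin g) (Fin g) ℂ) (p : Model g) (u : Fin g → ℂ) :
    (p.reframe γ).bar X (γ.mulVec u) =
      ∑ i, Matrix.vecMul (star u) (γ.conjTranspose * X.M * γ) i • (p.h i : HPrime) := by
  have h : ∀ i, ((p.reframe γ).h i : HPrime) = ∑ j, γ i j • (p.h j : HPrime) := fun i => by
    simp [reframe]
  simp only [bar, h, Finset.smul_sum, smul_smul]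
  rw [Finset.sum_comm]
  refine Finset.sum_congr rfl fun j _ => ?_
  rw [← Finset.sum_smul, Matrix.star_mulVec, Matrix.vecMul_vecMul, ← Matrix.vecMul_vecMul _ _ γ]
  rfl

variable {X}

lemma IsAut.toExt {γ : Matrix (Fin g) (Fin g) ℂ} (hγ : IsAut X γ) {p : Model g} (hp : p.IsFrame)
    (hp' : (p.reframe γ).IsFrame) : (p.reframe γ).toExt X hp' = p.toExt X hp := by
  refine ExtPPAV.ext rfl ?_ ?_
  · change p.Z ⊓ LinearMap.ker (p.reframe γ).psi = p.Z ⊓ LinearMap.ker p.psi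
    congr 1
    ext x
    rw [LinearMap.mem_ker, LinearMap.mem_ker, psi_reframe]
    exact ⟨fun h => (Matrix.mulVec_injective_iff_isUnit.2 hγ.isUnit)
      (h.trans (Matrix.mulVec_zero γ).symm), fun h => by rw [h, Matrix.mulVec_zero]⟩
  · have hbar : ∀ z, (p.reframe γ).bar X ((p.reframe γ).psi z) = p.bar X (p.psi z) := fun z => by
      rw [psi_reframe, bar_reframe, hγ.form]
      rfl
    ext x
    change (∃ z ∈ p.Z, (p.reframe γ).psi z ∈ X.Λ ∧ x = z + (p.reframe γ).bar X _) ↔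
      ∃ z ∈ p.Z, p.psi z ∈ X.Λ ∧ x = z + p.bar X _
    simp only [hbar]
    simp only [psi_reframe, hγ.lattice]

/-- Two pairs over the same point differ by an automorphism of `(X, Θ)`. -/
lemma exists_isAut {p p' : Model g} (hp : p.IsFrame) (hp' : p'.IsFrame)
    (h : p.toExt X hp = p'.toExt X hp') : ∃ γ, IsAut X γ ∧ p' = p.reframe γ := by
  have hZ : p.Z = p'.Z := congrArg ExtPPAV.Z h
  have hF : p.F = p'.F := congrArg ExtPPAV.F h
  have hK : p.K X = p'.K X := congrArg ExtPPAV.K h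
  have hpi : (Real.pi : ℂ) ≠ 0 := by exact_mod_cast Real.pi_ne_zero
  have hpr : ∀ (q : Model g) (x : HMinus), prMinus (q.graphMap x) = x := fun q x => by
    rw [graphMap_apply, map_add, prMinus_of_minus, prMinus_of_plus (q.φ.1 x).2, add_zero]
  have hgr : ∀ x, p'.graphMap x = p.graphMap x := fun x => by
    have h1 : p'.graphMap x ∈ p.Z := by rw [hZ]; exact ⟨x, rfl⟩
    obtain ⟨y, hy⟩ := h1
    have := congrArg prMinus hy
    rw [hpr, hpr] at this
    rw [← hy, this]
  have hφ : p'.φ = p.φ := by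
    apply Subtype.ext
    ext1 x
    apply Subtype.ext
    have := hgr x
    rw [graphMap_apply, graphMap_apply] at this
    exact add_left_cancel this
  choose z hz hzu using fun j : Fin g => p.psi_surj hp (Pi.single j 1)
  -- The `z j` represent the basis of `Z/F` dual to the first frame, so `γ` is the transition matrix
  -- between the two identifications of `Z/F` with `ℂ^g`.
  let γ : Matrix (Fin g) (Fin g) ℂ := fun i j => p'.psi (z j) i
  have hγ : ∀ x ∈ p.Z, p'.psi x = γ.mulVec (p.psi x) := by
    intro x hx
    have h1 : x - ∑ j, p.psi x j • z j ∈ p'.F := by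
      rw [← hF]
      refine ⟨sub_mem hx (sum_mem fun j _ => Submodule.smul_mem _ _ (hz j)), ?_⟩
      change p.psi _ = 0
      rw [map_sub, map_sum]
      simp only [map_smul, hzu]
      rw [sub_eq_zero]
      ext i
      simp [Pi.single_apply]
    have h2 := LinearMap.mem_ker.1 h1.2
    rw [map_sub, sub_eq_zero] at h2
    rw [h2, map_sum]
    ext i
    simp [Matrix.mulVec, dotProduct, γ, mul_comm]
  have hp'γ : p' = p.reframe γ := by
    refine ext' hφ ?_
    ext1 i
    rw [← sub_eq_zero]
    apply Subtype.ext
    refine plus_eq_zero (Subtype.mem _) fun y hy => ?_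
    have h1 := congrFun (hγ (p.graphMap ⟨y, hy⟩) ⟨_, rfl⟩) i
    rw [← psi_reframe, psi_apply, psi_apply] at h1
    have h2 := mul_left_cancel₀ (inv_ne_zero hpi) h1
    rw [← p.symp_plus_graph (Subtype.mem _) ⟨y, hy⟩, AddSubgroupClass.coe_sub, map_sub,
      LinearMap.sub_apply, h2, sub_self]
  -- Because `Z ∩ H'_+ = 0`, an element of `K` determines its `Z` component and its `H'_+`
  -- component. Equal `K` therefore gives both the same lattice and the same conjugation on lattice
  -- points.
  have hlat : ∀ (q q' : Model g), q.K X = q'.K X → q.Z = q'.Z → ∀ x ∈ q.Z, q.psi x ∈ X.Λ →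
      q'.psi x ∈ X.Λ ∧ q.bar X (q.psi x) = q'.bar X (q'.psi x) := by
    intro q q' hKq hZq x hx hl
    have h1 : x + q.bar X (q.psi x) ∈ q'.K X := by rw [← hKq]; exact ⟨x, hx, hl, rfl⟩
    obtain ⟨y, hy, hl', hxy⟩ := h1
    have h2 : x - y = 0 := by
      refine q'.Z_inf_plus (sub_mem (hZq ▸ hx) hy) ?_
      have h3 : x - y = q'.bar X (q'.psi y) - q.bar X (q.psi x) := by
        rw [sub_eq_sub_iff_add_eq_add, hxy]; abel
      rw [h3]
      exact sub_mem (q'.bar_mem_plus X _) (q.bar_mem_plus X _)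
    rw [sub_eq_zero] at h2
    subst h2
    exact ⟨hl', add_left_cancel hxy⟩
  refine ⟨γ, ⟨?_, fun u => ?_, ?_⟩, hp'γ⟩
  · rw [← Matrix.mulVec_surjective_iff_isUnit]
    intro u
    obtain ⟨x, hx, hxu⟩ := p'.psi_surj hp' u
    exact ⟨p.psi x, by rw [← hγ x (hZ ▸ hx), hxu]⟩
  · obtain ⟨x, hx, rfl⟩ := p.psi_surj hp u
    rw [← hγ x hx]
    exact ⟨fun h => (hlat p' p hK.symm hZ.symm x (hZ ▸ hx) h).1,
      fun h => (hlat p p' hK hZ x hx h).1⟩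
  · have key : ∀ u ∈ X.Λ, Matrix.vecMul (star u) (γ.conjTranspose * X.M * γ - X.M) = 0 := by
      intro u hu
      obtain ⟨x, hx, rfl⟩ := p.psi_surj hp u
      have h1 := (hlat p p' hK hZ x hx hu).2
      rw [hγ x hx, hp'γ, bar_reframe, eq_comm, ← sub_eq_zero, bar, ← Finset.sum_sub_distrib] at h1
      have h2 : ∑ i, (Matrix.vecMul (star (p.psi x)) (γ.conjTranspose * X.M * γ - X.M) i) •
          p.h i = 0 := by
        apply Subtype.ext
        rw [Matrix.vecMul_sub]
        simpa [sub_smul] using h1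
      ext i
      exact Fintype.linearIndependent_iff.1 hp _ h2 i
    have key' : ∀ u : Fin g → ℂ,
        Matrix.vecMul (star u) (γ.conjTranspose * X.M * γ - X.M) = 0 := by
      intro u
      have hu : u ∈ Submodule.span ℝ (X.Λ : Set (Fin g → ℂ)) := by rw [X.spans]; trivial
      induction hu using Submodule.span_induction with
      | mem u hu => exact key u hu
      | zero => simp
      | add u v _ _ hu hv => rw [star_add, Matrix.add_vecMul, hu, hv, add_zero]
      | smul c u _ hu => rw [star_smul, Matrix.smul_vecMul, hu, smul_zero]
    rw [← sub_eq_zero]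
    ext i j
    have := congrFun (key' (Pi.single i 1)) j
    rw [← Pi.single_star, star_one, Matrix.single_one_vecMul] at this
    exact this

end Model

/-! ## Calculus on `Sp(X, Θ)` -/

section Manifold

variable {g : ℕ} (X : PPAV g)

lemma continuous_ofFrame : Continuous (ofFrame X) := continuous_coinduced_rng

variable {X}

lemma pull_of_isFrame {β : Type*} [Zero β] (f : SpX X → β) {p : Model g} (hp : p.IsFrame) :
    pull X f p = f (ofFrame X ⟨p, hp⟩) := by
  rw [pull, dif_pos hp]

lemma exists_ofFrame (a : SpX X) : ∃ (p : Model g) (hp : p.IsFrame), ofFrame X ⟨p, hp⟩ = a := by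
  obtain ⟨⟨p, hp⟩, h⟩ := ofFrame_surjective X a
  exact ⟨p, hp, h⟩

lemma eventually_ofFrame_mem {U : Opens (SpX X)} {p : Model g} (hp : p.IsFrame)
    (hU : ofFrame X ⟨p, hp⟩ ∈ U) :
    ∀ᶠ q in nhds p, ∃ hq : q.IsFrame, ofFrame X ⟨q, hq⟩ ∈ U := by
  have h1 : ∀ᶠ q : {p : Model g // p.IsFrame} in nhds ⟨p, hp⟩, ofFrame X q ∈ U :=
    (continuous_ofFrame X).continuousAt.eventually (U.isOpen.mem_nhds hU)
  have h2 := map_nhds_subtype_coe_eq_nhds (p := Model.IsFrame) hp hp.eventually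
  rw [← h2, Filter.eventually_map]
  exact h1.mono fun q hq => ⟨q.2, hq⟩

lemma pull_reframe {β : Type*} [Zero β] (f : SpX X → β) {γ : Matrix (Fin g) (Fin g) ℂ}
    (hγ : Model.IsAut X γ) (p : Model g) : pull X f (p.reframe γ) = pull X f p := by
  by_cases hp : p.IsFrame
  · have hp' := hp.reframe hγ.isUnit
    rw [pull_of_isFrame f hp, pull_of_isFrame f hp']
    congr 1
    exact Subtype.ext (hγ.toExt hp hp')
  · rw [pull, pull, dif_neg hp, dif_neg (by rwa [Model.isFrame_reframe hγ.isUnit])]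

lemma exists_chart_eq {p : Model g} (hp : p.IsFrame) :
    ∃ γ, Model.IsAut X γ ∧ chart X (ofFrame X ⟨p, hp⟩) = p.reframe γ := by
  set c := Function.surjInv (ofFrame_surjective X) (ofFrame X ⟨p, hp⟩) with hc
  have h : ofFrame X c = ofFrame X ⟨p, hp⟩ := Function.surjInv_eq _ _
  exact Model.exists_isAut hp c.2 (congrArg Subtype.val h).symm

/-- The chosen `chart` differs from `p` by an automorphism of `(X, Θ)`, which commutes with `move`
and leaves `pull X f` unchanged. Any pair over the point may thus be used. -/
lemma lieDeriv_ofFrame (S : spPlus) (f : SpX X → ℂ) {p : Model g} (hp : p.IsFrame) :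
    lieDeriv X S f (ofFrame X ⟨p, hp⟩) = -Model.dir S (pull X f) p := by
  obtain ⟨γ, hγ, h⟩ := exists_chart_eq (X := X) hp
  rw [lieDeriv, h, Model.dir]
  simp only [Model.move_reframe, pull_reframe f hγ]

lemma eventually_pull_lieDeriv (S : spPlus) (f : SpX X → ℂ) {p : Model g} (hp : p.IsFrame) :
    ∀ᶠ q in nhds p, pull X (lieDeriv X S f) q = -Model.dir S (pull X f) q := by
  filter_upwards [hp.eventually] with q hq
  rw [pull_of_isFrame _ hq, lieDeriv_ofFrame]

lemma eventually_pull_eq {β : Type*} [Zero β] {U : Opens (SpX X)} {f f' : SpX X → β}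
    (h : ∀ x ∈ U, f x = f' x) {p : Model g} (hp : p.IsFrame) (hU : ofFrame X ⟨p, hp⟩ ∈ U) :
    ∀ᶠ q in nhds p, pull X f q = pull X f' q := by
  filter_upwards [eventually_ofFrame_mem hp hU] with q ⟨hq, hqU⟩
  rw [pull_of_isFrame _ hq, pull_of_isFrame _ hq, h _ hqU]

lemma pull_add (f f' : SpX X → ℂ) :
    pull X (fun x => f x + f' x) = fun q => pull X f q + pull X f' q := by
  funext q
  by_cases hq : q.IsFrame <;> simp [pull, hq]

lemma pull_mul (f f' : SpX X → ℂ) :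
    pull X (fun x => f x * f' x) = fun q => pull X f q * pull X f' q := by
  funext q
  by_cases hq : q.IsFrame <;> simp [pull, hq]

lemma eventually_pull_const (c : ℂ) {p : Model g} (hp : p.IsFrame) :
    ∀ᶠ q in nhds p, pull X (fun _ => c) q = c :=
  hp.eventually.mono fun _ hq => pull_of_isFrame _ hq

lemma IsHolOn.mono {U W : Opens (SpX X)} (h : W ≤ U) {f : SpX X → ℂ} (hf : IsHolOn X U f) :
    IsHolOn X W f := fun p hp hW => hf p hp (h hW)

lemma IsHolOn.congr {U : Opens (SpX X)} {f f' : SpX X → ℂ} (hf : IsHolOn X U f)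
    (h : ∀ x ∈ U, f' x = f x) : IsHolOn X U f' := fun p hp hU =>
  (hf p hp hU).congr (eventually_pull_eq h hp hU)

lemma isHolOn_const (U : Opens (SpX X)) (c : ℂ) : IsHolOn X U fun _ => c := fun p hp _ =>
  (Model.holAt_const c p).congr (eventually_pull_const c hp)

lemma IsHolOn.add {U : Opens (SpX X)} {f f' : SpX X → ℂ} (hf : IsHolOn X U f)
    (hf' : IsHolOn X U f') : IsHolOn X U fun x => f x + f' x := fun p hp hU => by
  rw [pull_add]
  exact (hf p hp hU).add (hf' p hp hU)

lemma IsHolOn.mul {U : Opens (SpX X)} {f f' : SpX X → ℂ} (hf : IsHolOn X U f)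
    (hf' : IsHolOn X U f') : IsHolOn X U fun x => f x * f' x := fun p hp hU => by
  rw [pull_mul]
  exact (hf p hp hU).mul (hf' p hp hU)

lemma IsHolOn.sum {ι : Type*} (s : Finset ι) {U : Opens (SpX X)} {f : ι → SpX X → ℂ}
    (hf : ∀ i ∈ s, IsHolOn X U (f i)) : IsHolOn X U fun x => ∑ i ∈ s, f i x := by
  classical
  induction s using Finset.induction_on with
  | empty => simpa using isHolOn_const U 0
  | insert i s hi ih =>
    simp only [Finset.sum_insert hi]
    exact (hf i (Finset.mem_insert_self i s)).add
      (ih fun j hj => hf j (Finset.mem_insert_of_mem hj))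

lemma IsHolOn.lieDeriv {U : Opens (SpX X)} {f : SpX X → ℂ} (hf : IsHolOn X U f) (S : spPlus) :
    IsHolOn X U (lieDeriv X S f) := fun p hp hU =>
  ((hf p hp hU).dir S).neg.congr (eventually_pull_lieDeriv S f hp)

lemma lieDeriv_congr {U : Opens (SpX X)} {f f' : SpX X → ℂ} (h : ∀ x ∈ U, f x = f' x) {a : SpX X}
    (ha : a ∈ U) (S : spPlus) : lieDeriv X S f a = lieDeriv X S f' a := by
  obtain ⟨p, hp, rfl⟩ := exists_ofFrame a
  rw [lieDeriv_ofFrame, lieDeriv_ofFrame, Model.dir_congr (eventually_pull_eq h hp ha)]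

lemma lieDeriv_const (S : spPlus) (c : ℂ) (a : SpX X) : lieDeriv X S (fun _ => c) a = 0 := by
  obtain ⟨p, hp, rfl⟩ := exists_ofFrame a
  rw [lieDeriv_ofFrame, Model.dir_congr (eventually_pull_const c hp), Model.dir_const, neg_zero]

lemma lieDeriv_add {U : Opens (SpX X)} {f f' : SpX X → ℂ} (hf : IsHolOn X U f)
    (hf' : IsHolOn X U f') {a : SpX X} (ha : a ∈ U) (S : spPlus) :
    lieDeriv X S (fun x => f x + f' x) a = lieDeriv X S f a + lieDeriv X S f' a := by
  obtain ⟨p, hp, rfl⟩ := exists_ofFrame a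
  rw [lieDeriv_ofFrame, lieDeriv_ofFrame, lieDeriv_ofFrame, pull_add,
    Model.dir_add (hf p hp ha) (hf' p hp ha)]
  ring

lemma lieDeriv_mul {U : Opens (SpX X)} {f f' : SpX X → ℂ} (hf : IsHolOn X U f)
    (hf' : IsHolOn X U f') {a : SpX X} (ha : a ∈ U) (S : spPlus) :
    lieDeriv X S (fun x => f x * f' x) a = lieDeriv X S f a * f' a + f a * lieDeriv X S f' a := by
  obtain ⟨p, hp, rfl⟩ := exists_ofFrame a
  rw [lieDeriv_ofFrame, lieDeriv_ofFrame, lieDeriv_ofFrame, pull_mul,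
    Model.dir_mul (hf p hp ha) (hf' p hp ha), pull_of_isFrame _ hp, pull_of_isFrame _ hp]
  ring

lemma lieDeriv_mul_const {U : Opens (SpX X)} {f : SpX X → ℂ} (hf : IsHolOn X U f) (c : ℂ)
    {a : SpX X} (ha : a ∈ U) (S : spPlus) :
    lieDeriv X S (fun x => f x * c) a = lieDeriv X S f a * c := by
  rw [lieDeriv_mul hf (isHolOn_const U c) ha, lieDeriv_const, mul_zero, add_zero]

lemma lieDeriv_sum {ι : Type*} (s : Finset ι) {U : Opens (SpX X)} {f : ι → SpX X → ℂ}
    (hf : ∀ i ∈ s, IsHolOn X U (f i)) {a : SpX X} (ha : a ∈ U) (S : spPlus) :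
    lieDeriv X S (fun x => ∑ i ∈ s, f i x) a = ∑ i ∈ s, lieDeriv X S (f i) a := by
  classical
  induction s using Finset.induction_on with
  | empty => simpa using lieDeriv_const S 0 a
  | insert i s hi ih =>
    simp only [Finset.sum_insert hi]
    have h' := fun j hj => hf j (Finset.mem_insert_of_mem (a := j) hj)
    rw [lieDeriv_add (hf i (Finset.mem_insert_self i s)) (IsHolOn.sum s h') ha, ih h']

lemma lieDeriv_add_left {U : Opens (SpX X)} {f : SpX X → ℂ} (hf : IsHolOn X U f) {a : SpX X}
    (ha : a ∈ U) (S T : spPlus) :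
    lieDeriv X (S + T) f a = lieDeriv X S f a + lieDeriv X T f a := by
  obtain ⟨p, hp, rfl⟩ := exists_ofFrame a
  rw [lieDeriv_ofFrame, lieDeriv_ofFrame, lieDeriv_ofFrame, Model.dir_add_left (hf p hp ha)]
  ring

lemma lieDeriv_smul_left {U : Opens (SpX X)} {f : SpX X → ℂ} (hf : IsHolOn X U f) {a : SpX X}
    (ha : a ∈ U) (c : ℂ) (S : spPlus) :
    lieDeriv X (c • S) f a = c * lieDeriv X S f a := by
  obtain ⟨p, hp, rfl⟩ := exists_ofFrame a
  rw [lieDeriv_ofFrame, lieDeriv_ofFrame, Model.dir_smul_left (hf p hp ha)]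
  ring

lemma lieDeriv_lie {U : Opens (SpX X)} {f : SpX X → ℂ} (hf : IsHolOn X U f) {a : SpX X}
    (ha : a ∈ U) (S T : spPlus) : lieDeriv X ⁅S, T⁆ f a =
      lieDeriv X S (lieDeriv X T f) a - lieDeriv X T (lieDeriv X S f) a := by
  obtain ⟨p, hp, rfl⟩ := exists_ofFrame a
  rw [lieDeriv_ofFrame, lieDeriv_ofFrame, lieDeriv_ofFrame,
    Model.dir_congr (eventually_pull_lieDeriv T f hp),
    Model.dir_congr (eventually_pull_lieDeriv S f hp), Model.dir_neg, Model.dir_neg,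
    ← Model.dir_dir (hf p hp ha)]
  ring

/-! ## Sections of `V ⊗ 𝒪` -/

variable {V : Type*} [AddCommGroup V] [Module ℂ V]

lemma exists_of_mem_tensorPre {U : Opens (SpX X)} {s : SpX X → V} (hs : s ∈ tensorPre X V U) :
    ∃ (n : ℕ) (f : Fin n → SpX X → ℂ) (v : Fin n → V), (∀ i, IsHolOn X U (f i)) ∧
      s = fun x => ∑ i, f i x • v i := by
  induction hs using Submodule.span_induction with
  | mem s hs =>
    obtain ⟨f, v, hf, rfl⟩ := hs
    exact ⟨1, fun _ => f, fun _ => v, fun _ => hf, by simp⟩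
  | zero => exact ⟨0, Fin.elim0, Fin.elim0, fun i => i.elim0, by ext; simp⟩
  | add s t _ _ hs ht =>
    obtain ⟨n, f, v, hf, rfl⟩ := hs
    obtain ⟨m, f', v', hf', rfl⟩ := ht
    refine ⟨n + m, Fin.append f f', Fin.append v v', fun i => ?_, ?_⟩
    · induction i using Fin.addCases with
      | left i => rw [Fin.append_left]; exact hf i
      | right i => rw [Fin.append_right]; exact hf' i
    · funext x
      rw [Fin.sum_univ_add]
      simp
  | smul c s _ hs =>
    obtain ⟨n, f, v, hf, rfl⟩ := hs
    refine ⟨n, f, fun i => c • v i, hf, ?_⟩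
    funext x
    simp [Finset.smul_sum, smul_comm c]

lemma exists_of_mem_VO {U : Opens (SpX X)} {s : SpX X → V} (hs : s ∈ VO X V U) {a : SpX X}
    (ha : a ∈ U) : ∃ W : Opens (SpX X), a ∈ W ∧ W ≤ U ∧
      ∃ (n : ℕ) (f : Fin n → SpX X → ℂ) (v : Fin n → V), (∀ i, IsHolOn X W (f i)) ∧
        ∀ x ∈ W, s x = ∑ i, f i x • v i := by
  obtain ⟨W, haW, hWU, t, ht, hst⟩ := hs a ha
  obtain ⟨n, f, v, hf, rfl⟩ := exists_of_mem_tensorPre ht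
  exact ⟨W, haW, hWU, n, f, v, hf, hst⟩

lemma sum_smul_mem_tensorPre {ι : Type*} (I : Finset ι) {U : Opens (SpX X)} {f : ι → SpX X → ℂ}
    (hf : ∀ i ∈ I, IsHolOn X U (f i)) (v : ι → V) :
    (fun x => ∑ i ∈ I, f i x • v i) ∈ tensorPre X V U := by
  have h : (fun x => ∑ i ∈ I, f i x • v i) = ∑ i ∈ I, fun x => f i x • v i := by
    funext x; simp
  rw [h]
  exact sum_mem fun i hi => Submodule.subset_span ⟨f i, v i, hf i hi, rfl⟩

lemma tensorPre_le_VO (U : Opens (SpX X)) : tensorPre X V U ≤ VO X V U :=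
  fun t ht _ ha => ⟨U, ha, le_rfl, t, ht, fun _ _ => rfl⟩

lemma mem_VO_of_locally {U : Opens (SpX X)} {s : SpX X → V}
    (h : ∀ a ∈ U, ∃ W : Opens (SpX X), a ∈ W ∧ W ≤ U ∧ ∃ t ∈ VO X V W, ∀ x ∈ W, s x = t x) :
    s ∈ VO X V U := by
  intro a ha
  obtain ⟨W, haW, hWU, t, ht, hst⟩ := h a ha
  obtain ⟨W', haW', hW'W, t', ht', htt'⟩ := ht a haW
  exact ⟨W', haW', hW'W.trans hWU, t', ht', fun x hx => (hst x (hW'W hx)).trans (htt' x hx)⟩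

/-- On a finite sum of holomorphic functions times vectors, the derivative is the termwise one,
whatever basis of `V` was chosen in the definition and however the sum is written. -/
lemma lieDerivV_eq_sum {ι : Type*} (I : Finset ι) {W : Opens (SpX X)} {f : ι → SpX X → ℂ}
    (hf : ∀ i ∈ I, IsHolOn X W (f i)) {v : ι → V} {s : SpX X → V}
    (hs : ∀ x ∈ W, s x = ∑ i ∈ I, f i x • v i) {a : SpX X} (ha : a ∈ W) (S : spPlus) :
    lieDerivV X S s a = ∑ i ∈ I, lieDeriv X S (f i) a • v i := by
  set B := Module.Basis.ofVectorSpace ℂ V with hB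
  have h : ∀ j, lieDeriv X S (fun x => B.repr (s x) j) a =
      B.repr (∑ i ∈ I, lieDeriv X S (f i) a • v i) j := by
    intro j
    have h1 : ∀ x ∈ W, B.repr (s x) j = ∑ i ∈ I, f i x * B.repr (v i) j := by
      intro x hx
      rw [hs x hx]
      simp
    rw [lieDeriv_congr h1 ha, lieDeriv_sum I
      (fun i hi => (hf i hi).mul (isHolOn_const W (B.repr (v i) j))) ha]
    rw [map_sum, Finsupp.finsetSum_apply]
    refine Finset.sum_congr rfl fun i hi => ?_
    rw [lieDeriv_mul_const (hf i hi) _ ha]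
    simp
  rw [lieDerivV]
  simp only [← hB, h]
  set w := ∑ i ∈ I, lieDeriv X S (f i) a • v i
  conv_rhs => rw [← B.linearCombination_repr w, Finsupp.linearCombination_apply, Finsupp.sum]
  refine finsum_eq_sum_of_support_subset _ fun j hj => ?_
  rw [Finset.mem_coe, Finsupp.mem_support_iff]
  intro h0
  exact hj (by simp [h0])

end Manifold

/-! ### Pairings, determinants and inverses with holomorphic dependence on `(φ, h)`. -/

lemma exists_cf_eq (c : ℤ → ℂ) {N : ℤ} (hN : ∀ n < N, c n = 0) (h0 : c 0 = 0) :
    ∃ u : HPrime, ∀ n, cf n u = c n := by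
  have hb : BddBelow (Function.support c) :=
    ⟨N, fun n hn => not_lt.1 fun h => hn (hN n h)⟩
  refine ⟨toHPrime (HahnSeries.ofSuppBddBelow c hb), fun n => ?_⟩
  rw [cf_toHPrime]
  split_ifs with h
  · rw [h, h0]
  · rfl

/-- Uniform pole bounds give a summation range independent of the vectors, so that a pairing of
varying vectors can be differentiated termwise. -/
lemma symp_eq_sum (x y : HPrime) {M N : ℤ} (hx : ∀ n < N, cf n x = 0)
    (hy : ∀ n ≤ -M, cf n y = 0) :
    symp x y = ∑ n ∈ Finset.Ico N M, (n : ℂ) * cf n x * cf (-n) y := by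
  rw [symp_eq_finsum]
  refine finsum_eq_sum_of_support_subset _ fun n hn => ?_
  rw [Finset.mem_coe, Finset.mem_Ico]
  by_contra h
  apply hn
  rcases lt_or_ge n N with h1 | h1
  · simp [hx n h1]
  · simp [hy (-n) (by omega)]

namespace Model

variable {g : ℕ}

lemma HolAt.continuousAt {f : Model g → ℂ} {p : Model g} (hf : HolAt f p) : ContinuousAt f p := by
  obtain ⟨s, G, hG, hf⟩ := hf
  have h : ContinuousAt (fun q => G (coords s q)) p :=
    ContinuousAt.comp (g := G) hG.continuousAt (continuous_coords s).continuousAt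
  exact h.congr (hf.mono fun q hq => hq.symm)

lemma HolAt.prod {ι : Type*} (s : Finset ι) {f : ι → Model g → ℂ} {p : Model g}
    (hf : ∀ i ∈ s, HolAt (f i) p) : HolAt (fun q => ∏ i ∈ s, f i q) p := by
  classical
  induction s using Finset.induction_on with
  | empty => simpa using holAt_const 1 p
  | insert i s hi ih =>
    simp only [Finset.prod_insert hi]
    exact (hf i (Finset.mem_insert_self i s)).mul
      (ih fun j hj => hf j (Finset.mem_insert_of_mem hj))

lemma HolAt.inv {f : Model g → ℂ} {p : Model g} (hf : HolAt f p) (h0 : f p ≠ 0) :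
    HolAt (fun q => (f q)⁻¹) p :=
  HolAt.comp_analytic (f := fun _ : Unit => f) (fun _ => hf) (Φ := fun x => (x ())⁻¹)
    (AnalyticAt.inv
      ((ContinuousLinearMap.proj (R := ℂ) (φ := fun _ : Unit => ℂ) ()).analyticAt _) h0)

lemma HolAt.det {n : ℕ} {A : Model g → Matrix (Fin n) (Fin n) ℂ} {p : Model g}
    (hA : ∀ i j, HolAt (fun q => A q i j) p) : HolAt (fun q => (A q).det) p := by
  simp only [Matrix.det_apply']
  exact HolAt.sum _ fun σ _ => (HolAt.prod _ fun i _ => hA _ _).const_mul _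

/-- Cramer's rule reduces the solution of a linear system to quotients of determinants, which are
polynomial in the entries. -/
lemma HolAt.inv_mulVec {n : ℕ} {A : Model g → Matrix (Fin n) (Fin n) ℂ} {r : Model g → Fin n → ℂ}
    {p : Model g} (hA : ∀ i j, HolAt (fun q => A q i j) p) (hr : ∀ i, HolAt (fun q => r q i) p)
    (h0 : (A p).det ≠ 0) (j : Fin n) : HolAt (fun q => (A q)⁻¹.mulVec (r q) j) p := by
  have h : (fun q => (A q)⁻¹.mulVec (r q) j) = fun q =>
      (A q).det⁻¹ * ((A q).updateCol j (r q)).det := by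
    funext q
    rw [Matrix.inv_def, Matrix.smul_mulVec, ← Matrix.cramer_eq_adjugate_mulVec,
      Ring.inverse_eq_inv', Pi.smul_apply, smul_eq_mul, Matrix.cramer_apply]
  rw [h]
  refine ((HolAt.det hA).inv h0).mul (HolAt.det fun i k => ?_)
  by_cases hk : k = j
  · subst hk
    simpa using hr i
  · simpa [Matrix.updateCol_apply, hk] using hA i k

lemma prMinus_graphMap (p : Model g) (x : HMinus) : prMinus (p.graphMap x) = x := by
  rw [graphMap_apply, map_add, prMinus_of_minus, prMinus_of_plus (p.φ.1 x).2, add_zero]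

lemma graphMap_prMinus (p : Model g) {z : HPrime} (hz : z ∈ p.Z) :
    p.graphMap (prMinus z) = z := by
  obtain ⟨x, rfl⟩ := hz
  rw [prMinus_graphMap]

lemma psi_graphMap (p : Model g) (x : HMinus) : p.psi (p.graphMap x) = p.psi x := by
  rw [graphMap_apply, map_add, p.psi_plus (p.φ.1 x).2, add_zero]

lemma holAt_cf_phi (y : HMinus) (l : ℤ) (p : Model g) :
    HolAt (fun q => cf l (q.φ.1 y)) p := by
  obtain ⟨N, hN⟩ := exists_cf_bound (y : HPrime)
  simp only [cf_phi _ y l hN]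
  exact HolAt.sum _ fun k _ => (holAt_coord _ p).const_mul _

lemma holAt_psi (y : HPrime) (i : Fin g) (p : Model g) : HolAt (fun q => q.psi y i) p := by
  obtain ⟨N, hN⟩ := exists_cf_bound y
  have h : (fun q : Model g => q.psi y i) = fun q => (Real.pi : ℂ)⁻¹ *
      ∑ n ∈ Finset.Ico 0 (1 - N), (n : ℂ) * q.coord (Sum.inr (i, n)) * cf (-n) y := by
    funext q
    rw [psi_apply, symp_eq_sum _ y (M := 1 - N) (fun n hn => (q.h i).2 n hn)
      (fun n hn => hN n (by omega))]
    rfl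
  rw [h]
  exact (HolAt.sum _ fun n _ =>
    ((holAt_coord _ p).const_mul _).mul (holAt_const _ p)).const_mul _

/-! ## Sections of the tautological sheaf -/

section Taut

variable (x₀ : HMinus) (y : Fin g → HMinus)

/-- The pairing of the frame with given elements of `H_-`. -/
def pairing (q : Model g) : Matrix (Fin g) (Fin g) ℂ := Matrix.of fun i j => q.psi (y j) i

/-- The modification of `x₀` by a combination of the `y_j` which is orthogonal to the frame. -/
def adjust (q : Model g) : HMinus :=
  x₀ - ∑ j, (q.pairing y)⁻¹.mulVec (q.psi x₀) j • y j

lemma pairing_reframe (γ : Matrix (Fin g) (Fin g) ℂ) (q : Model g) :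
    (q.reframe γ).pairing y = γ * q.pairing y := by
  ext i j
  simp only [pairing, Matrix.of_apply, psi_reframe]
  rfl

/-- A change of frame multiplies both the matrix and the right-hand side of the linear system by
`γ`, so the solution is the same. The adjusted vector is thus a function on `Sp(X, Θ)`. -/
lemma adjust_reframe {γ : Matrix (Fin g) (Fin g) ℂ} (hγ : IsUnit γ) (q : Model g) :
    (q.reframe γ).adjust x₀ y = q.adjust x₀ y := by
  have h : IsUnit γ.det := (Matrix.isUnit_iff_isUnit_det γ).1 hγ
  simp only [adjust, pairing_reframe, psi_reframe, Matrix.mul_inv_rev, Matrix.mulVec_mulVec,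
    mul_assoc, Matrix.nonsing_inv_mul γ h, mul_one]

lemma psi_adjust {q : Model g} (hq : (q.pairing y).det ≠ 0) :
    q.psi (q.graphMap (q.adjust x₀ y)) = 0 := by
  rw [psi_graphMap, adjust]
  set c := (q.pairing y)⁻¹.mulVec (q.psi x₀) with hc
  have h1 : (q.pairing y).mulVec c = q.psi x₀ := by
    rw [hc, Matrix.mulVec_mulVec, Matrix.mul_nonsing_inv _ (isUnit_iff_ne_zero.2 hq),
      Matrix.one_mulVec]
  have h2 : q.psi ((∑ j, c j • y j : HMinus) : HPrime) = (q.pairing y).mulVec c := by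
    rw [Submodule.coe_sum, map_sum]
    ext i
    simp [Matrix.mulVec, dotProduct, pairing, mul_comm]
  rw [AddSubgroupClass.coe_sub, map_sub, h2, h1, sub_self]

lemma holAt_cf_adjust {q : Model g} (hq : (q.pairing y).det ≠ 0) (n : ℤ) :
    HolAt (fun q => cf n (q.graphMap (q.adjust x₀ y))) q := by
  have h : (fun q : Model g => cf n (q.graphMap (q.adjust x₀ y))) = fun q =>
      cf n x₀ + cf n (q.φ.1 x₀) - ∑ j, (q.pairing y)⁻¹.mulVec (q.psi x₀) j *
        (cf n (y j) + cf n (q.φ.1 (y j))) := by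
    funext q
    rw [adjust, map_sub, map_sum, map_sub, map_sum, graphMap_apply, map_add]
    congr 1
    refine Finset.sum_congr rfl fun j _ => ?_
    rw [map_smul, graphMap_apply, map_smul, map_add, smul_eq_mul]
  rw [h]
  refine ((holAt_const _ q).add (holAt_cf_phi x₀ n q)).sub (HolAt.sum _ fun j _ => ?_)
  exact (HolAt.inv_mulVec (fun i j => holAt_psi _ i q) (fun i => holAt_psi _ i q) hq j).mul
    ((holAt_const _ q).add (holAt_cf_phi _ n q))

end Taut

end Model

section Manifold

variable {g : ℕ} {X : PPAV g}

/-- Every element of `F` is the value of a local section of the tautological sheaf. -/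
lemma exists_tautSection (a : SpX X) {f₀ : HPrime} (hf₀ : f₀ ∈ a.1.F) :
    ∃ (U : Opens (SpX X)) (f : SpX X → HPrime), a ∈ U ∧ IsTautSection X U f ∧ f a = f₀ := by
  obtain ⟨p, hp, rfl⟩ := exists_ofFrame a
  change f₀ ∈ p.F at hf₀
  -- With the `z j` dual to the frame at `p`, the pairing matrix is the identity there and stays
  -- invertible on a neighborhood. On it, subtracting a combination of their `H_-` parts keeps the
  -- section orthogonal to the moving frame; at `p` no correction is needed.
  choose z hz hzu using fun j : Fin g => p.psi_surj hp (Pi.single j 1)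
  let y : Fin g → HMinus := fun j => prMinus (z j)
  let x₀ : HMinus := prMinus f₀
  have hy : ∀ j, p.psi (y j) = Pi.single j 1 := fun j => by
    rw [← p.psi_graphMap, p.graphMap_prMinus (hz j), hzu]
  have hA : p.pairing y = 1 := by
    ext i j
    simp only [Model.pairing, Matrix.of_apply, hy, Matrix.one_apply, Pi.single_apply]
  have hx₀ : p.psi x₀ = 0 := by
    rw [← p.psi_graphMap, p.graphMap_prMinus hf₀.1]
    exact hf₀.2
  have hadj : p.adjust x₀ y = x₀ := by
    rw [Model.adjust, hx₀]
    simp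
  let f : SpX X → HPrime := fun b => (chart X b).graphMap ((chart X b).adjust x₀ y)
  have hf : ∀ (q : Model g) (hq : q.IsFrame),
      f (ofFrame X ⟨q, hq⟩) = q.graphMap (q.adjust x₀ y) := by
    intro q hq
    obtain ⟨γ, hγ, h⟩ := exists_chart_eq (X := X) hq
    change (chart X _).graphMap ((chart X _).adjust x₀ y) = _
    rw [h, Model.adjust_reframe _ _ hγ.isUnit]
    rfl
  have hdet : ∀ (q : Model g) (hq : q.IsFrame),
      ((chart X (ofFrame X ⟨q, hq⟩)).pairing y).det ≠ 0 ↔ (q.pairing y).det ≠ 0 := by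
    intro q hq
    obtain ⟨γ, hγ, h⟩ := exists_chart_eq (X := X) hq
    have h0 : γ.det ≠ 0 := ((Matrix.isUnit_iff_isUnit_det γ).1 hγ.isUnit).ne_zero
    rw [h, Model.pairing_reframe, Matrix.det_mul]
    simp [h0]
  let U : Opens (SpX X) := ⟨{b | ((chart X b).pairing y).det ≠ 0}, by
    change IsOpen (ofFrame X ⁻¹' _)
    have h1 : ofFrame X ⁻¹' {b | ((chart X b).pairing y).det ≠ 0} =
        Subtype.val ⁻¹' {q : Model g | (q.pairing y).det ≠ 0} := by
      ext ⟨q, hq⟩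
      exact hdet q hq
    rw [h1]
    refine IsOpen.preimage continuous_subtype_val ?_
    have hc : Continuous fun q : Model g => (q.pairing y).det :=
      continuous_iff_continuousAt.2 fun q =>
        (Model.HolAt.det fun i j => Model.holAt_psi _ i q).continuousAt
    exact isOpen_ne_fun hc continuous_const⟩
  have hU : ∀ (q : Model g) (hq : q.IsFrame),
      ofFrame X ⟨q, hq⟩ ∈ U ↔ (q.pairing y).det ≠ 0 := hdet
  refine ⟨U, f, ?_, ⟨fun b hb => ?_, fun n q hq hqU => ?_, fun b hb => ?_⟩, ?_⟩
  · rw [hU, hA, Matrix.det_one]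
    exact one_ne_zero
  · obtain ⟨q, hq, rfl⟩ := exists_ofFrame b
    rw [hf q hq]
    exact ⟨⟨_, rfl⟩, Model.psi_adjust _ _ ((hU q hq).1 hb)⟩
  · refine (Model.holAt_cf_adjust x₀ y ((hU q hq).1 hqU) n).congr ?_
    filter_upwards [hq.eventually] with r hr
    rw [pull_of_isFrame _ hr, hf r hr]
  · obtain ⟨N, hN⟩ := exists_cf_bound_finset (Finset.univ : Finset (Option (Fin g)))
      (fun o => o.elim (x₀ : HPrime) fun j => (y j : HPrime))
    refine ⟨U, hb, min N 0, fun c _ n hn => ?_⟩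
    obtain ⟨q, hq, rfl⟩ := exists_ofFrame c
    have hnN : n < N := lt_of_lt_of_le hn (min_le_left _ _)
    have hn0 : n < 0 := lt_of_lt_of_le hn (min_le_right _ _)
    have h1 : cf n (x₀ : HPrime) = 0 := hN none (Finset.mem_univ _) n hnN
    have h2 : ∀ j, cf n (y j : HPrime) = 0 := fun j => hN (some j) (Finset.mem_univ _) n hnN
    rw [hf q hq, Model.graphMap_apply, map_add, (q.φ.1 _).2 n hn0, add_zero, Model.adjust,
      AddSubgroupClass.coe_sub, map_sub, h1, Submodule.coe_sum, map_sum]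
    simp [h2]
  · rw [hf p hp, hadj, p.graphMap_prMinus hf₀.1]

lemma cf_pull (f : SpX X → HPrime) (n : ℤ) (q : Model g) :
    cf n (pull X f q) = pull X (fun x => cf n (f x)) q := by
  by_cases hq : q.IsFrame <;> simp [pull, hq]

/-- If `w` is the derivative of a section `f` of the tautological sheaf, then `S f + w` lies
in `F`. -/
lemma add_deriv_mem_F {U : Opens (SpX X)} {f : SpX X → HPrime} (hf : IsTautSection X U f)
    {a : SpX X} (ha : a ∈ U) (S : spPlus) {w : HPrime}
    (hw : ∀ n, cf n w = lieDeriv X S (fun x => cf n (f x)) a) : S.1 (f a) + w ∈ a.1.F := by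
  obtain ⟨W, haW, N, hN⟩ := hf.2.2 a ha
  have hwN : ∀ n < N, cf n w = 0 := fun n hn => by
    rw [hw, lieDeriv_congr (f' := fun _ => 0) (fun x hx => hN x hx n hn) haW, lieDeriv_const]
  obtain ⟨p, hp, rfl⟩ := exists_ofFrame a
  have hhol : ∀ n, Model.HolAt (fun q => cf n (pull X f q)) p := fun n => by
    simp only [cf_pull]
    exact hf.2.1 n p hp ha
  -- The sign comes from `lieDeriv` being the derivative along `exp(-ε S)`, whereas `dir` moves
  -- along `S`.
  have hdir : ∀ n, Model.dir S (fun q => cf n (pull X f q)) p = -cf n w := fun n => by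
    simp only [cf_pull]
    rw [hw, lieDeriv_ofFrame, neg_neg]
  have hev : ∀ᶠ q in nhds p, pull X f q ∈ q.F ∧ ∀ n < N, cf n (pull X f q) = 0 := by
    filter_upwards [eventually_ofFrame_mem hp ha, eventually_ofFrame_mem hp haW]
      with q ⟨hq, hqU⟩ ⟨_, hqW⟩
    rw [pull_of_isFrame f hq]
    exact ⟨hf.1 _ hqU, hN _ hqW⟩
  have hfa : pull X f p = f (ofFrame X ⟨p, hp⟩) := pull_of_isFrame f hp
  rw [← hfa]
  obtain ⟨hpF, hpN⟩ := hev.self_of_nhds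
  set u := pull X f p with hu
  change S.1 u + w ∈ p.F
  have hminus : ∀ (z : HPrime), (∀ n < N, cf n z = 0) → ∀ n < N, cf n (prMinus z) = 0 := by
    intro z hz n hn
    rw [cf_prMinus, hz n hn, ite_self]
  have hZ : S.1 u + w ∈ p.Z := by
    refine ⟨prMinus (S.1 u + w), ?_⟩
    rw [eq_comm, ← sub_eq_zero]
    refine hprime_ext fun l => ?_
    rw [map_zero]
    rcases le_or_gt l 0 with hl | hl
    · rcases hl.eq_or_lt with rfl | hl
      · exact cf_zero _
      · exact p.sub_graph_mem _ l hl
    -- This is the graph equation `f_+ = φ(f_-)` in degree `l > 0`. The common pole bound `N` makes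
    -- it a finite sum over a fixed range, which is then differentiated along `S`.
    have h1 : ∀ᶠ q in nhds p, cf l (pull X f q) =
        ∑ k ∈ Finset.Ico N 0, cf k (pull X f q) * q.coord (Sum.inl (k, l)) := by
      filter_upwards [hev] with q ⟨hqF, hqN⟩
      conv_lhs => rw [← q.graphMap_prMinus hqF.1]
      rw [Model.graphMap_apply, map_add, (prMinus (pull X f q)).2 l hl, zero_add,
        q.cf_phi _ l (hminus _ hqN)]
      refine Finset.sum_congr rfl fun k hk => ?_
      rw [cf_prMinus, if_pos (Finset.mem_Ico.1 hk).2]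
    have h2 := Model.dir_congr h1 S
    rw [hdir, Model.dir_sum _ fun k _ => (hhol k).mul (Model.holAt_coord _ p)] at h2
    have h3 : ∀ k ∈ Finset.Ico N 0,
        Model.dir S (fun q => cf k (pull X f q) * q.coord (Sum.inl (k, l))) p =
          -(cf k (prMinus w : HPrime) * p.coord (Sum.inl (k, l))) +
            cf k (prMinus u : HPrime) * cf l ((p.tangent S).1 (prMinus (b k))) := by
      intro k hk
      rw [Model.dir_mul (hhol k) (Model.holAt_coord _ p), hdir, Model.dir_coord, cf_prMinus,
        cf_prMinus, if_pos (Finset.mem_Ico.1 hk).2, if_pos (Finset.mem_Ico.1 hk).2, neg_mul]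
      rfl
    have h4 : ∑ k ∈ Finset.Ico N 0, cf k (prMinus u : HPrime) *
        cf l ((p.tangent S).1 (prMinus (b k))) = cf l ((p.tangent S).1 (prMinus u)) := by
      conv_rhs => rw [minus_eq_sum (prMinus u) (hminus _ hpN)]
      simp
    rw [Finset.sum_congr rfl h3, Finset.sum_add_distrib, Finset.sum_neg_distrib, h4,
      ← p.cf_phi _ l (hminus _ hwN)] at h2
    have h5 : (((p.tangent S).1 (prMinus u) : HPlus) : HPrime) =
        S.1 u - p.graphMap (prMinus (S.1 u)) := by
      change ((prPlus (S.1 (p.graphMap (prMinus u))) -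
        p.φ.1 (prMinus (S.1 (p.graphMap (prMinus u)))) : HPlus) : HPrime) = _
      rw [p.graphMap_prMinus hpF.1, AddSubgroupClass.coe_sub, p.graphMap_apply,
        eq_sub_of_add_eq' (prMinus_add_prPlus (S.1 u))]
      abel
    rw [h5, map_sub] at h2
    have h6 : cf l (p.graphMap (prMinus w)) = cf l (p.φ.1 (prMinus w)) := by
      rw [p.graphMap_apply, map_add, (prMinus w).2 l hl, zero_add]
    rw [map_add prMinus, map_add p.graphMap, map_sub, map_add, map_add, h6]
    linear_combination -h2
  refine ⟨hZ, ?_⟩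
  change p.psi _ = 0
  ext i
  rw [Model.psi_apply, Pi.zero_apply]
  -- This is the second equation `⟨h_i, f⟩ = 0`. Its derivative is `⟨S h_i, u⟩ - ⟨h_i, w⟩ = 0`, and
  -- skewness of `S` turns this into `⟨h_i, S u + w⟩ = 0`. Terms with `n > -N` vanish by the pole
  -- bound.
  have h1 : ∀ᶠ q in nhds p, ∑ n ∈ Finset.Ico 0 (1 - N),
      (n : ℂ) * q.coord (Sum.inr (i, n)) * cf (-n) (pull X f q) = 0 := by
    filter_upwards [hev] with q ⟨hqF, hqN⟩
    have h2 := symp_eq_sum (q.h i : HPrime) (pull X f q) (N := 0) (M := 1 - N)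
      (fun n hn => (q.h i).2 n hn) (fun n hn => hqN n (by omega))
    have h3 := congrFun (LinearMap.mem_ker.1 hqF.2) i
    have hpi : (Real.pi : ℂ) ≠ 0 := by exact_mod_cast Real.pi_ne_zero
    rw [Model.psi_apply, Pi.zero_apply, mul_eq_zero, or_iff_right (inv_ne_zero hpi), h2] at h3
    exact h3
  have h2 := Model.dir_congr h1 S
  rw [Model.dir_const, Model.dir_sum _ fun n _ =>
    ((Model.holAt_coord _ p).const_mul _).mul (hhol _)] at h2
  have h3 : ∀ n ∈ Finset.Ico 0 (1 - N),
      Model.dir S (fun q => (n : ℂ) * q.coord (Sum.inr (i, n)) * cf (-n) (pull X f q)) p =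
        (n : ℂ) * cf n (S.1 (p.h i)) * cf (-n) u - (n : ℂ) * cf n (p.h i) * cf (-n) w := by
    intro n _
    rw [Model.dir_mul ((Model.holAt_coord _ p).const_mul _) (hhol _),
      Model.dir_const_mul _ (Model.holAt_coord _ p), Model.dir_coord, hdir]
    simp only [Model.vel, Model.coord, ← hu]
    ring
  rw [Finset.sum_congr rfl h3, Finset.sum_sub_distrib,
    ← symp_eq_sum _ u (fun n hn => S.2.2 _ (p.h i).2 n hn) (fun n hn => hpN n (by omega)),
    ← symp_eq_sum _ w (fun n hn => (p.h i).2 n hn) (fun n hn => hwN n (by omega))] at h2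
  have h4 := S.2.1.2 (p.h i) u
  rw [map_add]
  have h5 : symp (p.h i : HPrime) (S.1 u) + symp (p.h i : HPrime) w = 0 := by
    linear_combination h4 - h2
  rw [h5, mul_zero]

/-- The derivative of a section of the tautological sheaf by `S`. -/
lemma exists_tautDeriv {U : Opens (SpX X)} {f : SpX X → HPrime} (hf : IsTautSection X U f)
    (S : spPlus) : ∃ u : SpX X → HPrime, IsTautSection X U (fun x => S.1 (f x) + u x) ∧
      ∀ x ∈ U, ∀ n, cf n (u x) = lieDeriv X S (fun y => cf n (f y)) x := by
  have hex : ∀ x : SpX X, ∃ u : HPrime, x ∈ U →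
      ∀ n, cf n u = lieDeriv X S (fun y => cf n (f y)) x := by
    intro x
    by_cases hx : x ∈ U
    · obtain ⟨W, hxW, N, hN⟩ := hf.2.2 x hx
      obtain ⟨u, hu⟩ := exists_cf_eq (fun n => lieDeriv X S (fun y => cf n (f y)) x) (N := N)
        (fun n hn => by
          rw [lieDeriv_congr (f' := fun _ => 0) (fun y hy => hN y hy n hn) hxW, lieDeriv_const])
        (by simp only [cf_zero]; exact lieDeriv_const S 0 x)
      exact ⟨u, fun _ => hu⟩
    · exact ⟨0, fun h => absurd h hx⟩
  choose u hu using hex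
  refine ⟨u, ⟨fun a ha => add_deriv_mem_F hf ha S (hu a ha), fun n p hp hU => ?_,
    fun a ha => ?_⟩, hu⟩
  · obtain ⟨W, hxW, N, hN⟩ := hf.2.2 _ hU
    obtain ⟨M, hM⟩ := exists_cf_eq_sum S.2.1.1 n
    have h : IsHolOn X (U ⊓ W) fun a => cf n (S.1 (f a) + u a) := by
      refine IsHolOn.congr (f := fun a => (∑ m ∈ Finset.Ico N M, cf m (f a) * cf n (S.1 (b m))) +
        lieDeriv X S (fun y => cf n (f y)) a) ?_ ?_
      · refine IsHolOn.mono inf_le_left (IsHolOn.add (IsHolOn.sum _ fun m _ => ?_) ?_)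
        · exact (show IsHolOn X U _ from hf.2.1 m).mul (isHolOn_const U _)
        · exact (show IsHolOn X U _ from hf.2.1 n).lieDeriv S
      · rintro x ⟨hxU, hxW⟩
        rw [map_add, hM _ N (hN x hxW), hu x hxU]
    exact h p hp ⟨hU, hxW⟩
  · obtain ⟨W, haW, N, hN⟩ := hf.2.2 a ha
    -- Since `S` preserves `H'_+`, the poles of `S (f x)` come only from `S (b n)` with `N ≤ n < 0`,
    -- which gives a bound uniform in `x`.
    obtain ⟨N', hN'⟩ := exists_cf_bound_finset (Finset.Ico N 0) (fun n => S.1 (b n))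
    refine ⟨U ⊓ W, ⟨ha, haW⟩, min N (min N' 0), ?_⟩
    rintro x ⟨hxU, hxW⟩ n hn
    have h1 : cf n (u x) = 0 := by
      rw [hu x hxU, lieDeriv_congr (f' := fun _ => 0) (fun y hy => hN y hy n (by omega)) hxW,
        lieDeriv_const]
    have h3 : f x - ∑ m ∈ Finset.Ico N 0, cf m (f x) • b m ∈ HPlus := by
      intro m hm
      rw [map_sub, cf_sum_b]
      by_cases h : N ≤ m
      · simp [h, hm]
      · simp [h, hN x hxW m (not_le.1 h)]
    have h4 := S.2.2 _ h3 n (by omega)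
    rw [map_sub, map_sub, sub_eq_zero, map_sum, map_sum] at h4
    rw [map_add, h1, add_zero, h4]
    refine Finset.sum_eq_zero fun m hm => ?_
    rw [map_smul, map_smul, hN' m hm n (by omega), smul_zero]

end Manifold

/-! ### The isotropy algebra fixes the point to first order. -/

section Manifold

variable {g : ℕ} {X : PPAV g}

/-- From `Z ⊆ F^⊥` one gets `S Z ⊆ F ⊆ Z`, so the tangent vector at `Z` is zero. Each `h_i` lies in
`F^⊥_+`, so `S h_i` lies in `F ∩ H'_+ = 0`. The displacement curve is constant, and derivatives of
arbitrary functions along it vanish. -/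
lemma Model.move_of_mem_spPlusF {p : Model g} {S : spPlus} (hS : S.1 ∈ spPlusF p.F) (ε : ℂ) :
    p.move S ε = p := by
  have hperp : ∀ x ∈ symp.orthogonal p.F, S.1 x ∈ p.F := hS.2.2
  have h1 : p.tangent S = 0 := by
    apply Subtype.ext
    ext1 x
    apply Subtype.ext
    change ((prPlus (S.1 (p.graphMap x)) - p.φ.1 (prMinus (S.1 (p.graphMap x))) : HPlus) :
      HPrime) = 0
    have hx : S.1 (p.graphMap x) ∈ p.Z := by
      refine (hperp _ fun y hy => ?_).1
      have hx : p.graphMap x ∈ symp.orthogonal p.Z := by rw [p.lagrangian]; exact ⟨x, rfl⟩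
      exact hx y hy.1
    have h := p.graphMap_prMinus hx
    rw [p.graphMap_apply] at h
    rw [AddSubgroupClass.coe_sub, eq_sub_of_add_eq' (prMinus_add_prPlus (S.1 _)), sub_sub, h,
      sub_self]
  have h2 : ∀ i, S.1 (p.h i) = 0 := fun i => by
    refine p.Z_inf_plus (hperp _ fun x hx => ?_).1 (S.2.2 _ (p.h i).2)
    have h := congrFun (LinearMap.mem_ker.1 hx.2) i
    have hpi : (Real.pi : ℂ) ≠ 0 := by exact_mod_cast Real.pi_ne_zero
    rw [Model.psi_apply, Pi.zero_apply, mul_eq_zero, or_iff_right (inv_ne_zero hpi)] at h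
    change symp x (p.h i) = 0
    rw [symp_neg_swap, h, neg_zero]
  refine Model.ext' ?_ ?_
  · simp [Model.move, h1]
  · ext1 i
    apply Subtype.ext
    simp [Model.move, h2]

lemma lieDeriv_of_mem_spPlusF {a : SpX X} {S : spPlus} (hS : S.1 ∈ spPlusF a.1.F)
    (f : SpX X → ℂ) : lieDeriv X S f a = 0 := by
  obtain ⟨p, hp, rfl⟩ := exists_ofFrame a
  rw [lieDeriv_ofFrame, Model.dir]
  simp only [Model.move_of_mem_spPlusF (p := p) hS]
  simp

lemma lieDerivV_of_mem_spPlusF {V : Type*} [AddCommGroup V] [Module ℂ V] {a : SpX X} {S : spPlus}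
    (hS : S.1 ∈ spPlusF a.1.F) (s : SpX X → V) : lieDerivV X S s a = 0 := by
  rw [lieDerivV]
  simp only [lieDeriv_of_mem_spPlusF hS, zero_smul, finsum_zero]

/-! ## Actions on sections of `V ⊗ 𝒪` -/

section Action

variable {V : Type*} [AddCommGroup V] [Module ℂ V]

/-- The action of `S` on functions with values in `V`, if `S` acts by `D` on `V`. -/
def derAct (D : V →ₗ[ℂ] V) (S : spPlus) (s : SpX X → V) : SpX X → V :=
  fun a => D (s a) + lieDerivV X S s a

lemma derAct_eq_sum {ι : Type*} (I : Finset ι) {W : Opens (SpX X)} {f : ι → SpX X → ℂ}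
    (hf : ∀ i ∈ I, IsHolOn X W (f i)) {v : ι → V} {s : SpX X → V}
    (hs : ∀ x ∈ W, s x = ∑ i ∈ I, f i x • v i) {a : SpX X} (ha : a ∈ W) (D : V →ₗ[ℂ] V)
    (S : spPlus) : derAct D S s a =
      (∑ i ∈ I, f i a • D (v i)) + ∑ i ∈ I, lieDeriv X S (f i) a • v i := by
  rw [derAct, lieDerivV_eq_sum I hf hs ha, hs a ha, map_sum]
  simp only [map_smul]

lemma derAct_congr {U : Opens (SpX X)} {s s' : SpX X → V} (h : ∀ x ∈ U, s x = s' x) {a : SpX X}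
    (ha : a ∈ U) (D : V →ₗ[ℂ] V) (S : spPlus) : derAct D S s a = derAct D S s' a := by
  rw [derAct, derAct, h a ha, lieDerivV, lieDerivV]
  congr 1
  refine finsum_congr fun i => ?_
  rw [lieDeriv_congr (f' := fun x => (Module.Basis.ofVectorSpace ℂ V).repr (s' x) i)
    (fun x hx => by rw [h x hx]) ha]

lemma derAct_mem_VO {U : Opens (SpX X)} {s : SpX X → V} (hs : s ∈ VO X V U) (D : V →ₗ[ℂ] V)
    (S : spPlus) : derAct D S s ∈ VO X V U := by
  intro a ha
  obtain ⟨W, haW, hWU, n, f, v, hf, hsW⟩ := exists_of_mem_VO hs ha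
  refine ⟨W, haW, hWU, _, add_mem
    (sum_smul_mem_tensorPre Finset.univ (fun i _ => hf i) fun i => D (v i))
    (sum_smul_mem_tensorPre Finset.univ (fun i _ => (hf i).lieDeriv S) v), fun x hx => ?_⟩
  exact derAct_eq_sum Finset.univ (fun i _ => hf i) hsW hx D S

lemma derAct_add {U : Opens (SpX X)} {s s' : SpX X → V} (hs : s ∈ VO X V U) (hs' : s' ∈ VO X V U)
    {a : SpX X} (ha : a ∈ U) (D : V →ₗ[ℂ] V) (S : spPlus) :
    derAct D S (s + s') a = derAct D S s a + derAct D S s' a := by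
  obtain ⟨W, haW, -, n, f, v, hf, hsW⟩ := exists_of_mem_VO hs ha
  obtain ⟨W', haW', -, n', f', v', hf', hsW'⟩ := exists_of_mem_VO hs' ha
  rw [derAct_eq_sum Finset.univ (fun i _ => hf i) hsW haW D S,
    derAct_eq_sum Finset.univ (fun i _ => hf' i) hsW' haW' D S,
    derAct_eq_sum (W := W ⊓ W') Finset.univ (f := Sum.elim f f') (v := Sum.elim v v') ?_ ?_
      ⟨haW, haW'⟩ D S]
  · simp only [Fintype.sum_sum_type, Sum.elim_inl, Sum.elim_inr]
    abel
  · rintro (i | i) -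
    · exact (hf i).mono inf_le_left
    · exact (hf' i).mono inf_le_right
  · rintro x ⟨hx, hx'⟩
    simp [hsW x hx, hsW' x hx']

lemma derAct_smul {U : Opens (SpX X)} {s : SpX X → V} (hs : s ∈ VO X V U) (c : ℂ)
    {a : SpX X} (ha : a ∈ U) (D : V →ₗ[ℂ] V) (S : spPlus) :
    derAct D S (c • s) a = c • derAct D S s a := by
  obtain ⟨W, haW, -, n, f, v, hf, hsW⟩ := exists_of_mem_VO hs ha
  rw [derAct_eq_sum Finset.univ (fun i _ => hf i) hsW haW D S,
    derAct_eq_sum Finset.univ (fun i _ => hf i) (v := fun i => c • v i) ?_ haW D S]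
  · simp only [map_smul, smul_comm _ c, ← Finset.smul_sum, smul_add]
  · intro x hx
    simp [hsW x hx, Finset.smul_sum, smul_comm c]

lemma derAct_add_left {U : Opens (SpX X)} {s : SpX X → V} (hs : s ∈ VO X V U)
    {a : SpX X} (ha : a ∈ U) (D D' : V →ₗ[ℂ] V) (S S' : spPlus) :
    derAct (D + D') (S + S') s a = derAct D S s a + derAct D' S' s a := by
  obtain ⟨W, haW, -, n, f, v, hf, hsW⟩ := exists_of_mem_VO hs ha
  simp only [derAct_eq_sum Finset.univ (fun i _ => hf i) hsW haW, lieDeriv_add_left (hf _) haW,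
    LinearMap.add_apply, smul_add, add_smul, Finset.sum_add_distrib]
  abel

lemma derAct_smul_left {U : Opens (SpX X)} {s : SpX X → V} (hs : s ∈ VO X V U)
    {a : SpX X} (ha : a ∈ U) (c : ℂ) (D : V →ₗ[ℂ] V) (S : spPlus) :
    derAct (c • D) (c • S) s a = c • derAct D S s a := by
  obtain ⟨W, haW, -, n, f, v, hf, hsW⟩ := exists_of_mem_VO hs ha
  simp only [derAct_eq_sum Finset.univ (fun i _ => hf i) hsW haW, lieDeriv_smul_left (hf _) haW,
    LinearMap.smul_apply, smul_add, mul_smul, Finset.smul_sum, smul_comm _ c]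

/-- The mixed terms, with one operator acting on the vector and the other on its coefficient, are
symmetric under exchange of the two and cancel. What remains is the commutator on `V` and
`lieDeriv_lie` on coefficients. -/
lemma derAct_lie {U : Opens (SpX X)} {s : SpX X → V} (hs : s ∈ VO X V U)
    {a : SpX X} (ha : a ∈ U) (D D' : V →ₗ[ℂ] V) (S S' : spPlus) :
    derAct (D ∘ₗ D' - D' ∘ₗ D) ⁅S, S'⁆ s a =
      derAct D S (derAct D' S' s) a - derAct D' S' (derAct D S s) a := by
  obtain ⟨W, haW, -, n, f, v, hf, hsW⟩ := exists_of_mem_VO hs ha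
  have key : ∀ (D D' : V →ₗ[ℂ] V) (S S' : spPlus), derAct D S (derAct D' S' s) a =
      (∑ i, f i a • D (D' (v i))) + (∑ i, lieDeriv X S' (f i) a • D (v i)) +
        ((∑ i, lieDeriv X S (f i) a • D' (v i)) +
          ∑ i, lieDeriv X S (lieDeriv X S' (f i)) a • v i) := by
    intro D D' S S'
    rw [derAct_eq_sum (W := W) Finset.univ (f := Sum.elim f fun i => lieDeriv X S' (f i))
      (v := Sum.elim (fun i => D' (v i)) v) ?_ ?_ haW D S]
    · simp only [Fintype.sum_sum_type, Sum.elim_inl, Sum.elim_inr]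
    · rintro (i | i) -
      · exact hf i
      · exact (hf i).lieDeriv S'
    · intro x hx
      rw [derAct_eq_sum Finset.univ (fun i _ => hf i) hsW hx]
      simp only [Fintype.sum_sum_type, Sum.elim_inl, Sum.elim_inr]
  rw [key, key, derAct_eq_sum Finset.univ (fun i _ => hf i) hsW haW]
  simp only [lieDeriv_lie (hf _) haW, LinearMap.sub_apply, LinearMap.comp_apply, smul_sub,
    sub_smul, Finset.sum_sub_distrib]
  abel

end Action

/-! ## The subsheaf `𝔥^out(X, Θ)(V ⊗ 𝒪)` -/

section Coinvariants

variable {𝔥 : Type*} [AddCommGroup 𝔥] [Module ℂ 𝔥] (κ : LinearMap.BilinForm ℂ 𝔥) (k : Kind)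

lemma act_eq_derAct {κ : LinearMap.BilinForm ℂ 𝔥} {d : ℕ} {H : Module.Basis (Fin d) ℂ 𝔥}
    (hH : ∀ i j, κ (H i) (H j) = if i = j then 1 else 0) (S : spPlus) (s : SpX X → HVA κ k) :
    act κ k X H S s = derAct (fockDer κ k.level S) S s := by
  funext a
  rw [act, spAct_eq_fockDer hH, derAct]

variable {κ k}

lemma exists_op_eq_zero_fin {n : ℕ} (v : Fin n → HVA κ k) : ∃ M : ℤ, ∀ i (A : 𝔥) (f : LS),
    (∀ n < M, f.coeff n = 0) → op κ k.level A f (v i) = 0 := by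
  choose M hM using fun i => exists_op_eq_zero (v i)
  obtain ⟨M₀, hM₀⟩ := (Set.finite_range M).bddAbove
  exact ⟨M₀, fun i A f hf => hM i A f fun n hn => hf n (hn.trans_le (hM₀ ⟨i, rfl⟩))⟩

lemma op_sum_smul {n : ℕ} (v : Fin n → HVA κ k) (c : Fin n → ℂ) (A : 𝔥) (x : HPrime) {M N : ℤ}
    (hN : ∀ n < N, cf n x = 0) (hM : ∀ i (A : 𝔥) (f : LS),
      (∀ n < M, f.coeff n = 0) → op κ k.level A f (v i) = 0) :
    op κ k.level A (rep x) (∑ i, c i • v i) = ∑ im ∈ Finset.univ ×ˢ Finset.Ico N M,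
      (c im.1 * cf im.2 x) • mode κ k.level A im.2 (v im.1) := by
  rw [Finset.sum_product, ← opL_apply, map_sum]
  refine Finset.sum_congr rfl fun i _ => ?_
  rw [map_smul, opL_apply, op_eq_sum κ k.level A (rep x) (v i) hN (hM i), fock_smul_sum]
  exact Finset.sum_congr rfl fun m _ => fock_smul_smul _ _ _ _ _

/-- Locally, `(A ⊗ f) t` is a finite sum of products of holomorphic functions and vectors. -/
lemma exists_op_local {U : Opens (SpX X)} {f : SpX X → HPrime} (hf : IsTautSection X U f)
    {t : SpX X → HVA κ k} (ht : t ∈ VO X (HVA κ k) U) {a : SpX X} (ha : a ∈ U) :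
    ∃ W : Opens (SpX X), a ∈ W ∧ W ≤ U ∧ ∃ (n : ℕ) (c : Fin n → SpX X → ℂ) (v : Fin n → HVA κ k)
      (N M : ℤ), (∀ i, IsHolOn X W (c i)) ∧ (∀ x ∈ W, t x = ∑ i, c i x • v i) ∧
      (∀ x ∈ W, ∀ n < N, cf n (f x) = 0) ∧ ∀ i (A : 𝔥) (f : LS),
        (∀ n < M, f.coeff n = 0) → op κ k.level A f (v i) = 0 := by
  obtain ⟨W, haW, hWU, n, c, v, hc, htW⟩ := exists_of_mem_VO ht ha
  obtain ⟨W', haW', N, hN⟩ := hf.2.2 a ha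
  obtain ⟨M, hM⟩ := exists_op_eq_zero_fin v
  exact ⟨W ⊓ W', ⟨haW, haW'⟩, inf_le_left.trans hWU, n, c, v, N, M,
    fun i => (hc i).mono inf_le_left, fun x hx => htW x hx.1, fun x hx => hN x hx.2, hM⟩

lemma op_mem_VO {U : Opens (SpX X)} {f : SpX X → HPrime} (hf : IsTautSection X U f)
    {t : SpX X → HVA κ k} (ht : t ∈ VO X (HVA κ k) U) (A : 𝔥) :
    (fun x => op κ k.level A (rep (f x)) (t x)) ∈ VO X (HVA κ k) U := by
  intro a ha
  obtain ⟨W, haW, hWU, n, c, v, N, M, hc, htW, hN, hM⟩ := exists_op_local hf ht ha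
  refine ⟨W, haW, hWU, _, sum_smul_mem_tensorPre (Finset.univ ×ˢ Finset.Ico N M)
    (f := fun im x => c im.1 x * cf im.2 (f x)) (fun im _ => ?_)
    (fun im => mode κ k.level A im.2 (v im.1)), fun x hx => ?_⟩
  · exact (hc im.1).mul ((show IsHolOn X U _ from hf.2.1 im.2).mono hWU)
  · beta_reduce
    rw [htW x hx, op_sum_smul v _ A (f x) (hN x hx) hM]

/-- The operator `A ⊗ f` is affected twice: the commutator with `fockDer S` produces `S f`, and
differentiating the coefficients produces `u`. Only the sum `S f + u` is a section of `𝔽`, and with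
it both terms on the right lie in the subsheaf. -/
lemma derAct_op {U : Opens (SpX X)} {f : SpX X → HPrime} (hf : IsTautSection X U f)
    {t : SpX X → HVA κ k} (ht : t ∈ VO X (HVA κ k) U) (A : 𝔥) (S : spPlus) {u : SpX X → HPrime}
    (hu : ∀ x ∈ U, ∀ n, cf n (u x) = lieDeriv X S (fun y => cf n (f y)) x) {a : SpX X}
    (ha : a ∈ U) :
    derAct (fockDer κ k.level S) S (fun x => op κ k.level A (rep (f x)) (t x)) a =
      op κ k.level A (rep (S.1 (f a) + u a)) (t a) +
        op κ k.level A (rep (f a)) (derAct (fockDer κ k.level S) S t a) := by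
  obtain ⟨W, haW, hWU, n, c, v, N, M, hc, htW, hN, hM⟩ := exists_op_local hf ht ha
  have hfW : ∀ m, IsHolOn X W fun x => cf m (f x) := fun m =>
    (show IsHolOn X U _ from hf.2.1 m).mono hWU
  have huN : ∀ n < N, cf n (u a) = 0 := fun n hn => by
    rw [hu a ha, lieDeriv_congr (f' := fun _ => 0) (fun x hx => hN x hx n hn) haW, lieDeriv_const]
  have h1 : lieDerivV X S (fun x => op κ k.level A (rep (f x)) (t x)) a =
      op κ k.level A (rep (f a)) (lieDerivV X S t a) + op κ k.level A (rep (u a)) (t a) := by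
    rw [lieDerivV_eq_sum (Finset.univ ×ˢ Finset.Ico N M) (W := W)
      (f := fun im x => c im.1 x * cf im.2 (f x))
      (fun im _ => (hc im.1).mul (hfW im.2))
      (v := fun im => mode κ k.level A im.2 (v im.1))
      (fun x hx => by rw [htW x hx, op_sum_smul v _ A (f x) (hN x hx) hM]) haW,
      lieDerivV_eq_sum Finset.univ (fun i _ => hc i) htW haW, htW a haW,
      op_sum_smul v _ A (f a) (hN a haW) hM, op_sum_smul v _ A (u a) huN hM,
      ← Finset.sum_add_distrib]
    refine Finset.sum_congr rfl fun im _ => ?_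
    rw [lieDeriv_mul (hc im.1) (hfW im.2) haW, hu a ha]
    exact add_smul _ _ _
  have h2 : liftEnd S.1 (rep (f a)) = rep (S.1 (f a)) := by simp [liftEnd, toHPrime_rep]
  rw [derAct, derAct, h1, fockDer_op, h2]
  simp only [← opL_apply, map_add, LinearMap.add_apply]
  abel

variable (κ k)

lemma houtPre_le_VO (U : Opens (SpX X)) : houtPre κ k X U ≤ VO X (HVA κ k) U := by
  refine Submodule.span_le.2 ?_
  rintro _ ⟨A, f, t, hf, ht, rfl⟩
  exact op_mem_VO hf ht A

lemma hout_le_VO (U : Opens (SpX X)) : hout κ k X U ≤ VO X (HVA κ k) U := by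
  intro s hs
  refine mem_VO_of_locally fun a ha => ?_
  obtain ⟨W, haW, hWU, t, ht, hst⟩ := hs a ha
  exact ⟨W, haW, hWU, t, houtPre_le_VO κ k W ht, hst⟩

variable {κ k}

lemma exists_derAct_houtPre {W : Opens (SpX X)} {t : SpX X → HVA κ k} (ht : t ∈ houtPre κ k X W)
    (S : spPlus) : ∃ r ∈ houtPre κ k X W, ∀ x ∈ W,
      derAct (fockDer κ k.level S) S t x = r x := by
  have hVO := houtPre_le_VO κ k (X := X) W
  induction ht using Submodule.span_induction with
  | mem t ht =>
    obtain ⟨A, f, t, hf, ht, rfl⟩ := ht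
    obtain ⟨u, hu, hu'⟩ := exists_tautDeriv hf S
    refine ⟨_, add_mem (Submodule.subset_span ⟨A, _, t, hu, ht, rfl⟩)
      (Submodule.subset_span ⟨A, f, _, hf, derAct_mem_VO ht (fockDer κ k.level S) S, rfl⟩),
      fun x hx => ?_⟩
    exact derAct_op hf ht A S hu' hx
  | zero =>
    refine ⟨0, zero_mem _, fun x hx => ?_⟩
    rw [derAct_eq_sum (∅ : Finset ℕ) (f := fun _ _ => 0) (v := fun _ => 0) (by simp) (by simp) hx]
    simp
  | add t t' ht ht' h h' =>
    obtain ⟨r, hr, hrx⟩ := h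
    obtain ⟨r', hr', hrx'⟩ := h'
    refine ⟨r + r', add_mem hr hr', fun x hx => ?_⟩
    rw [derAct_add (hVO ht) (hVO ht') hx, hrx x hx, hrx' x hx]
    rfl
  | smul c t ht h =>
    obtain ⟨r, hr, hrx⟩ := h
    refine ⟨c • r, Submodule.smul_mem _ c hr, fun x hx => ?_⟩
    rw [derAct_smul (hVO ht) c hx, hrx x hx]
    rfl

lemma derAct_mem_hout {U : Opens (SpX X)} {s : SpX X → HVA κ k} (hs : s ∈ hout κ k X U)
    (S : spPlus) : derAct (fockDer κ k.level S) S s ∈ hout κ k X U := by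
  intro a ha
  obtain ⟨W, haW, hWU, t, ht, hst⟩ := hs a ha
  obtain ⟨r, hr, hrx⟩ := exists_derAct_houtPre ht S
  exact ⟨W, haW, hWU, r, hr, fun x hx => (derAct_congr hst hx _ S).trans (hrx x hx)⟩

end Coinvariants

end Manifold

/-! ### Stalks of the sheaf of coinvariants and the induced action. -/

section Manifold

variable {g : ℕ} {X : PPAV g}

/-- Neighborhoods of `a` are closed under intersection, so the family is directed and its supremum
is a union. -/
lemma mem_iSup_germs {V : Type*} [AddCommGroup V] [Module ℂ V]
    {P : Opens (SpX X) → Submodule ℂ (SpX X → V)} (hP : Antitone P) {a : SpX X} {s : SpX X → V} :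
    s ∈ ⨆ (U : Opens (SpX X)) (_ : a ∈ U), P U ↔ ∃ U : Opens (SpX X), a ∈ U ∧ s ∈ P U := by
  constructor
  · let Q : Submodule ℂ (SpX X → V) :=
      { carrier := {s | ∃ U : Opens (SpX X), a ∈ U ∧ s ∈ P U}
        add_mem' := by
          rintro s t ⟨U, hU, hs⟩ ⟨W, hW, ht⟩
          exact ⟨U ⊓ W, ⟨hU, hW⟩, add_mem (hP inf_le_left hs) (hP inf_le_right ht)⟩
        zero_mem' := ⟨⊤, trivial, zero_mem _⟩
        smul_mem' := by
          rintro c s ⟨U, hU, hs⟩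
          exact ⟨U, hU, Submodule.smul_mem _ c hs⟩ }
    have h : ⨆ (U : Opens (SpX X)) (_ : a ∈ U), P U ≤ Q :=
      iSup₂_le fun U hU s hs => ⟨U, hU, hs⟩
    exact fun hs => h hs
  · rintro ⟨U, hU, hs⟩
    exact le_iSup₂ (f := fun (U : Opens (SpX X)) (_ : a ∈ U) => P U) U hU hs

section Coinvariants

variable {𝔥 : Type*} [AddCommGroup 𝔥] [Module ℂ 𝔥] {κ : LinearMap.BilinForm ℂ 𝔥} {k : Kind}

lemma mem_VOat {a : SpX X} {s : SpX X → HVA κ k} :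
    s ∈ VOat κ k X a ↔ ∃ U : Opens (SpX X), a ∈ U ∧ s ∈ VO X (HVA κ k) U :=
  mem_iSup_germs (locallyIn_antitone X _ _)

lemma mem_houtAt {a : SpX X} {s : SpX X → HVA κ k} :
    s ∈ houtAt κ k X a ↔ ∃ U : Opens (SpX X), a ∈ U ∧ s ∈ hout κ k X U :=
  mem_iSup_germs (locallyIn_antitone X _ _)

lemma toStalk_surjective (a : SpX X) : Function.Surjective (toStalk κ k X a) :=
  Submodule.mkQ_surjective _

lemma toStalk_eq_zero {a : SpX X} {s : VOat κ k X a} :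
    toStalk κ k X a s = 0 ↔ s.1 ∈ houtAt κ k X a :=
  Submodule.Quotient.mk_eq_zero _

lemma toStalk_eq_of_sub {a : SpX X} {s s' : VOat κ k X a} {W : Opens (SpX X)} (ha : a ∈ W)
    {τ : SpX X → HVA κ k} (hτ : τ ∈ houtPre κ k X W) (h : ∀ x ∈ W, s.1 x - s'.1 x = τ x) :
    toStalk κ k X a s = toStalk κ k X a s' := by
  rw [← sub_eq_zero, ← map_sub, toStalk_eq_zero, mem_houtAt]
  exact ⟨W, ha, fun b hb => ⟨W, hb, le_rfl, τ, hτ, h⟩⟩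

lemma toStalk_congr {a : SpX X} {s s' : VOat κ k X a} {W : Opens (SpX X)} (ha : a ∈ W)
    (h : ∀ x ∈ W, s.1 x = s'.1 x) : toStalk κ k X a s = toStalk κ k X a s' :=
  toStalk_eq_of_sub ha (zero_mem _) fun x hx => by rw [h x hx, sub_self]; rfl

lemma derAct_mem_VOat {a : SpX X} {s : SpX X → HVA κ k} (hs : s ∈ VOat κ k X a) (S : spPlus) :
    derAct (fockDer κ k.level S) S s ∈ VOat κ k X a := by
  obtain ⟨U, hU, hs⟩ := mem_VOat.1 hs
  exact mem_VOat.2 ⟨U, hU, derAct_mem_VO hs _ S⟩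

lemma exists_VO_of_VOat {a : SpX X} {s s' : SpX X → HVA κ k} (hs : s ∈ VOat κ k X a)
    (hs' : s' ∈ VOat κ k X a) :
    ∃ U : Opens (SpX X), a ∈ U ∧ s ∈ VO X (HVA κ k) U ∧ s' ∈ VO X (HVA κ k) U := by
  obtain ⟨U, hU, hs⟩ := mem_VOat.1 hs
  obtain ⟨U', hU', hs'⟩ := mem_VOat.1 hs'
  exact ⟨U ⊓ U', ⟨hU, hU'⟩, locallyIn_antitone X _ _ inf_le_left hs,
    locallyIn_antitone X _ _ inf_le_right hs'⟩

variable (κ k) in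
/-- The action of `S` on germs of sections of `V ⊗ 𝒪`, with values in the stalk of `V̂`. -/
def preStalkAct (S : spPlus) (a : SpX X) : VOat κ k X a →ₗ[ℂ] Stalk κ k X a where
  toFun s := toStalk κ k X a ⟨derAct (fockDer κ k.level S) S s.1, derAct_mem_VOat s.2 S⟩
  map_add' s s' := by
    obtain ⟨U, ha, hs, hs'⟩ := exists_VO_of_VOat s.2 s'.2
    rw [← map_add]
    exact toStalk_congr ha fun x hx => derAct_add hs hs' hx _ S
  map_smul' c s := by
    obtain ⟨U, ha, hs⟩ := mem_VOat.1 s.2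
    rw [← map_smul]
    exact toStalk_congr ha fun x hx => derAct_smul hs c hx _ S

variable (κ k) in
/-- The action of `S` on the stalk of `V̂`. -/
def stalkAct (S : spPlus) (a : SpX X) : Stalk κ k X a →ₗ[ℂ] Stalk κ k X a :=
  Submodule.liftQ ((houtAt κ k X a).submoduleOf (VOat κ k X a)) (preStalkAct κ k S a) (by
    intro s hs
    obtain ⟨U, ha, hs⟩ := mem_houtAt.1 (show s.1 ∈ houtAt κ k X a from hs)
    exact toStalk_eq_zero.2 (mem_houtAt.2 ⟨U, ha, derAct_mem_hout hs S⟩))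

lemma stalkAct_toStalk (S : spPlus) (a : SpX X) (s : VOat κ k X a) :
    stalkAct κ k S a (toStalk κ k X a s) =
      toStalk κ k X a ⟨derAct (fockDer κ k.level S) S s.1, derAct_mem_VOat s.2 S⟩ := rfl

lemma stalkAct_germ (S : spPlus) {U : Opens (SpX X)} {a : SpX X} (ha : a ∈ U)
    (s : VO X (HVA κ k) U) : stalkAct κ k S a (germ κ k X U a ha s) =
      germ κ k X U a ha ⟨derAct (fockDer κ k.level S) S s.1, derAct_mem_VO s.2 _ S⟩ := rfl

lemma stalkAct_add (S T : spPlus) (a : SpX X) :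
    stalkAct κ k (S + T) a = stalkAct κ k S a + stalkAct κ k T a := by
  ext σ
  obtain ⟨s, rfl⟩ := toStalk_surjective a σ
  obtain ⟨U, ha, hs⟩ := mem_VOat.1 s.2
  rw [LinearMap.add_apply, stalkAct_toStalk, stalkAct_toStalk, stalkAct_toStalk, ← map_add]
  refine toStalk_congr ha fun x hx => ?_
  change derAct (fockDer κ k.level (S + T)) (S + T) s.1 x = _
  rw [fockDer_add]
  exact derAct_add_left hs hx _ _ S T

lemma stalkAct_smul (c : ℂ) (S : spPlus) (a : SpX X) :
    stalkAct κ k (c • S) a = c • stalkAct κ k S a := by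
  ext σ
  obtain ⟨s, rfl⟩ := toStalk_surjective a σ
  obtain ⟨U, ha, hs⟩ := mem_VOat.1 s.2
  rw [LinearMap.smul_apply, stalkAct_toStalk, stalkAct_toStalk, ← map_smul]
  refine toStalk_congr ha fun x hx => ?_
  change derAct (fockDer κ k.level (c • S)) (c • S) s.1 x = _
  rw [fockDer_smul]
  exact derAct_smul_left hs hx c _ S

lemma stalkAct_lie (S T : spPlus) (a : SpX X) (σ : Stalk κ k X a) :
    stalkAct κ k ⁅S, T⁆ a σ =
      stalkAct κ k S a (stalkAct κ k T a σ) - stalkAct κ k T a (stalkAct κ k S a σ) := by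
  obtain ⟨s, rfl⟩ := toStalk_surjective a σ
  obtain ⟨U, ha, hs⟩ := mem_VOat.1 s.2
  simp only [stalkAct_toStalk]
  rw [← map_sub]
  refine toStalk_congr ha fun x hx => ?_
  change derAct (fockDer κ k.level ⁅S, T⁆) ⁅S, T⁆ s.1 x = _
  rw [fockDer_lie]
  exact derAct_lie hs hx _ _ S T

variable (κ k) in
/-- The action of `S` on the sections of `V̂` over `U`. -/
def vhatAct (U : Opens (SpX X)) (S : spPlus) : Module.End ℂ (Vhat κ k X U) :=
  LinearMap.restrict
    (LinearMap.pi fun a : U => stalkAct κ k S a.1 ∘ₗ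
      (LinearMap.proj a : ((a : U) → Stalk κ k X a.1) →ₗ[ℂ] Stalk κ k X a.1)) (by
    intro σ hσ a ha
    obtain ⟨W, hW, haW, s, hs⟩ := hσ a ha
    refine ⟨W, hW, haW, ⟨derAct (fockDer κ k.level S) S s.1, derAct_mem_VO s.2 _ S⟩,
      fun x hx => ?_⟩
    rw [← stalkAct_germ, ← hs x hx]
    rfl)

lemma vhatAct_apply (U : Opens (SpX X)) (S : spPlus) (σ : Vhat κ k X U) (a : U) :
    (vhatAct κ k U S σ).1 a = stalkAct κ k S a.1 (σ.1 a) := rfl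

variable (κ k) in
/-- The representation of `sp⁺(H')` on the sections of `V̂` over `U`. -/
def vhatRep (U : Opens (SpX X)) : spPlus →ₗ⁅ℂ⁆ Module.End ℂ (Vhat κ k X U) where
  toFun := vhatAct κ k U
  map_add' S T := by
    refine LinearMap.ext fun σ => Subtype.ext (funext fun a => ?_)
    rw [vhatAct_apply, stalkAct_add]
    rfl
  map_smul' c S := by
    refine LinearMap.ext fun σ => Subtype.ext (funext fun a => ?_)
    rw [vhatAct_apply, stalkAct_smul]
    rfl
  map_lie' {S T} := by
    refine LinearMap.ext fun σ => Subtype.ext (funext fun a => ?_)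
    exact stalkAct_lie S T a.1 (σ.1 a)

/-! ## Fibers -/

lemma const_mem_VO (U : Opens (SpX X)) {V : Type*} [AddCommGroup V] [Module ℂ V] (v : V) :
    (fun _ => v) ∈ VO X V U :=
  tensorPre_le_VO U (Submodule.subset_span ⟨fun _ => 1, v, isHolOn_const U 1, by simp⟩)

lemma houtPre_apply_mem {W : Opens (SpX X)} {t : SpX X → HVA κ k} (ht : t ∈ houtPre κ k X W)
    {a : SpX X} (ha : a ∈ W) : t a ∈ houtFiber κ k a.1 := by
  induction ht using Submodule.span_induction with
  | mem t ht =>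
    obtain ⟨A, f, t, hf, -, rfl⟩ := ht
    exact Submodule.subset_span ⟨A, f a, t a, hf.1 a ha, rfl⟩
  | zero => exact zero_mem _
  | add t t' _ _ h h' => exact add_mem h h'
  | smul c t _ h => exact Submodule.smul_mem _ c h

/-- A generator `(A ⊗ f₀) u` is extended by a local section of `𝔽` through `f₀` and the constant
section `u`. Together with `houtPre_apply_mem` this identifies the values at `a` of the subsheaf. -/
lemma exists_houtPre_apply_eq {a : SpX X} {v : HVA κ k} (hv : v ∈ houtFiber κ k a.1) :
    ∃ W : Opens (SpX X), a ∈ W ∧ ∃ τ ∈ houtPre κ k X W, τ a = v := by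
  induction hv using Submodule.span_induction with
  | mem v hv =>
    obtain ⟨A, f₀, u, hf₀, rfl⟩ := hv
    obtain ⟨W, f, ha, hf, hfa⟩ := exists_tautSection a hf₀
    exact ⟨W, ha, _, Submodule.subset_span ⟨A, f, fun _ => u, hf, const_mem_VO W u, rfl⟩,
      by rw [← hfa]⟩
  | zero => exact ⟨⊤, trivial, 0, zero_mem _, rfl⟩
  | add v v' _ _ h h' =>
    obtain ⟨W, ha, τ, hτ, rfl⟩ := h
    obtain ⟨W', ha', τ', hτ', rfl⟩ := h'
    exact ⟨W ⊓ W', ⟨ha, ha'⟩, τ + τ', add_mem (houtPre_antitone κ k X inf_le_left hτ)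
      (houtPre_antitone κ k X inf_le_right hτ'), rfl⟩
  | smul c v _ h =>
    obtain ⟨W, ha, τ, hτ, rfl⟩ := h
    exact ⟨W, ha, c • τ, Submodule.smul_mem _ c hτ, rfl⟩

variable (κ k) in
/-- Evaluation at `a` of germs of sections of `V̂`. -/
def evalStalk (a : SpX X) : Stalk κ k X a →ₗ[ℂ] Coinv κ k a.1 :=
  Submodule.liftQ ((houtAt κ k X a).submoduleOf (VOat κ k X a))
    ((houtFiber κ k a.1).mkQ ∘ₗ LinearMap.proj a ∘ₗ (VOat κ k X a).subtype) (by
    intro s hs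
    obtain ⟨U, ha, hs⟩ := mem_houtAt.1 (show s.1 ∈ houtAt κ k X a from hs)
    obtain ⟨W, haW, -, t, ht, hst⟩ := hs a ha
    refine (Submodule.Quotient.mk_eq_zero _).2 ?_
    change s.1 a ∈ _
    rw [hst a haW]
    exact houtPre_apply_mem ht haW)

lemma evalStalk_toStalk (a : SpX X) (s : VOat κ k X a) :
    evalStalk κ k a (toStalk κ k X a s) = Submodule.Quotient.mk (s.1 a) := rfl

lemma evalStalk_surjective (a : SpX X) : Function.Surjective (evalStalk κ k a) := by
  intro c
  obtain ⟨v, rfl⟩ := Submodule.mkQ_surjective _ c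
  exact ⟨toStalk κ k X a ⟨fun _ => v, mem_VOat.2 ⟨⊤, trivial, const_mem_VO ⊤ v⟩⟩, rfl⟩

/-- If the value of `s` at `a` lies in `(𝔥 ⊗ F)(V)`, subtract a section `τ` of the subsheaf with
that value. Near `a` the difference is `∑ f_i v_i` with `∑ f_i(a) v_i = 0`, hence equals `∑ (f_i -
f_i(a)) v_i`, whose coefficients vanish at `a`. The `v_i` need not be independent. -/
lemma maxIdealStalk_eq_ker (a : SpX X) :
    maxIdealStalk κ k X a = LinearMap.ker (evalStalk κ k a) := by
  apply le_antisymm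
  · rintro _ ⟨⟨s, hsV⟩, hs, rfl⟩
    have h0 : s a = 0 := by
      have hs' : s ∈ Submodule.span ℂ _ := hs
      clear hs hsV
      induction hs' using Submodule.span_induction with
      | mem s hs =>
        obtain ⟨U, f, t, -, -, hfa, -, rfl⟩ := hs
        change f a • t a = 0
        rw [hfa, fock_zero_smul]
      | zero => rfl
      | add s s' _ _ h h' => rw [Pi.add_apply, h, h', add_zero]
      | smul c s _ h => rw [Pi.smul_apply, h]; exact fock_smul_zero _ _ c
    rw [LinearMap.mem_ker, evalStalk_toStalk]
    refine (Submodule.Quotient.mk_eq_zero _).2 ?_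
    change s a ∈ houtFiber κ k a.1
    rw [h0]
    exact zero_mem _
  · intro σ hσ
    obtain ⟨s, rfl⟩ := toStalk_surjective a σ
    rw [LinearMap.mem_ker, evalStalk_toStalk, Submodule.Quotient.mk_eq_zero] at hσ
    obtain ⟨U, haU, hs⟩ := mem_VOat.1 s.2
    obtain ⟨W, haW, τ, hτ, hτa⟩ := exists_houtPre_apply_eq hσ
    have hsτ : s.1 - τ ∈ VO X (HVA κ k) (U ⊓ W) :=
      sub_mem (locallyIn_antitone X _ _ inf_le_left hs)
        (locallyIn_antitone X _ _ inf_le_right (houtPre_le_VO κ k W hτ))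
    obtain ⟨W', haW', hW', n, f, v, hf, hfs⟩ := exists_of_mem_VO hsτ ⟨haU, haW⟩
    have h0 : ∑ i, f i a • v i = 0 := by
      rw [← hfs a haW', Pi.sub_apply, hτa, sub_self]
    have hf' : ∀ i, IsHolOn X W' fun x => f i x + -f i a := fun i =>
      (hf i).add (isHolOn_const W' _)
    have hr : (fun x => ∑ i, (f i x + -f i a) • v i) ∈ VO X (HVA κ k) W' :=
      tensorPre_le_VO W' (sum_smul_mem_tensorPre Finset.univ (fun i _ => hf' i) v)
    let r : VOat κ k X a := ⟨_, mem_VOat.2 ⟨W', haW', hr⟩⟩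
    refine ⟨r, ?_, (toStalk_eq_of_sub haW' (houtPre_antitone κ k X
      (hW'.trans inf_le_right) hτ) fun x hx => ?_).symm⟩
    · change (fun x => ∑ i, (f i x + -f i a) • v i) ∈ Submodule.span ℂ _
      have hsum : (fun x => ∑ i, (f i x + -f i a) • v i) =
          ∑ i, fun x => (f i x + -f i a) • v i := by
        funext x
        rw [Finset.sum_apply]
      rw [hsum]
      exact sum_mem fun i _ => Submodule.subset_span
        ⟨W', _, fun _ => v i, haW', hf' i, add_neg_cancel _, const_mem_VO W' (v i), rfl⟩
    · have h1 : ∑ i, (f i x + -f i a) • v i = s.1 x - τ x := by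
        have h2 := hfs x hx
        rw [Pi.sub_apply] at h2
        rw [h2, ← sub_zero (∑ i, f i x • v i), ← h0, ← Finset.sum_sub_distrib]
        refine Finset.sum_congr rfl fun i _ => ?_
        rw [← sub_eq_add_neg]
        exact sub_smul (M := HVA κ k) (f i x) (f i a) (v i)
      change s.1 x - ∑ i, (f i x + -f i a) • v i = τ x
      rw [h1, sub_sub_cancel]

variable (κ k) in
/-- Evaluation at `a` identifies the fiber of `V̂` at `a` with the space of coinvariants. -/
def fiberEquiv (a : SpX X) : Fiber κ k X a ≃ₗ[ℂ] Coinv κ k a.1 :=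
  (Submodule.quotEquivOfEq _ _ (maxIdealStalk_eq_ker a)).trans
    ((evalStalk κ k a).quotKerEquivOfSurjective (evalStalk_surjective a))

lemma evalStalk_stalkAct_eq_zero {a : SpX X} {S : spPlus} (hS : S.1 ∈ spPlusF a.1.F)
    (σ : Stalk κ k X a) : evalStalk κ k a (stalkAct κ k S a σ) = 0 := by
  obtain ⟨s, rfl⟩ := toStalk_surjective a σ
  rw [stalkAct_toStalk, evalStalk_toStalk, Submodule.Quotient.mk_eq_zero]
  change fockDer κ k.level S (s.1 a) + lieDerivV X S s.1 a ∈ _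
  rw [lieDerivV_of_mem_spPlusF hS, add_zero]
  exact fockDer_mem_houtFiber a.1 k hS _

end Coinvariants

end Manifold

end HeisPPAV

end

theorem theorem5p1 {g : ℕ} (X : PPAV g)
    {Γ : Type*} [AddCommGroup Γ] [Module.Free ℤ Γ] [Module.Finite ℤ Γ]
    (q : LinearMap.BilinForm ℤ Γ) (hq : IsEvenPosDef q)
    {d : ℕ} (H : Module.Basis (Fin d) ℂ (Cartan Γ))
    (hH : ∀ i j, cartanForm q (H i) (H j) = if i = j then 1 else 0)
    (k : Kind) :
    -- `𝔥^out(X, Θ)(V ⊗ 𝒪)` is a subsheaf of `V ⊗ 𝒪`, and both are preserved by `sp⁺(H')`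
    (∀ U, hout (cartanForm q) k X U ≤ VO X (HVA (cartanForm q) k) U) ∧
    (∀ (S : spPlus) (U) (s), s ∈ VO X (HVA (cartanForm q) k) U →
      act (cartanForm q) k X H S s ∈ VO X (HVA (cartanForm q) k) U) ∧
    (∀ (S : spPlus) (U) (s), s ∈ hout (cartanForm q) k X U →
      act (cartanForm q) k X H S s ∈ hout (cartanForm q) k X U) ∧
    -- the induced action `ρ` on the sheaf `V̂(X, Θ, V)`
    ∃ ρ : (U : TopologicalSpace.Opens (SpX X)) →
        spPlus →ₗ⁅ℂ⁆ Module.End ℂ (Vhat (cartanForm q) k X U),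
      (∀ (U U') (hU : U ≤ U') (S : spPlus) (σ : Vhat (cartanForm q) k X U'),
        resVhat (cartanForm q) k X hU (ρ U' S σ) =
          ρ U S (resVhat (cartanForm q) k X hU σ)) ∧
      (∀ (U) (S : spPlus) (s s' : VO X (HVA (cartanForm q) k) U),
        s'.1 = act (cartanForm q) k X H S s.1 →
          ρ U S (toVhat (cartanForm q) k X U s) = toVhat (cartanForm q) k X U s') ∧
      -- the fiber at `a` is `V̂(a, V)`, and `sp⁺_F(H')` acts trivially on it
      ∀ a : SpX X, ∃ e : Fiber (cartanForm q) k X a ≃ₗ[ℂ] Coinv (cartanForm q) k a.1,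
        (∀ (U) (ha : a ∈ U) (s : VO X (HVA (cartanForm q) k) U),
          e (Submodule.Quotient.mk (germ (cartanForm q) k X U a ha s)) =
            Submodule.Quotient.mk (s.1 a)) ∧
        ∀ S : spPlus, S.1 ∈ spPlusF a.1.F →
          ∀ (U) (ha : a ∈ U) (σ : Vhat (cartanForm q) k X U),
            e (Submodule.Quotient.mk ((ρ U S σ).1 ⟨a, ha⟩)) = 0 := by

  -- The action on `V̂` is defined germ by germ and the fiber isomorphism by evaluation, so
  -- compatibility with restriction and the formula for `e` hold by definition. Orthonormality of
  -- `H` enters only in replacing `act` by `derAct`.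
  refine ⟨fun U => hout_le_VO _ k U, fun S U s hs => ?_, fun S U s hs => ?_,
    fun U => vhatRep _ k U, fun U U' hU S σ => rfl, fun U S s s' hs' => ?_,
    fun a => ⟨fiberEquiv _ k a, fun U ha s => rfl, fun S hS U ha σ => ?_⟩⟩
  · rw [act_eq_derAct k hH]
    exact derAct_mem_VO hs _ S
  · rw [act_eq_derAct k hH]
    exact derAct_mem_hout hs S
  · obtain ⟨s', hs'VO⟩ := s'
    rw [act_eq_derAct k hH] at hs'
    subst hs'
    rfl
  · exact evalStalk_stalkAct_eq_zero hS _
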